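/- Let $d,m\ge 1$ be integers and let $\sigma,c>0$. A dataset is a finite tuple of points of $\mathbb R^d$, and $|D|$ denotes the number of points of $D$. Let $\Theta$ be the class of all probability distributions $\theta$ on $\mathbb R^d$ each of whose coordinates has a finite second moment and variance at most $\sigma^2$, and let $\mu(\theta)$ be the mean of $\theta$. *Setting.* A mechanism $M$ for $m$ agents consists of a space of allocations $\mathcal A$ and a (possibly randomized) procedure which maps $m$ submitted datasets to $m$ allocations. A strategy of agent $i$ is $s_i=(n_i,f_i,h_i)$: she collects a dataset $X_i$ of $n_i\in\mathbb N$ independent samples from $\theta$, at cost $c$ per sample, submits the dataset $Y_i=f_i(X_i)$, receives the allocation $A_i$, and estimates $\mu(\theta)$ by $h_i(X_i,Y_i,A_i)$, where $f_i,h_i$ are measurable. Samples of different agents are independent. Her penalty is $$p_i(M,s)=\sup_{\theta\in\Theta}\mathbb E\big[\|h_i(X_i,Y_i,A_i)-\mu(\theta)\|_2^2\big]+c\,n_i .$$ The social penalty is $P(M,s)=\sum_i p_i(M,s)$, and $\mathrm{PoS}(M,s)=P(M,s)/\inf_{M',s'}P(M',s')$, the infimum being over all mechanisms and strategy profiles.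 $M$ is individually rational at $s$ if for every $i$, $p_i(M,s)$ is at most the infimum over $n\in\mathbb N$ and measurable estimators $h$ of $\sup_{\theta\in\Theta}\mathbb E[\|h(X)-\mu(\theta)\|_2^2]+cn$, where $X$ consists of $n$ independent samples from $\theta$. *Parameters.* Let $n^*=\frac{\sigma}{m}\sqrt{d/c}$ if $m\le 4$ and $n^*=\sigma\sqrt{d/(cm)}$ if $m\ge5$, and assume that $n^*$ is an integer. For $m\ge 5$ put $\tilde c=c/d$ and let $\alpha$ be the smallest number larger than $\sqrt\sigma(\tilde cm)^{-1/4}$ with $G(\alpha)=0$, where $$G(\alpha)=\Big(\tfrac{m-4}{m-2}\tfrac{4\alpha^2}{\sigma/\sqrt{\tilde cm}}-1\Big)\tfrac{4\alpha}{\sqrt\sigma(m/\tilde c)^{1/4}}-\Big(4(m+1)\tfrac{\alpha^2}{\sigma\sqrt{m/\tilde c}}-1\Big)\sqrt{2\pi}\exp\Big(\tfrac{\sigma\sqrt{m/\tilde c}}{8\alpha^2}\Big)\operatorname{erfc}\Big(\tfrac{\sqrt\sigma(m/\tilde c)^{1/4}}{2\sqrt2\,\alpha}\Big).$$ *The mechanism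 CCCD.* Let $Y_{-i}$ be the union (with multiplicity) of the datasets $Y_j$, $j\ne i$. If $m\le4$, agent $i$ receives $A_i=(Y_{-i},\emptyset,0)$. If $m\ge5$, the mechanism samples $\min\{|Y_{-i}|,\sigma\sqrt{d/(cm)}\}$ points of $Y_{-i}$ uniformly without replacement to obtain $Z_i$; puts, in each coordinate $k$, $\eta_{i,k}^2=\alpha^2\big(\overline{Y_i}^{(k)}-\overline{Z_i}^{(k)}\big)^2$, where $\overline{D}$ is the sample mean of $D$ ($0$ if $D$ is empty); obtains $Z_i'$ from the points of $Y_{-i}\setminus Z_i$ by adding to coordinate $k$ of each of them independent noise with distribution $\mathcal N(0,\eta_{i,k}^2)$; and returns $A_i=(Z_i,Z_i',\eta_i^2)$. *Recommended strategies.* In the profile $s^*$ each agent collects $n^*$ points, submits them unchanged, and uses the estimate $$\frac{\frac1{\sigma^2}\sum_{u\in X_i\cup Z_i}u+\frac1{\sigma^2+\tau^2}\sum_{u\in Z_i'}u}{\frac1{\sigma^2}\big(|X_i|+|Z_i|\big)+\frac1{\sigma^2+\tau^2}|Z_i'|},\qquad \tau^2=\frac{2\alpha^2\sigma^2}{n^*}$$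 (for $m\le4$ the set $Z_i'$ is empty and $\tau^2$ plays no role). *Theorem.* For $m\ge5$ the number $\alpha$ exists, and for every $m\ge1$ the following hold for $M=\mathrm{CCCD}$. (i) $s^*$ is an approximate Nash equilibrium: for every agent $i$ and every strategy $s_i$, $p_i(M,s^*)\le p_i(M,(s_i,s^*_{-i}))\,(1+5/m)$. (ii) $M$ is individually rational at $s^*$. (iii) $P(M,s^*)$ is finite and $\mathrm{PoS}(M,s^*)<2+10/m$. -/

import Mathlib

open MeasureTheory ProbabilityTheory
open scoped ENNReal NNReal

universe u v

namespace CCCD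

/-- Points of `ℝ^d`, given by their coordinates. -/
abbrev Vec (d : ℕ) : Type := Fin d → ℝ

/-- The squared Euclidean distance on `ℝ^d`. -/
def sqDist {d : ℕ} (x y : Vec d) : ℝ := ∑ k, (x k - y k) ^ 2

/-- Finite datasets `⋃ n, (ℝ^d)^n`: a size together with that many points. -/
abbrev Dataset (d : ℕ) : Type := Σ n : ℕ, (Fin n → Vec d)

namespace Dataset

variable {d m : ℕ}

/-- The number of points of a dataset. -/
def size (D : Dataset d) : ℕ := D.1

/-- The empty dataset. -/
def empty : Dataset d := ⟨0, Fin.elim0⟩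

/-- The sum of the points of a dataset. -/
def sum (D : Dataset d) : Vec d := ∑ j : Fin D.1, D.2 j

/-- The sample mean of a dataset (the origin for the empty dataset). -/
noncomputable def mean (D : Dataset d) : Vec d := fun k => (D.1 : ℝ)⁻¹ * D.sum k

/-- The points of a dataset rearranged by a permutation. -/
def permute (D : Dataset d) (π : Equiv.Perm (Fin D.1)) : Dataset d := ⟨D.1, fun j => D.2 (π j)⟩

/-- The first `min |D| k` points. -/
def take (k : ℕ) (D : Dataset d) : Dataset d :=
  ⟨min D.1 k, fun j => D.2 (Fin.castLE (min_le_left _ _) j)⟩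

/-- All points but the first `min |D| k`. -/
def drop (k : ℕ) (D : Dataset d) : Dataset d :=
  ⟨D.1 - k, fun j => D.2 ⟨k + j.1, by have := j.2; omega⟩⟩

/-- Each point `z` is replaced by `z + ε_z`. -/
def addNoise (D : Dataset d) (ε : Fin D.1 → Vec d) : Dataset d := ⟨D.1, fun j => D.2 j + ε j⟩

/-- The union (with multiplicity) of the datasets `Y j`, `j ≠ i`, listed in an order that depends
only on the sizes of these datasets. -/
noncomputable def others (i : Fin m) (Y : Fin m → Dataset d) : Dataset d :=
  ⟨Fintype.card (Σ j : {j : Fin m // j ≠ i}, Fin (Y j).1), fun t =>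
    let p := (Fintype.equivFin (Σ j : {j : Fin m // j ≠ i}, Fin (Y j).1)).symm t
    (Y p.1).2 p.2⟩

end Dataset

/-! ### Distributions, mechanisms, strategies and penalties -/

/-- The mean `μ(θ)` of a distribution on `ℝ^d`. -/
noncomputable def meanOf {d : ℕ} (θ : Measure (Vec d)) : Vec d := fun k => ∫ x, x k ∂θ

/-- The class `Θ` of all distributions on `ℝ^d` each of whose coordinates has a finite second
moment and variance at most `σ²`. -/
def boundedVariance (d : ℕ) (σ : ℝ) : Set (Measure (Vec d)) :=
  {θ | IsProbabilityMeasure θ ∧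
    ∀ k : Fin d, MemLp (fun x : Vec d => x k) 2 θ ∧ Var[fun x : Vec d => x k; θ] ≤ σ ^ 2}

/-- A (possibly randomized) mechanism for `m` agents: a space of allocations, and a procedure that
maps the `m` submitted datasets to `m` allocations. -/
structure Mechanism (d m : ℕ) where
  /-- the space of allocations -/
  Alloc : Type u
  [instAlloc : MeasurableSpace Alloc]
  /-- the law of the `m` allocations given the `m` submitted datasets -/
  law : Kernel (Fin m → Dataset d) (Fin m → Alloc)
  [isMarkov : IsMarkovKernel law]

attribute [instance] Mechanism.instAlloc Mechanism.isMarkov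

/-- A strategy of an agent: how many points to collect, how to turn the collected dataset into the
submitted one, and how to estimate the mean from the collected dataset, the submitted dataset and
the allocation. -/
structure Strategy (d : ℕ) (A : Type u) [MeasurableSpace A] where
  n : ℕ
  submit : Dataset d → Dataset d
  estimate : Dataset d → Dataset d → A → Vec d
  measurable_submit : Measurable submit
  measurable_estimate :
    Measurable fun p : Dataset d × Dataset d × A => estimate p.1 p.2.1 p.2.2

section Penalty

variable {d m : ℕ}

/-- The law of the collected points, all independent with distribution `θ`, when agent `j`
collects `n j` of them. -/
noncomputable def dataLaw (θ : Measure (Vec d)) (n : Fin m → ℕ) :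
    Measure ((j : Fin m) → Fin (n j) → Vec d) :=
  Measure.pi fun j => Measure.pi fun _ : Fin (n j) => θ

/-- The expected squared error `E[‖h_i(X_i, Y_i, A_i) - μ(θ)‖²]` of agent `i` when the points are
drawn from `θ`. The expectation is over the data of all agents and the randomness of the
mechanism. -/
noncomputable def risk (M : Mechanism.{u} d m) (s : Fin m → Strategy d M.Alloc) (i : Fin m)
    (θ : Measure (Vec d)) : ℝ≥0∞ :=
  ∫⁻ x : (j : Fin m) → Fin (s j).n → Vec d,
    ∫⁻ a : Fin m → M.Alloc,
      ENNReal.ofReal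
        (sqDist ((s i).estimate ⟨(s i).n, x i⟩ ((s i).submit ⟨(s i).n, x i⟩) (a i)) (meanOf θ))
      ∂(M.law fun j => (s j).submit ⟨(s j).n, x j⟩)
    ∂(dataLaw θ fun j => (s j).n)

/-- The penalty of agent `i`: her maximum risk over the class `Θ`, plus her cost of collecting
data. -/
noncomputable def penalty (σ c : ℝ) (M : Mechanism.{u} d m) (s : Fin m → Strategy d M.Alloc)
    (i : Fin m) : ℝ≥0∞ :=
  (⨆ θ ∈ boundedVariance d σ, risk M s i θ) + ENNReal.ofReal (c * (s i).n)

/-- The social penalty: the sum of the penalties of all agents. -/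
noncomputable def socialPenalty (σ c : ℝ) (M : Mechanism.{u} d m)
    (s : Fin m → Strategy d M.Alloc) : ℝ≥0∞ :=
  ∑ i, penalty σ c M s i

/-- The ratio of the social penalty of `M` at `s` to the lowest social penalty among all
mechanisms and all strategy profiles. -/
noncomputable def PoS (σ c : ℝ) (M : Mechanism.{u} d m) (s : Fin m → Strategy d M.Alloc) : ℝ≥0∞ :=
  socialPenalty σ c M s /
    ⨅ (M' : Mechanism.{v} d m) (s' : Fin m → Strategy d M'.Alloc), socialPenalty σ c M' s'

/-- The penalty of an agent who works on her own, collects `n` points and uses the estimator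
`h`. -/
noncomputable def alonePenalty (σ c : ℝ) (n : ℕ) (h : Dataset d → Vec d) : ℝ≥0∞ :=
  (⨆ θ ∈ boundedVariance d σ,
    ∫⁻ x : Fin n → Vec d, ENNReal.ofReal (sqDist (h ⟨n, x⟩) (meanOf θ))
      ∂(Measure.pi fun _ : Fin n => θ)) + ENNReal.ofReal (c * n)

/-- `M` is individually rational at `s`: no agent has a higher penalty than the lowest one that
she can achieve on her own. -/
def IndividuallyRational (σ c : ℝ) (M : Mechanism.{u} d m) (s : Fin m → Strategy d M.Alloc) :
    Prop :=
  ∀ i, penalty σ c M s i ≤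
    ⨅ (n : ℕ) (h : Dataset d → Vec d) (_ : Measurable h), alonePenalty σ c n h

end Penalty

/-! ### The parameters of the mechanism -/

/-- The complementary error function. -/
noncomputable def erfc (x : ℝ) : ℝ := 2 / √Real.pi * ∫ t in Set.Ioi x, Real.exp (-t ^ 2)

/-- The function whose root is the corruption parameter of the mechanism, for `m` agents, standard
deviation `σ` and cost `c` per point. -/
noncomputable def G (m σ c a : ℝ) : ℝ :=
  ((m - 4) / (m - 2) * (4 * a ^ 2 / (σ / √(c * m))) - 1)
      * (4 * a / (√σ * (m / c) ^ (1 / 4 : ℝ)))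
    - (4 * (m + 1) * (a ^ 2 / (σ * √(m / c))) - 1) * √(2 * Real.pi)
      * Real.exp (σ * √(m / c) / (8 * a ^ 2))
      * erfc (√σ * (m / c) ^ (1 / 4 : ℝ) / (2 * √2 * a))

/-- The roots of `G` larger than `√σ (c m)^(-1/4)`, with `c / d` in place of `c`. -/
def alphaSet (d m : ℕ) (σ c : ℝ) : Set ℝ :=
  {a | √σ * (c / d * m) ^ (-(1 / 4) : ℝ) < a ∧ G m σ (c / d) a = 0}

/-- The corruption parameter `α`: the smallest element of `alphaSet`. -/
noncomputable def alpha (d m : ℕ) (σ c : ℝ) : ℝ := sInf (alphaSet d m σ c)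

/-- The recommended number `n*` of points, as a real number. -/
noncomputable def nStar (d m : ℕ) (σ c : ℝ) : ℝ :=
  if m ≤ 4 then σ / m * √(d / c) else σ * √(d / (c * m))

/-! ### The mechanism -/

section Mechanism

variable {d m : ℕ}

/-- The space of allocations: an uncorrupted dataset, a corrupted dataset, and the variances of
the noise in each coordinate. -/
abbrev Allocation (d : ℕ) : Type := Dataset d × Dataset d × (Fin d → ℝ≥0)

/-- The variances `η² = α² (mean Y - mean Z)²`, computed in each coordinate, for a submission `Y`
and an uncorrupted dataset `Z`. -/
noncomputable def etaSq (α : ℝ) (Y Z : Dataset d) : Fin d → ℝ≥0 :=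
  fun k => (α ^ 2 * (Y.mean k - Z.mean k) ^ 2).toNNReal

/-- The law of independent noise with distribution `N(0, v k)` in coordinate `k`, for `N`
points. -/
noncomputable def noiseLaw (N : ℕ) (v : Fin d → ℝ≥0) : Measure (Fin N → Vec d) :=
  Measure.pi fun _ => Measure.pi fun k => gaussianReal 0 (v k)

/-- The law of the allocation of an agent with submission `Y`, when `D` is the union of the other
submissions and the first `min |D| k` points of `D` are the uncorrupted ones. -/
noncomputable def splitLaw (α : ℝ) (k : ℕ) (Y D : Dataset d) : Measure (Allocation d) :=
  (noiseLaw (D.drop k).1 (etaSq α Y (D.take k))).map fun ε =>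
    (D.take k, (D.drop k).addNoise ε, etaSq α Y (D.take k))

/-- The law of the allocation when the `min |D| k` uncorrupted points are sampled from `D`
uniformly without replacement: they are the first ones after a uniformly random permutation. -/
noncomputable def sampleLaw (α : ℝ) (k : ℕ) (Y D : Dataset d) : Measure (Allocation d) :=
  (Nat.factorial D.1 : ℝ≥0∞)⁻¹ •
    ∑ π : Equiv.Perm (Fin D.1), splitLaw α k Y (D.permute π)

/-- The law of the allocation of agent `i`, given the submissions `Y` of all agents. With at most
four agents she gets all the data of the other agents, uncorrupted. -/
noncomputable def allocLaw (α : ℝ) (k : ℕ) (i : Fin m) (Y : Fin m → Dataset d) :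
    Measure (Allocation d) :=
  if m ≤ 4 then Measure.dirac (Dataset.others i Y, Dataset.empty, 0)
  else sampleLaw α k (Y i) (Dataset.others i Y)

/-! Well-definedness: the laws above are probability measures that depend measurably on the
submissions. -/

instance (N : ℕ) (v : Fin d → ℝ≥0) : IsProbabilityMeasure (noiseLaw N v) := by
  unfold noiseLaw; infer_instance

theorem measurable_sigma {γ : Type*} [MeasurableSpace γ] {f : Dataset d → γ}
    (h : ∀ n : ℕ, Measurable fun x : Fin n → Vec d => f ⟨n, x⟩) : Measurable f := by
  intro s hs
  refine MeasurableSpace.measurableSet_iInf.2 fun n => ?_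
  exact h n hs

theorem measurable_sigmaMk (n : ℕ) : Measurable fun x : Fin n → Vec d => (⟨n, x⟩ : Dataset d) :=
  fun _ hs => MeasurableSpace.measurableSet_iInf.1 hs n

theorem measurable_size : Measurable (Dataset.size : Dataset d → ℕ) :=
  measurable_sigma fun _ => measurable_const

theorem measurable_sum : Measurable (Dataset.sum : Dataset d → Vec d) := by
  refine measurable_sigma fun n => ?_
  exact Finset.univ.measurable_sum fun j _ => measurable_pi_apply j

/-- A map on tuples of datasets is measurable if it is so for each choice of the sizes. -/
theorem measurable_of_sizes {γ : Type*} [MeasurableSpace γ] {f : (Fin m → Dataset d) → γ}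
    (h : ∀ n : Fin m → ℕ,
      Measurable fun x : (j : Fin m) → Fin (n j) → Vec d => f fun j => ⟨n j, x j⟩) :
    Measurable f := by
  let r : (n : ℕ) → Dataset d → Fin n → Vec d :=
    fun n D j => if h : j.1 < D.1 then D.2 ⟨j.1, h⟩ else 0
  have hr : ∀ n, Measurable (r n) := fun n => by
    refine measurable_sigma fun k => measurable_pi_iff.2 fun j => ?_
    by_cases hj : j.1 < k
    · simp only [r, hj, dite_true]; exact measurable_pi_apply (⟨j.1, hj⟩ : Fin k)
    · simp only [r, hj, dite_false]; exact measurable_const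
  have hr' : ∀ D : Dataset d, (⟨D.1, r D.1 D⟩ : Dataset d) = D := fun D => by
    simp [r]
  let g : (Fin m → ℕ) × (Fin m → Dataset d) → γ := fun p => f fun j => ⟨p.1 j, r (p.1 j) (p.2 j)⟩
  have hg : Measurable g := by
    refine measurable_from_prod_countable_right fun n => ?_
    exact (h n).comp (measurable_pi_iff.2 fun j => (hr (n j)).comp (measurable_pi_apply j))
  have hs : Measurable fun Y : Fin m → Dataset d => ((fun j => (Y j).size), Y) :=
    (measurable_pi_iff.2 fun j => measurable_size.comp (measurable_pi_apply j)).prodMk measurable_id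
  have hfg : f = fun Y => g ((fun j => (Y j).size), Y) := by
    funext Y
    simp only [g, Dataset.size, hr']
  rw [hfg]
  exact hg.comp hs

/-- A product of probability measures depends measurably on its factors. -/
theorem measurable_piLaw {ι X : Type*} [Fintype ι] [MeasurableSpace X] {β : ι → Type*}
    [∀ i, MeasurableSpace (β i)] {μ : X → (i : ι) → Measure (β i)}
    [∀ x i, IsProbabilityMeasure (μ x i)] (hμ : ∀ i, Measurable fun x => μ x i) :
    Measurable fun x => Measure.pi (μ x) := by
  refine Measurable.measure_of_isPiSystem_of_isProbabilityMeasure generateFrom_pi.symm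
    isPiSystem_pi ?_
  rintro _ ⟨t, ht, rfl⟩
  simp only [Measure.pi_pi]
  exact Finset.measurable_prod _ fun i _ =>
    (Measure.measurable_coe (ht i (Set.mem_univ i))).comp (hμ i)

theorem measurable_mapLaw {X Y Z : Type*} [MeasurableSpace X] [MeasurableSpace Y]
    [MeasurableSpace Z] {μ : X → Measure Y} [∀ x, IsProbabilityMeasure (μ x)] (hμ : Measurable μ)
    {F : X → Y → Z} (hF : Measurable fun p : X × Y => F p.1 p.2) :
    Measurable fun x => (μ x).map (F x) := by
  refine Measure.measurable_of_measurable_coe _ fun s hs => ?_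
  let κ : Kernel X Y := ⟨μ, hμ⟩
  have : IsMarkovKernel κ := ⟨fun x => inferInstanceAs (IsProbabilityMeasure (μ x))⟩
  have h := Kernel.measurable_kernel_prodMk_left (κ := κ) (hF hs)
  have hx : ∀ x, Measurable (F x) := fun x => hF.comp (measurable_const.prodMk measurable_id)
  simp only [Measure.map_apply (hx _) hs]
  exact h

theorem measurable_noiseLaw (N : ℕ) : Measurable (noiseLaw N : (Fin d → ℝ≥0) → _) := by
  unfold noiseLaw
  refine measurable_piLaw fun _ => measurable_piLaw fun k => ?_
  exact measurable_gaussianReal.comp (measurable_const.prodMk (measurable_pi_apply k))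

instance (α : ℝ) (k : ℕ) (Y D : Dataset d) : IsProbabilityMeasure (splitLaw α k Y D) := by
  refine Measure.isProbabilityMeasure_map (Measurable.aemeasurable ?_)
  refine measurable_const.prodMk (Measurable.prodMk ?_ measurable_const)
  refine (measurable_sigmaMk (D.drop k).1).comp ?_
  fun_prop

instance (α : ℝ) (k : ℕ) (Y D : Dataset d) : IsProbabilityMeasure (sampleLaw α k Y D) := by
  constructor
  simp only [sampleLaw, Measure.smul_apply, Measure.finsetSum_apply, measure_univ, smul_eq_mul,
    Finset.sum_const, Finset.card_univ, Fintype.card_perm, Fintype.card_fin, nsmul_eq_mul, mul_one]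
  exact ENNReal.inv_mul_cancel (by exact_mod_cast Nat.factorial_ne_zero _) (by simp)

instance (α : ℝ) (k : ℕ) (i : Fin m) (Y : Fin m → Dataset d) :
    IsProbabilityMeasure (allocLaw α k i Y) := by
  unfold allocLaw; split_ifs <;> infer_instance

theorem measurable_sampleLaw (α : ℝ) (k n N : ℕ) :
    Measurable fun p : (Fin n → Vec d) × (Fin N → Vec d) =>
      sampleLaw α k (⟨n, p.1⟩ : Dataset d) ⟨N, p.2⟩ := by
  refine Measure.measurable_of_measurable_coe _ fun s hs => ?_
  simp only [sampleLaw, Measure.smul_apply, Measure.finsetSum_apply, smul_eq_mul]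
  suffices h : ∀ π : Equiv.Perm (Fin N), Measurable fun p : (Fin n → Vec d) × (Fin N → Vec d) =>
      splitLaw α k (⟨n, p.1⟩ : Dataset d) (Dataset.permute ⟨N, p.2⟩ π) from
    Measurable.const_mul (Finset.univ.measurable_sum fun π _ =>
      (Measure.measurable_coe hs).comp (h π)) _
  intro π
  have hz : Measurable fun p : (Fin n → Vec d) × (Fin N → Vec d) =>
      (Dataset.permute ⟨N, p.2⟩ π).take k :=
    (measurable_sigmaMk (min N k)).comp (measurable_pi_iff.2 fun j =>
      (measurable_pi_apply (π (Fin.castLE (min_le_left N k) j))).comp measurable_snd)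
  have hmean : ∀ l, Measurable fun D : Dataset d => D.mean l := fun l =>
    (Measurable.inv (measurable_from_top.comp measurable_size)).mul
      ((measurable_pi_apply l).comp measurable_sum)
  have hv : Measurable fun p : (Fin n → Vec d) × (Fin N → Vec d) =>
      etaSq α (⟨n, p.1⟩ : Dataset d) ((Dataset.permute ⟨N, p.2⟩ π).take k) :=
    measurable_pi_iff.2 fun l => Measurable.real_toNNReal
      (((((hmean l).comp ((measurable_sigmaMk n).comp measurable_fst)).sub
        ((hmean l).comp hz)).pow_const 2).const_mul _)
  refine measurable_mapLaw (Y := Fin (N - k) → Vec d)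
    (μ := fun p : (Fin n → Vec d) × (Fin N → Vec d) => noiseLaw (N - k)
      (etaSq α (⟨n, p.1⟩ : Dataset d) ((Dataset.permute ⟨N, p.2⟩ π).take k)))
    ((measurable_noiseLaw _).comp hv) ?_
  refine (hz.comp measurable_fst).prodMk (Measurable.prodMk ?_ (hv.comp measurable_fst))
  refine (measurable_sigmaMk (N - k)).comp (measurable_pi_iff.2 fun j => ?_)
  have hj : k + j.1 < N := by have := j.2; omega
  have h1 : Measurable fun q : ((Fin n → Vec d) × (Fin N → Vec d)) × (Fin (N - k) → Vec d) =>
      q.1.2 (π ⟨k + j.1, hj⟩) :=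
    (measurable_pi_apply (π ⟨k + j.1, hj⟩)).comp (measurable_snd.comp measurable_fst)
  have h2 : Measurable fun q : ((Fin n → Vec d) × (Fin N → Vec d)) × (Fin (N - k) → Vec d) =>
      q.2 j := (measurable_pi_apply j).comp measurable_snd
  exact h1.add h2

theorem measurable_allocLaw (α : ℝ) (k : ℕ) (i : Fin m) :
    Measurable (allocLaw α k i : (Fin m → Dataset d) → _) := by
  refine measurable_of_sizes fun n => ?_
  obtain ⟨N, P, hP, ho⟩ : ∃ (N : ℕ) (P : ((j : Fin m) → Fin (n j) → Vec d) → Fin N → Vec d),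
      Measurable P ∧ ∀ x : (j : Fin m) → Fin (n j) → Vec d,
        Dataset.others i (fun j => (⟨n j, x j⟩ : Dataset d)) = ⟨N, P x⟩ := by
    let e := Fintype.equivFin (Σ j : {j : Fin m // j ≠ i}, Fin (n j))
    refine ⟨_, fun x t => x (e.symm t).1 (e.symm t).2, ?_, fun _ => rfl⟩
    exact measurable_pi_iff.2 fun t => (measurable_pi_apply (e.symm t).2).comp
      (measurable_pi_apply ((e.symm t).1 : Fin m))
  simp only [allocLaw, ho]
  split_ifs
  · have h : Measurable fun x => ((⟨N, P x⟩, Dataset.empty, 0) : Allocation d) :=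
      ((measurable_sigmaMk N).comp hP).prodMk measurable_const
    exact Measure.measurable_dirac.comp h
  · have h : Measurable fun x : (j : Fin m) → Fin (n j) → Vec d => (x i, P x) :=
      (measurable_pi_apply i).prodMk hP
    have h2 := (measurable_sampleLaw α k (n i) N).comp h
    simp only [Function.comp_def] at h2
    exact h2

/-- The mechanism, with corruption parameter `α` and with `⌊σ √(d / (c m))⌋` as the largest size of
an uncorrupted sample. The agents' allocations are drawn independently given the submissions. -/
noncomputable def mechanism (d m : ℕ) (σ c : ℝ) : Mechanism.{0} d m where
  Alloc := Allocation d
  law :=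
    { toFun := fun Y =>
        Measure.pi fun i => allocLaw (alpha d m σ c) ⌊σ * √(d / (c * m))⌋₊ i Y
      measurable' := measurable_piLaw fun i => measurable_allocLaw _ _ i }
  isMarkov := ⟨fun Y => inferInstanceAs (IsProbabilityMeasure
    (Measure.pi fun i => allocLaw (alpha d m σ c) ⌊σ * √(d / (c * m))⌋₊ i Y))⟩

/-! ### The recommended strategies -/

/-- The weighting parameter `τ² = 2 α² σ² / n*`. -/
noncomputable def tauSq (d m : ℕ) (σ c : ℝ) : ℝ :=
  2 * alpha d m σ c ^ 2 * σ ^ 2 / nStar d m σ c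

/-- The weighted average in which the points of the collected dataset `X` and of the uncorrupted
dataset `Z` have weight `1 / σ²`, and those of the corrupted dataset `Z'` have weight
`1 / (σ² + τ²)`. -/
noncomputable def weightedMean (σ τsq : ℝ) (X Z Z' : Dataset d) : Vec d := fun k =>
  (1 / σ ^ 2 * (X.sum k + Z.sum k) + 1 / (σ ^ 2 + τsq) * Z'.sum k) /
    (1 / σ ^ 2 * (X.size + Z.size) + 1 / (σ ^ 2 + τsq) * Z'.size)

/-- The recommended strategy of an agent: collect `n*` points, submit them as they are, and use
the weighted average. -/
noncomputable def recommended (d m : ℕ) (σ c : ℝ) : Strategy d (mechanism d m σ c).Alloc where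
  n := ⌊nStar d m σ c⌋₊
  submit := id
  estimate := fun X _ A => weightedMean σ (tauSq d m σ c) X A.1 A.2.1
  measurable_submit := measurable_id
  measurable_estimate := by
    refine measurable_pi_iff.2 fun k => ?_
    have hs : ∀ {f : Dataset d × Dataset d × Allocation d → Dataset d}, Measurable f →
        Measurable fun p => (f p).sum k := fun hf =>
      (measurable_pi_apply k).comp (measurable_sum.comp hf)
    have hn : ∀ {f : Dataset d × Dataset d × Allocation d → Dataset d}, Measurable f →
        Measurable fun p => ((f p).size : ℝ) := fun hf =>
      measurable_from_top.comp (measurable_size.comp hf)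
    have h1 : Measurable fun p : Dataset d × Dataset d × Allocation d => p.1 := measurable_fst
    have h2 : Measurable fun p : Dataset d × Dataset d × Allocation d => p.2.2.1 :=
      measurable_fst.comp (measurable_snd.comp measurable_snd)
    have h3 : Measurable fun p : Dataset d × Dataset d × Allocation d => p.2.2.2.1 :=
      measurable_fst.comp (measurable_snd.comp (measurable_snd.comp measurable_snd))
    exact ((((hs h1).add (hs h2)).const_mul _).add ((hs h3).const_mul _)).div
      ((((hn h1).add (hn h2)).const_mul _).add ((hn h3).const_mul _))

/-- The recommended strategy profile. -/
noncomputable def recommendedProfile (d m : ℕ) (σ c : ℝ) :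
    Fin m → Strategy d (mechanism d m σ c).Alloc :=
  fun _ => recommended d m σ c

end Mechanism

end CCCD

namespace CCCD

/-! ### Products of Gaussian measures -/

section Pi

variable {ι : Type*} [Fintype ι] {E : ι → Type*} [∀ i, MeasurableSpace (E i)]

/-! Both halves of the theorem compare explicit numbers: an upper bound for the penalty at `s*` and
lower bounds for deviations, for working alone and for arbitrary mechanisms.

All lower bounds are Bayesian. The class `Θ` contains every Gaussian with coordinate variances `σ²`,
so a maximum risk is at least the average risk over a Gaussian prior on the mean, of precision
`δ/σ²`. By conjugacy the posterior is Gaussian, its precision does not depend on the observed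
values, and no estimator beats the posterior variance. The predicate `BayesDominates` packages this
so that observations can be processed one after another, their precisions adding up. Letting `δ → 0`
removes the prior. For an arbitrary mechanism, `T` points in total give risk at least `dσ²/T`, and
AM-GM bounds `dσ²/T + cT` and its social analogue (`ofReal_le_socialPenalty_of_sq`).

For `m ≤ 4` all data are shared, and the same AM-GM inequality shows that `n*` is a best response.

For `m ≥ 5` write `N = n*` and `α² = tN`. Under `s*` the noise variance has expectation at most
`τ²`, and the recommended weights give risk at most `(dσ²/N)(1+2t)/(m+4t)`
(`splitRisk_recommended_le`). For a deviating agent, the noise variance is `α²(b - Z̄)²`, where `b`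
is the mean of her submission; given her data, `Z̄` is Gaussian. The posterior variance grows with
`|b - Z̄|`, so by a rearrangement inequality (`lintegral_gaussianReal_zero_le`) she can do no better
than to centre `b`. With `X` the number of her points divided by `N`, this leaves
(`ofReal_le_iSup_splitRisk`) the lower bound `(dσ²/N)(E[1/(X + 1 + (m-2)/(1 + tz²(1+1/X)))] + X/m)`,
with `z` standard normal. For each `z` the integrand lies above its tangent in `X` at `X = 1`. The
equation `G(α) = 0` says exactly that the averaged tangent has slope `-1/m`, so `X = 1` is the
minimum (`le_integral_postVar_scaled`), with value `(10t-1)/(4t(m+1)-m) + 1/m`.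

What remains is to locate `t`. In the variable `t`, `G` becomes `balance m t`, in which erfc enters
through `mills y = E[1/(1+yz²)]`. Rational bounds for `mills` give a sign change on `(1, rootBound
m]` for `m ≥ 9` and on `(1, 100]` for `5 ≤ m ≤ 8`, and the three claims become rational inequalities
in `m` and `t`. -/

theorem lintegral_fin_prod {n : ℕ} {E : Fin n → Type*} [∀ i, MeasurableSpace (E i)]
    (μ : (i : Fin n) → Measure (E i)) [∀ i, SigmaFinite (μ i)] (f : (i : Fin n) → E i → ℝ≥0∞)
    (hf : ∀ i, Measurable (f i)) :
    ∫⁻ x, ∏ i, f i (x i) ∂Measure.pi μ = ∏ i, ∫⁻ x, f i x ∂μ i := by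
  induction n with
  | zero => simp
  | succ n ih =>
    calc
      _ = ∫⁻ x : E 0 × ((i : Fin n) → E (Fin.succ i)), f 0 x.1 * ∏ i : Fin n, f i.succ (x.2 i)
            ∂((μ 0).prod (Measure.pi fun i => μ i.succ)) := by
          refine (((measurePreserving_piFinSuccAbove μ 0).symm).lintegral_comp
            (f := fun x => ∏ i, f i (x i))
            (Finset.measurable_prod _ fun i _ => (hf i).comp (measurable_pi_apply i))).symm.trans
            (lintegral_congr fun x => ?_)
          rw [Fin.prod_univ_succ]
          rfl
      _ = (∫⁻ x, f 0 x ∂μ 0) * ∏ i : Fin n, ∫⁻ x, f i.succ x ∂μ i.succ := by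
          rw [← ih (fun i => μ i.succ) (fun i => f i.succ) fun i => hf i.succ,
            ← lintegral_prod_mul (hf 0).aemeasurable (Finset.measurable_prod _ fun i _ =>
              (hf i.succ).comp (measurable_pi_apply i)).aemeasurable]
      _ = _ := by rw [Fin.prod_univ_succ]

theorem lintegral_fintype_prod (μ : (i : ι) → Measure (E i)) [∀ i, SigmaFinite (μ i)]
    (f : (i : ι) → E i → ℝ≥0∞) (hf : ∀ i, Measurable (f i)) :
    ∫⁻ x, ∏ i, f i (x i) ∂Measure.pi μ = ∏ i, ∫⁻ x, f i x ∂μ i := by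
  let e := (Fintype.equivFin ι).symm
  rw [← (measurePreserving_piCongrLeft μ e).lintegral_comp (by fun_prop)]
  simp_rw [← e.prod_comp, MeasurableEquiv.coe_piCongrLeft, Equiv.piCongrLeft_apply_apply]
  exact lintegral_fin_prod _ _ fun i => hf _

theorem pi_withDensity (μ : (i : ι) → Measure (E i)) [∀ i, SigmaFinite (μ i)]
    (f : (i : ι) → E i → ℝ≥0∞) (hf : ∀ i, Measurable (f i))
    [∀ i, SigmaFinite ((μ i).withDensity (f i))] :
    Measure.pi (fun i => (μ i).withDensity (f i)) =
      (Measure.pi μ).withDensity fun x => ∏ i, f i (x i) := by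
  refine Measure.pi_eq fun s hs => ?_
  rw [withDensity_apply _ (MeasurableSet.univ_pi hs),
    ← lintegral_indicator (MeasurableSet.univ_pi hs)]
  have h : ∀ x : (i : ι) → E i, (Set.univ.pi s).indicator (fun x => ∏ i, f i (x i)) x =
      ∏ i, (s i).indicator (f i) (x i) := fun x => by
    by_cases hx : x ∈ Set.univ.pi s
    · rw [Set.indicator_of_mem hx]
      exact Finset.prod_congr rfl fun i _ => (Set.indicator_of_mem (hx i trivial) _).symm
    · rw [Set.indicator_of_notMem hx]
      simp only [Set.mem_univ_pi, not_forall] at hx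
      obtain ⟨i, hi⟩ := hx
      exact (Finset.prod_eq_zero (Finset.mem_univ i) (Set.indicator_of_notMem hi _)).symm
  simp_rw [h]
  rw [lintegral_fintype_prod μ _ fun i => (hf i).indicator (hs i)]
  exact Finset.prod_congr rfl fun i _ => by
    rw [lintegral_indicator (hs i), withDensity_apply _ (hs i)]

end Pi

/-- The Gaussian measure on `ℝ^d` with mean `a` and independent coordinates of precisions `s`. -/
noncomputable def gaussPrec {d : ℕ} (a : Vec d) (s : Fin d → ℝ≥0) : Measure (Vec d) :=
  Measure.pi fun k => gaussianReal (a k) (s k)⁻¹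

instance {d : ℕ} (a : Vec d) (s : Fin d → ℝ≥0) : IsProbabilityMeasure (gaussPrec a s) := by
  unfold gaussPrec; infer_instance

/-- Bayes' formula for a Gaussian prior and a Gaussian observation, on the level of densities. -/
theorem gaussianPDFReal_mul_gaussianPDFReal {s r : ℝ≥0} (hs : 0 < s) (hr : 0 < r) (a x y : ℝ) :
    gaussianPDFReal a s⁻¹ x * gaussianPDFReal x r⁻¹ y =
      gaussianPDFReal a (s⁻¹ + r⁻¹) y *
        gaussianPDFReal ((s * a + r * y) / (s + r)) (s + r)⁻¹ x := by
  have hs' : (0 : ℝ) < s := hs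
  have hr' : (0 : ℝ) < r := hr
  have hsr : (0 : ℝ) < s + r := by positivity
  simp only [gaussianPDFReal, NNReal.coe_inv, NNReal.coe_add]
  rw [mul_mul_mul_comm, mul_mul_mul_comm (√(2 * Real.pi * ((s : ℝ)⁻¹ + (r : ℝ)⁻¹)))⁻¹,
    ← Real.exp_add, ← Real.exp_add, ← mul_inv, ← mul_inv, ← Real.sqrt_mul (by positivity),
    ← Real.sqrt_mul (by positivity)]
  have h1 : 2 * Real.pi * (s : ℝ)⁻¹ * (2 * Real.pi * (r : ℝ)⁻¹) =
      2 * Real.pi * ((s : ℝ)⁻¹ + (r : ℝ)⁻¹) * (2 * Real.pi * ((s : ℝ) + r)⁻¹) := by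
    field_simp
    ring
  have h2 : -(x - a) ^ 2 / (2 * (s : ℝ)⁻¹) + -(y - x) ^ 2 / (2 * (r : ℝ)⁻¹) =
      -(y - a) ^ 2 / (2 * ((s : ℝ)⁻¹ + (r : ℝ)⁻¹)) +
        -(x - (s * a + r * y) / (s + r)) ^ 2 / (2 * ((s : ℝ) + r)⁻¹) := by
    field_simp
    ring
  rw [h1, h2]

/-- Exchanging the order in a joint law given by densities. -/
theorem lintegral_withDensity_swap {α β : Type*} [MeasurableSpace α] [MeasurableSpace β]
    {μ : Measure α} {ν : Measure β} [SFinite μ] [SFinite ν] {f : α → ℝ≥0∞} {g : α → β → ℝ≥0∞}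
    {h : β → ℝ≥0∞} {q : β → α → ℝ≥0∞} (hf : Measurable f) (hg : Measurable (Function.uncurry g))
    (hh : Measurable h) (hq : Measurable (Function.uncurry q))
    (heq : ∀ x y, f x * g x y = h y * q y x) {F : α → β → ℝ≥0∞}
    (hF : Measurable (Function.uncurry F)) :
    ∫⁻ x, ∫⁻ y, F x y ∂ν.withDensity (g x) ∂μ.withDensity f =
      ∫⁻ y, ∫⁻ x, F x y ∂μ.withDensity (q y) ∂ν.withDensity h := by
  have hF1 : ∀ x, Measurable (F x) := fun x => hF.comp measurable_prodMk_left
  have hF2 : ∀ y, Measurable fun x => F x y := fun y => hF.comp measurable_prodMk_right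
  have hg1 : ∀ x, Measurable (g x) := fun x => hg.comp measurable_prodMk_left
  have hq1 : ∀ y, Measurable (q y) := fun y => hq.comp measurable_prodMk_left
  have e1 : ∀ x, ∫⁻ y, F x y ∂ν.withDensity (g x) = ∫⁻ y, g x y * F x y ∂ν := fun x =>
    lintegral_withDensity_eq_lintegral_mul _ (hg1 x) (hF1 x)
  have e2 : ∀ y, ∫⁻ x, F x y ∂μ.withDensity (q y) = ∫⁻ x, q y x * F x y ∂μ := fun y =>
    lintegral_withDensity_eq_lintegral_mul _ (hq1 y) (hF2 y)
  have m1 : Measurable fun x => ∫⁻ y, g x y * F x y ∂ν :=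
    Measurable.lintegral_prod_right' (f := fun p : α × β => g p.1 p.2 * F p.1 p.2) (hg.mul hF)
  have m2 : Measurable fun y => ∫⁻ x, q y x * F x y ∂μ :=
    Measurable.lintegral_prod_right' (f := fun p : β × α => q p.1 p.2 * F p.2 p.1)
      (hq.mul (hF.comp measurable_swap))
  simp_rw [e1, e2]
  rw [lintegral_withDensity_eq_lintegral_mul _ hf m1, lintegral_withDensity_eq_lintegral_mul _ hh m2]
  simp only [Pi.mul_apply]
  have e3 : ∀ x, f x * ∫⁻ y, g x y * F x y ∂ν = ∫⁻ y, f x * (g x y * F x y) ∂ν := fun x =>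
    (lintegral_const_mul _ ((hg1 x).mul (hF1 x))).symm
  have e4 : ∀ y, h y * ∫⁻ x, q y x * F x y ∂μ = ∫⁻ x, h y * (q y x * F x y) ∂μ := fun y =>
    (lintegral_const_mul _ ((hq1 y).mul (hF2 y))).symm
  simp_rw [e3, e4]
  rw [lintegral_lintegral_swap (((hf.comp measurable_fst).mul (hg.mul hF)).aemeasurable)]
  simp_rw [← mul_assoc, heq]

/-! ### Conjugate Gaussian priors and successive observations -/

section Bayes

variable {d : ℕ}

theorem gaussPrec_eq_withDensity (a : Vec d) {s : Fin d → ℝ≥0} (hs : ∀ k, 0 < s k) :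
    gaussPrec a s = (volume : Measure (Vec d)).withDensity
      fun x => ∏ k, gaussianPDF (a k) (s k)⁻¹ (x k) := by
  have h : ∀ k, gaussianReal (a k) (s k)⁻¹ =
      (volume : Measure ℝ).withDensity (gaussianPDF (a k) (s k)⁻¹) := fun k =>
    gaussianReal_of_var_ne_zero _ (inv_ne_zero (hs k).ne')
  have hσ : ∀ k, SigmaFinite ((volume : Measure ℝ).withDensity (gaussianPDF (a k) (s k)⁻¹)) :=
    fun k => by rw [← h k]; infer_instance
  unfold gaussPrec
  simp_rw [h]
  rw [pi_withDensity _ _ fun k => measurable_gaussianPDF _ _]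
  rfl

theorem measurable_gaussPrec (s : Fin d → ℝ≥0) : Measurable fun a => gaussPrec a s := by
  unfold gaussPrec
  exact measurable_piLaw fun k => measurable_gaussianReal.comp
    (g := Function.uncurry gaussianReal) (f := fun a : Vec d => (a k, (s k)⁻¹))
    ((measurable_pi_apply k).prodMk measurable_const)

/-- A Gaussian observation with mean `x` and precisions `s`, as a kernel in `x`. -/
noncomputable def gaussKernel (s : Fin d → ℝ≥0) : Kernel (Vec d) (Vec d) :=
  ⟨fun a => gaussPrec a s, measurable_gaussPrec s⟩

instance (s : Fin d → ℝ≥0) : IsMarkovKernel (gaussKernel s) :=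
  ⟨fun a => inferInstanceAs (IsProbabilityMeasure (gaussPrec a s))⟩

theorem measurable_prod_gaussianPDF (v : Fin d → ℝ≥0) :
    Measurable fun p : Vec d × Vec d => ∏ k, gaussianPDF (p.1 k) (v k) (p.2 k) := by
  refine Finset.measurable_prod _ fun k _ => ?_
  exact measurable_uncurry_gaussianPDF.comp
    (f := fun p : Vec d × Vec d => (p.1 k, v k, p.2 k)) (((measurable_pi_apply k).comp measurable_fst).prodMk
      (measurable_const.prodMk ((measurable_pi_apply k).comp measurable_snd)))

theorem prod_gaussianPDF_mul {s r : Fin d → ℝ≥0} (hs : ∀ k, 0 < s k) (hr : ∀ k, 0 < r k)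
    (a x y : Vec d) :
    (∏ k, gaussianPDF (a k) (s k)⁻¹ (x k)) * ∏ k, gaussianPDF (x k) (r k)⁻¹ (y k) =
      (∏ k, gaussianPDF (a k) ((s k)⁻¹ + (r k)⁻¹) (y k)) *
      ∏ k, gaussianPDF ((s k * a k + r k * y k) / (s k + r k)) (s k + r k)⁻¹ (x k) := by
  rw [← Finset.prod_mul_distrib, ← Finset.prod_mul_distrib]
  refine Finset.prod_congr rfl fun k _ => ?_
  simp only [gaussianPDF]
  rw [← ENNReal.ofReal_mul (gaussianPDFReal_nonneg _ _ _),
    ← ENNReal.ofReal_mul (gaussianPDFReal_nonneg _ _ _),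
    gaussianPDFReal_mul_gaussianPDFReal (hs k) (hr k)]

/-- Bayes' formula: exchanging the order of the parameter and of the observation. -/
theorem lintegral_gaussPrec_gaussPrec {s r : Fin d → ℝ≥0} (hs : ∀ k, 0 < s k)
    (hr : ∀ k, 0 < r k) (a : Vec d) {F : Vec d → Vec d → ℝ≥0∞}
    (hF : Measurable (Function.uncurry F)) :
    ∫⁻ x, ∫⁻ y, F x y ∂gaussPrec x r ∂gaussPrec a s =
      ∫⁻ y, ∫⁻ x, F x y ∂gaussPrec (fun k => (s k * a k + r k * y k) / (s k + r k)) (s + r)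
        ∂gaussPrec a (fun k => ((s k)⁻¹ + (r k)⁻¹)⁻¹) := by
  have hpos : ∀ k, 0 < ((s k)⁻¹ + (r k)⁻¹)⁻¹ := fun k => by
    have := hs k; have := hr k; positivity
  have hpos' : ∀ k, 0 < (s + r) k := fun k => add_pos (hs k) (hr k)
  have hq : Measurable (Function.uncurry fun y x : Vec d =>
      ∏ k, gaussianPDF ((s k * a k + r k * y k) / (s k + r k)) (s k + r k)⁻¹ (x k)) := by
    refine Finset.measurable_prod _ fun k _ => measurable_uncurry_gaussianPDF.comp
      (f := fun p : Vec d × Vec d => (((s k : ℝ) * a k + r k * p.1 k) / (s k + r k),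
        (s k + r k)⁻¹, p.2 k)) ?_
    fun_prop
  have hg : Measurable (Function.uncurry fun x y : Vec d =>
      ∏ k, gaussianPDF (x k) (r k)⁻¹ (y k)) := measurable_prod_gaussianPDF fun k => (r k)⁻¹
  have hf : ∀ v : Fin d → ℝ≥0, Measurable fun x : Vec d => ∏ k, gaussianPDF (a k) (v k) (x k) :=
    fun v => Finset.measurable_prod _ fun k _ =>
      (measurable_gaussianPDF _ _).comp (measurable_pi_apply k)
  have key := lintegral_withDensity_swap (μ := (volume : Measure (Vec d)))
    (ν := (volume : Measure (Vec d))) (hf _) hg (hf _) hq (prod_gaussianPDF_mul hs hr a) hF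
  rw [gaussPrec_eq_withDensity a hs, gaussPrec_eq_withDensity a hpos]
  simp_rw [gaussPrec_eq_withDensity _ hr, gaussPrec_eq_withDensity _ hpos', Pi.add_apply, inv_inv]
  exact key

/-- If the average of `G` is at most that of `F` for all posteriors of `x` after observing
`ω ∼ κ x`, in the form of Gaussian measures whose precisions exceed those of the prior by `r`,
then this is so for all Gaussian priors. -/
def BayesDominates {Ω : Type*} [MeasurableSpace Ω] (κ : Kernel (Vec d) Ω) (r : Fin d → ℝ≥0) :
    Prop :=
  ∀ (s : Fin d → ℝ≥0), (∀ k, 0 < s k) → ∀ (F G : Vec d → Ω → ℝ≥0∞),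
    Measurable (Function.uncurry F) → Measurable (Function.uncurry G) →
    (∀ ω a, ∫⁻ x, G x ω ∂gaussPrec a (s + r) ≤ ∫⁻ x, F x ω ∂gaussPrec a (s + r)) →
    ∀ a, ∫⁻ x, ∫⁻ ω, G x ω ∂κ x ∂gaussPrec a s ≤ ∫⁻ x, ∫⁻ ω, F x ω ∂κ x ∂gaussPrec a s

/-- Bayes' formula rewrites both sides as averages over the same marginal law of the observation, so
the comparison of posterior averages can be integrated. -/
theorem bayesDominates_gaussKernel {r : Fin d → ℝ≥0} (hr : ∀ k, 0 < r k) :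
    BayesDominates (gaussKernel r) r := by
  intro s hs F G hF hG h a
  have e1 := lintegral_gaussPrec_gaussPrec hs hr a hF
  have e2 := lintegral_gaussPrec_gaussPrec hs hr a hG
  change ∫⁻ x, ∫⁻ y, G x y ∂gaussPrec x r ∂gaussPrec a s ≤
    ∫⁻ x, ∫⁻ y, F x y ∂gaussPrec x r ∂gaussPrec a s
  rw [e1, e2]
  exact lintegral_mono fun y => h y _

/-- The product of finitely many kernels. -/
noncomputable def piKernel {m : ℕ} {β : Fin m → Type*} [∀ j, MeasurableSpace (β j)]
    (κ : (j : Fin m) → Kernel (Vec d) (β j)) [∀ j, IsMarkovKernel (κ j)] :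
    Kernel (Vec d) ((j : Fin m) → β j) :=
  ⟨fun x => Measure.pi fun j => κ j x, measurable_piLaw fun j => (κ j).measurable⟩

instance {m : ℕ} {β : Fin m → Type*} [∀ j, MeasurableSpace (β j)]
    (κ : (j : Fin m) → Kernel (Vec d) (β j)) [∀ j, IsMarkovKernel (κ j)] :
    IsMarkovKernel (piKernel κ) :=
  ⟨fun x => inferInstanceAs (IsProbabilityMeasure (Measure.pi fun j => κ j x))⟩

/-- Independent observations can be revealed one at a time, each posterior serving as the prior for
the next. Since the hypothesis is required at every centre `a`, posterior means never have to be
tracked; only precisions accumulate. -/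
theorem bayesDominates_piKernel {m : ℕ} {β : Fin m → Type*} [∀ j, MeasurableSpace (β j)]
    (κ : (j : Fin m) → Kernel (Vec d) (β j)) [∀ j, IsMarkovKernel (κ j)]
    (r : Fin m → Fin d → ℝ≥0) (h : ∀ j, BayesDominates (κ j) (r j)) :
    BayesDominates (piKernel κ) (∑ j, r j) := by
  induction m with
  | zero =>
    intro s hs F G hF hG hFG a
    have e : ∀ x, piKernel κ x = Measure.dirac default := fun x => by
      change Measure.pi _ = _
      rw [Measure.pi_of_empty _ default]
    simp_rw [e]
    have e1 : ∀ x, ∫⁻ ω, G x ω ∂Measure.dirac default = G x default := fun x =>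
      lintegral_dirac' _ (hG.comp measurable_prodMk_left)
    have e2 : ∀ x, ∫⁻ ω, F x ω ∂Measure.dirac default = F x default := fun x =>
      lintegral_dirac' _ (hF.comp measurable_prodMk_left)
    simp_rw [e1, e2]
    simpa using hFG default a
  | succ m ih =>
    intro s hs F G hF hG hFG a
    let e := MeasurableEquiv.piFinSuccAbove β 0
    let κ' : Kernel (Vec d) ((j : Fin m) → β j.succ) := piKernel fun j => κ j.succ
    have split : ∀ H : Vec d → ((j : Fin (m + 1)) → β j) → ℝ≥0∞, Measurable (Function.uncurry H) →
        ∀ x, ∫⁻ ω, H x ω ∂piKernel κ x = ∫⁻ u, ∫⁻ w, H x (e.symm (u, w)) ∂κ' x ∂κ 0 x := by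
      intro H hH x
      have hH1 : Measurable (H x) := hH.comp measurable_prodMk_left
      have := (measurePreserving_piFinSuccAbove (fun j => κ j x) 0).symm
      change ∫⁻ ω, H x ω ∂(Measure.pi fun j => κ j x) = _
      rw [← this.lintegral_comp hH1]
      exact lintegral_prod _ (hH1.comp e.symm.measurable).aemeasurable
    have meas : ∀ H : Vec d → ((j : Fin (m + 1)) → β j) → ℝ≥0∞, Measurable (Function.uncurry H) →
        Measurable (Function.uncurry fun (x : Vec d) (u : β 0) =>
          ∫⁻ w, H x (e.symm (u, w)) ∂κ' x) := by
      intro H hH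
      refine Measurable.lintegral_kernel_prod_right' (κ := Kernel.prodMkRight (β 0) κ')
        (f := fun p : (Vec d × β 0) × ((j : Fin m) → β j.succ) =>
          H p.1.1 (e.symm (p.1.2, p.2))) ?_
      exact hH.comp ((measurable_fst.comp measurable_fst).prodMk
        (e.symm.measurable.comp ((measurable_snd.comp measurable_fst).prodMk measurable_snd)))
    simp_rw [split F hF, split G hG]
    -- Revealing the first observation raises the precision from `s` to `s + r 0`, which is the
    -- prior for the induction hypothesis.
    refine h 0 s hs _ _ (meas F hF) (meas G hG) (fun u b => ?_) a
    refine ih (fun j => κ j.succ) (fun j => r j.succ) (fun j => h j.succ) (s + r 0)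
      (fun k => add_pos_of_pos_of_nonneg (hs k) bot_le) (fun x w => F x (e.symm (u, w)))
      (fun x w => G x (e.symm (u, w))) ?_ ?_ (fun w b' => ?_) b
    · exact hF.comp (measurable_fst.prodMk (e.symm.measurable.comp
        (measurable_const.prodMk measurable_snd)))
    · exact hG.comp (measurable_fst.prodMk (e.symm.measurable.comp
        (measurable_const.prodMk measurable_snd)))
    · have := hFG (e.symm (u, w)) b'
      rwa [Fin.sum_univ_succ, ← add_assoc] at this

/-- A sample of `n` independent Gaussian points with mean `x` and precisions `r`. -/
noncomputable def sampleKernel (r : Fin d → ℝ≥0) (n : ℕ) : Kernel (Vec d) (Fin n → Vec d) :=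
  piKernel fun _ => gaussKernel r

instance (r : Fin d → ℝ≥0) (n : ℕ) : IsMarkovKernel (sampleKernel r n) := by
  unfold sampleKernel; infer_instance

theorem sampleKernel_apply (r : Fin d → ℝ≥0) (n : ℕ) (x : Vec d) :
    sampleKernel r n x = Measure.pi fun _ => gaussPrec x r := rfl

theorem bayesDominates_sampleKernel {r : Fin d → ℝ≥0} (hr : ∀ k, 0 < r k) (n : ℕ) :
    BayesDominates (sampleKernel r n) (n • r) := by
  have := bayesDominates_piKernel (fun _ : Fin n => gaussKernel r) (fun _ => r)
    fun _ => bayesDominates_gaussKernel hr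
  rwa [Finset.sum_const, Finset.card_univ, Fintype.card_fin] at this

end Bayes

/-! ### Lower bounds for the minimax risk -/

section Minimax

variable {d m : ℕ}

theorem measurable_sqDist : Measurable fun p : Vec d × Vec d => sqDist p.1 p.2 := by
  unfold sqDist
  fun_prop

theorem gaussPrec_map_eval (a : Vec d) (s : Fin d → ℝ≥0) (k : Fin d) :
    (gaussPrec a s).map (fun x => x k) = gaussianReal (a k) (s k)⁻¹ :=
  (measurePreserving_eval (fun k => gaussianReal (a k) (s k)⁻¹) k).map_eq

theorem memLp_eval_gaussPrec (a : Vec d) (s : Fin d → ℝ≥0) (k : Fin d) :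
    MemLp (fun x : Vec d => x k) 2 (gaussPrec a s) :=
  (memLp_id_gaussianReal' 2 (by simp)).comp_measurePreserving
    (measurePreserving_eval (fun k => gaussianReal (a k) (s k)⁻¹) k)

theorem variance_eval_gaussPrec (a : Vec d) (s : Fin d → ℝ≥0) (k : Fin d) :
    Var[fun x : Vec d => x k; gaussPrec a s] = ((s k)⁻¹ : ℝ≥0) := by
  rw [← variance_id_map (measurable_pi_apply k).aemeasurable, gaussPrec_map_eval,
    variance_id_gaussianReal]

theorem integral_eval_gaussPrec (a : Vec d) (s : Fin d → ℝ≥0) (k : Fin d) :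
    ∫ x, x k ∂gaussPrec a s = a k := by
  rw [← integral_id_gaussianReal (μ := a k) (v := (s k)⁻¹), ← gaussPrec_map_eval a s k,
    integral_map (measurable_pi_apply k).aemeasurable (by fun_prop)]

theorem meanOf_gaussPrec (a : Vec d) (s : Fin d → ℝ≥0) : meanOf (gaussPrec a s) = a :=
  funext fun k => integral_eval_gaussPrec a s k

/-- The precision `σ⁻²` in each coordinate. -/
noncomputable def unitPrec (d : ℕ) (σ : ℝ) : Fin d → ℝ≥0 := fun _ => (σ ^ 2).toNNReal⁻¹

theorem unitPrec_pos {σ : ℝ} (hσ : 0 < σ) (k : Fin d) : 0 < unitPrec d σ k := by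
  have : 0 < σ ^ 2 := by positivity
  simpa [unitPrec] using this

theorem gaussPrec_mem_boundedVariance (a : Vec d) (σ : ℝ) :
    gaussPrec a (unitPrec d σ) ∈ boundedVariance d σ := by
  refine ⟨inferInstance, fun k => ⟨memLp_eval_gaussPrec _ _ _, ?_⟩⟩
  rw [variance_eval_gaussPrec, unitPrec, inv_inv, Real.coe_toNNReal _ (sq_nonneg σ)]

/-- The mean square distance to a fixed guess is smallest when the guess is the mean, where it is
the sum of the variances. -/
theorem ofReal_sum_inv_le_lintegral_sqDist (g a : Vec d) (s : Fin d → ℝ≥0) :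
    ENNReal.ofReal (∑ k, (s k : ℝ)⁻¹) ≤ ∫⁻ x, ENNReal.ofReal (sqDist g x) ∂gaussPrec a s := by
  have hL : ∀ k, MemLp (fun x : Vec d => g k - x k) 2 (gaussPrec a s) := fun k =>
    (memLp_const (g k)).sub (memLp_eval_gaussPrec a s k)
  have hint : Integrable (fun x : Vec d => sqDist g x) (gaussPrec a s) :=
    integrable_finsetSum _ fun k _ => (hL k).integrable_sq
  rw [← ofReal_integral_eq_lintegral_ofReal hint
    (ae_of_all _ fun x => Finset.sum_nonneg fun k _ => sq_nonneg _)]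
  refine ENNReal.ofReal_le_ofReal ?_
  unfold sqDist
  rw [integral_finsetSum _ fun k _ => (hL k).integrable_sq]
  refine Finset.sum_le_sum fun k _ => ?_
  have h := variance_le_expectation_sq (hL k).aestronglyMeasurable
  rw [variance_const_sub (memLp_eval_gaussPrec a s k).aestronglyMeasurable,
    variance_eval_gaussPrec, NNReal.coe_inv] at h
  simpa using h

/-- A lower bound for the Bayes risk of a randomized estimator. -/
theorem ofReal_le_bayesRisk {Ω A : Type*} [MeasurableSpace Ω] [MeasurableSpace A]
    {κ : Kernel (Vec d) Ω} {r : Fin d → ℝ≥0} (hκ : BayesDominates κ r)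
    (L : Kernel Ω A) [IsMarkovKernel L] {est : Ω × A → Vec d} (hest : Measurable est)
    [IsMarkovKernel κ] {s : Fin d → ℝ≥0} (hs : ∀ k, 0 < s k) (b : Vec d) :
    ENNReal.ofReal (∑ k, ((s k : ℝ) + r k)⁻¹) ≤
      ∫⁻ x, ∫⁻ ω, ∫⁻ a, ENNReal.ofReal (sqDist (est (ω, a)) x) ∂L ω ∂κ x ∂gaussPrec b s := by
  have hm : Measurable fun p : (Vec d × Ω) × A =>
      ENNReal.ofReal (sqDist (est (p.1.2, p.2)) p.1.1) :=
    (measurable_sqDist.comp ((hest.comp ((measurable_snd.comp measurable_fst).prodMk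
      measurable_snd)).prodMk (measurable_fst.comp measurable_fst))).ennreal_ofReal
  have hF : Measurable (Function.uncurry fun (x : Vec d) (ω : Ω) =>
      ∫⁻ a, ENNReal.ofReal (sqDist (est (ω, a)) x) ∂L ω) :=
    Measurable.lintegral_kernel_prod_right' (κ := Kernel.prodMkLeft (Vec d) L) hm
  -- The smaller function is the constant posterior variance, so only the posterior inequality for a
  -- fixed observation has to be checked.
  have h := hκ s hs (fun x ω => ∫⁻ a, ENNReal.ofReal (sqDist (est (ω, a)) x) ∂L ω)
    (fun _ _ => ENNReal.ofReal (∑ k, ((s k : ℝ) + r k)⁻¹)) hF measurable_const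
    (fun ω a' => ?_) b
  · simpa using h
  · simp only [lintegral_const, measure_univ, mul_one]
    -- Given `ω`, the law of the allocation does not involve the parameter, so each allocation can
    -- be fixed first; the estimate is then a constant.
    rw [lintegral_lintegral_swap]
    · calc ENNReal.ofReal (∑ k, ((s k : ℝ) + r k)⁻¹)
          = ∫⁻ _ : A, ENNReal.ofReal (∑ k, ((s k : ℝ) + r k)⁻¹) ∂L ω := by simp
        _ ≤ _ := lintegral_mono fun a => by
            simpa using ofReal_sum_inv_le_lintegral_sqDist (est (ω, a)) a' (s + r)
    · exact (hm.comp ((measurable_fst.prodMk measurable_const).prodMk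
        measurable_snd)).aemeasurable

/-- The maximum over the class `Θ` is at least the average over Gaussian distributions. -/
theorem lintegral_gaussPrec_le_iSup (σ : ℝ) (R : Measure (Vec d) → ℝ≥0∞) (b : Vec d)
    (s : Fin d → ℝ≥0) :
    ∫⁻ x, R (gaussPrec x (unitPrec d σ)) ∂gaussPrec b s ≤ ⨆ θ ∈ boundedVariance d σ, R θ := by
  calc _ ≤ ∫⁻ _ : Vec d, ⨆ θ ∈ boundedVariance d σ, R θ ∂gaussPrec b s :=
        lintegral_mono fun x => le_iSup₂_of_le _ (gaussPrec_mem_boundedVariance x σ) le_rfl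
    _ = _ := by simp

/-- Whatever the mechanism and the submissions, the agent's estimate is a randomized function of all
the collected points, `∑ j, (s j).n` in number. The parameter `δ > 0` keeps the prior proper and
covers the case of no points at all. -/
theorem ofReal_le_iSup_risk {σ : ℝ} (hσ : 0 < σ) (M : Mechanism.{u} d m)
    (s : Fin m → Strategy d M.Alloc) (i : Fin m) {δ : ℝ} (hδ : 0 < δ) :
    ENNReal.ofReal (d * σ ^ 2 / (δ + ∑ j, ((s j).n : ℝ))) ≤
      ⨆ θ ∈ boundedVariance d σ, risk M s i θ := by
  have hY : Measurable fun (x : (j : Fin m) → Fin (s j).n → Vec d) (j : Fin m) =>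
      (s j).submit ⟨(s j).n, x j⟩ :=
    measurable_pi_iff.2 fun j => (s j).measurable_submit.comp
      ((measurable_sigmaMk _).comp (measurable_pi_apply j))
  have hκ := bayesDominates_piKernel (fun j => sampleKernel (unitPrec d σ) (s j).n) _
    fun j => bayesDominates_sampleKernel (unitPrec_pos hσ) (s j).n
  have hX : Measurable fun p : ((j : Fin m) → Fin (s j).n → Vec d) × (Fin m → M.Alloc) =>
      (⟨(s i).n, p.1 i⟩ : Dataset d) :=
    (measurable_sigmaMk _).comp ((measurable_pi_apply i).comp measurable_fst)
  have hest := (s i).measurable_estimate.comp (hX.prodMk (((s i).measurable_submit.comp hX).prodMk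
    ((measurable_pi_apply i).comp measurable_snd)))
  have hpos : 0 < δ / σ ^ 2 := by positivity
  -- A prior of precision `δ / σ²` is worth `δ` additional points.
  have h := ofReal_le_bayesRisk hκ (M.law.comap _ hY) hest (s := fun _ => (δ / σ ^ 2).toNNReal)
    (fun _ => by simpa using hpos) 0
  refine le_trans (ENNReal.ofReal_le_ofReal (le_of_eq ?_)) (h.trans (le_trans (le_of_eq
    (lintegral_congr fun x => ?_)) (lintegral_gaussPrec_le_iSup σ (risk M s i) _ _)))
  swap
  · rw [risk, meanOf_gaussPrec]
    rfl
  have hsum : ∀ k : Fin d, ((∑ j, (s j).n • unitPrec d σ) k : ℝ) = (∑ j, ((s j).n : ℝ)) / σ ^ 2 := by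
    intro k
    simp [unitPrec, div_eq_mul_inv, Real.coe_toNNReal _ (sq_nonneg σ),
      Finset.sum_mul]
  simp only [hsum, Real.coe_toNNReal _ hpos.le]
  have h0 : 0 ≤ ∑ j, ((s j).n : ℝ) := Finset.sum_nonneg fun j _ => Nat.cast_nonneg _
  rw [Finset.sum_const, Finset.card_univ, Fintype.card_fin, nsmul_eq_mul, ← add_div, inv_div]
  ring

theorem ofReal_le_alonePenalty {σ c : ℝ} (hσ : 0 < σ) (n : ℕ) {h : Dataset d → Vec d}
    (hh : Measurable h) {δ : ℝ} (hδ : 0 < δ) :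
    ENNReal.ofReal (d * σ ^ 2 / (δ + n)) + ENNReal.ofReal (c * n) ≤ alonePenalty σ c n h := by
  refine add_le_add_left ?_ _
  have hκ := bayesDominates_sampleKernel (unitPrec_pos (d := d) hσ) n
  have hest : Measurable fun p : (Fin n → Vec d) × Unit => h ⟨n, p.1⟩ :=
    hh.comp ((measurable_sigmaMk _).comp measurable_fst)
  have hpos : 0 < δ / σ ^ 2 := by positivity
  -- Working alone involves no mechanism, so the allocation is a one-point space.
  have h1 := ofReal_le_bayesRisk hκ (Kernel.const _ (Measure.dirac ())) hest
    (s := fun _ => (δ / σ ^ 2).toNNReal) (fun _ => by simpa using hpos) 0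
  simp only [Kernel.const_apply, lintegral_dirac] at h1
  refine le_trans (ENNReal.ofReal_le_ofReal (le_of_eq ?_))
    (h1.trans (le_trans (le_of_eq (lintegral_congr fun x => ?_))
      (lintegral_gaussPrec_le_iSup σ (fun θ => ∫⁻ x : Fin n → Vec d,
      ENNReal.ofReal (sqDist (h ⟨n, x⟩) (meanOf θ)) ∂(Measure.pi fun _ : Fin n => θ)) _ _)))
  swap
  · simp only [meanOf_gaussPrec]
    rfl
  simp [unitPrec, Real.coe_toNNReal _ hpos.le, max_eq_left (sq_nonneg σ)]
  field_simp

end Minimax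

/-! ### The risk under the mechanism as an iterated integral -/

section Split

variable {d m : ℕ}

/-- Distinct points of the collected data are independent with distribution `θ`. -/
theorem measurePreserving_dataLaw (θ : Measure (Vec d)) [IsProbabilityMeasure θ] (n : Fin m → ℕ)
    {κ : Type*} [Fintype κ] {e : κ → Σ j : Fin m, Fin (n j)} (he : Function.Injective e) :
    MeasurePreserving (fun (x : (j : Fin m) → Fin (n j) → Vec d) q => x (e q).1 (e q).2)
      (dataLaw θ n) (Measure.pi fun _ : κ => θ) := by
  classical
  have hmeas : Measurable fun (x : (j : Fin m) → Fin (n j) → Vec d) q => x (e q).1 (e q).2 :=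
    measurable_pi_iff.2 fun q => (measurable_pi_apply _).comp (measurable_pi_apply _)
  refine ⟨hmeas, (Measure.pi_eq fun S hS => ?_).symm⟩
  rw [Measure.map_apply hmeas (MeasurableSet.univ_pi hS)]
  -- By injectivity of `e`, the intersection has at most one member: `T p` is `S q` when `p = e q`,
  -- and the whole space when `p` is not selected.
  let T : (p : Σ j : Fin m, Fin (n j)) → Set (Vec d) := fun p => ⋂ (q) (_ : e q = p), S q
  have hpre : (fun (x : (j : Fin m) → Fin (n j) → Vec d) q => x (e q).1 (e q).2) ⁻¹'
      Set.univ.pi S = Set.univ.pi fun j => Set.univ.pi fun l => T ⟨j, l⟩ := by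
    ext x
    simp only [Set.mem_preimage, Set.mem_univ_pi, T, Set.mem_iInter]
    refine ⟨fun h j l q hq => ?_, fun h q => h _ _ q rfl⟩
    have := h q
    rwa [hq] at this
  have hT1 : ∀ q, T (e q) = S q := fun q => by
    ext y
    simp only [T, Set.mem_iInter]
    exact ⟨fun h => h q rfl, fun h q' hq' => he hq' ▸ h⟩
  have hT2 : ∀ p, p ∉ Set.range e → T p = Set.univ := fun p hp => by
    ext y
    simp only [T, Set.mem_iInter, Set.mem_univ, iff_true]
    exact fun q hq => absurd ⟨q, hq⟩ hp
  rw [hpre, dataLaw, Measure.pi_pi]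
  simp_rw [Measure.pi_pi]
  rw [← Fintype.prod_sigma' fun (j : Fin m) (l : Fin (n j)) => θ (T ⟨j, l⟩)]
  refine (Fintype.prod_of_injective e he _ _ (fun p hp => ?_) fun q => ?_).symm
  · change θ (T p) = 1
    rw [hT2 p hp, measure_univ]
  · change θ (S q) = θ (T (e q))
    rw [hT1]

/-- This is what turns an expectation over all agents' data into an iterated one over the agent's
own, the uncorrupted and the remaining points; points outside the range of `e` integrate out. -/
theorem lintegral_dataLaw_split (θ : Measure (Vec d)) [IsProbabilityMeasure θ] (n : Fin m → ℕ)
    {A B C : Type*} [Fintype A] [Fintype B] [Fintype C] {e : A ⊕ B ⊕ C → Σ j : Fin m, Fin (n j)}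
    (he : Function.Injective e) {F : (A → Vec d) × (B → Vec d) × (C → Vec d) → ℝ≥0∞}
    (hF : Measurable F) :
    ∫⁻ x, F (fun q => x (e (.inl q)).1 (e (.inl q)).2,
        fun q => x (e (.inr (.inl q))).1 (e (.inr (.inl q))).2,
        fun q => x (e (.inr (.inr q))).1 (e (.inr (.inr q))).2) ∂dataLaw θ n =
      ∫⁻ X, ∫⁻ Z, ∫⁻ R, F (X, Z, R) ∂(Measure.pi fun _ : C => θ) ∂(Measure.pi fun _ : B => θ)
        ∂(Measure.pi fun _ : A => θ) := by
  have h1 := measurePreserving_dataLaw θ n he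
  have h2 := measurePreserving_sumPiEquivProdPi (fun _ : A ⊕ B ⊕ C => θ)
  have h3 := measurePreserving_sumPiEquivProdPi (fun _ : B ⊕ C => θ)
  have h4 := ((MeasurePreserving.id (Measure.pi fun _ : A => θ)).prod h3).comp (h2.comp h1)
  have h5 := h4.lintegral_comp hF
  rw [lintegral_prod _ hF.aemeasurable] at h5
  refine h5.trans (lintegral_congr fun X => ?_)
  exact lintegral_prod _ (hF.comp measurable_prodMk_left).aemeasurable

theorem lintegral_sampleLaw (α : ℝ) (k : ℕ) (Y D : Dataset d) {f : Allocation d → ℝ≥0∞}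
    (hf : Measurable f) :
    ∫⁻ a, f a ∂sampleLaw α k Y D = (Nat.factorial D.1 : ℝ≥0∞)⁻¹ * ∑ π : Equiv.Perm (Fin D.1),
      ∫⁻ ε, f ((D.permute π).take k, ((D.permute π).drop k).addNoise ε,
          etaSq α Y ((D.permute π).take k))
        ∂noiseLaw ((D.permute π).drop k).1 (etaSq α Y ((D.permute π).take k)) := by
  rw [sampleLaw, lintegral_smul_measure, lintegral_finsetSum_measure, smul_eq_mul]
  congr 1
  refine Finset.sum_congr rfl fun π _ => ?_
  rw [splitLaw, lintegral_map hf]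
  refine measurable_const.prodMk (Measurable.prodMk ?_ measurable_const)
  refine (measurable_sigmaMk _).comp ?_
  fun_prop

/-- The union of the other datasets factors through the restriction of `Y` to the other agents, so
the deviator's arbitrary submission plays no role in it. -/
theorem others_congr {i : Fin m} {Y Y' : Fin m → Dataset d} (h : ∀ j, j ≠ i → Y j = Y' j) :
    Dataset.others i Y = Dataset.others i Y' := by
  let o : ({j : Fin m // j ≠ i} → Dataset d) → Dataset d := fun W =>
    ⟨Fintype.card (Σ j, Fin (W j).1), fun t =>
      let p := (Fintype.equivFin (Σ j, Fin (W j).1)).symm t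
      (W p.1).2 p.2⟩
  exact congrArg o (funext fun j : {j : Fin m // j ≠ i} => h j j.2)

theorem measurable_etaSq (α : ℝ) {Ω : Type*} [MeasurableSpace Ω] {Y Z : Ω → Dataset d}
    (hY : Measurable Y) (hZ : Measurable Z) : Measurable fun ω => etaSq α (Y ω) (Z ω) := by
  have hmean : ∀ l, Measurable fun D : Dataset d => D.mean l := fun l =>
    (Measurable.inv (measurable_from_top.comp measurable_size)).mul
      ((measurable_pi_apply l).comp measurable_sum)
  exact measurable_pi_iff.2 fun l => Measurable.real_toNNReal
    (((((hmean l).comp hY).sub ((hmean l).comp hZ)).pow_const 2).const_mul _)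

/-- The squared error when the agent's data is `X`, the uncorrupted data is `Z`, the other data is
`R`, and `ε` is the noise. -/
noncomputable def splitLoss (α : ℝ) (s : Strategy d (Allocation d)) {k K : ℕ} (μ : Vec d)
    (X : Fin s.n → Vec d) (Z : Fin k → Vec d) (R ε : Fin K → Vec d) : ℝ≥0∞ :=
  ENNReal.ofReal (sqDist (s.estimate ⟨s.n, X⟩ (s.submit ⟨s.n, X⟩)
    (⟨k, Z⟩, ⟨K, fun j => R j + ε j⟩, etaSq α (s.submit ⟨s.n, X⟩) ⟨k, Z⟩)) μ)

/-- The variances of the noise as a function of the agent's data `X` and the uncorrupted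
data `Z`. -/
noncomputable def splitEtaSq (α : ℝ) (s : Strategy d (Allocation d)) {k : ℕ}
    (X : Fin s.n → Vec d) (Z : Fin k → Vec d) : Fin d → ℝ≥0 :=
  etaSq α (s.submit ⟨s.n, X⟩) ⟨k, Z⟩

/-- The risk of an agent who receives `k` uncorrupted and `K` corrupted points. -/
noncomputable def splitRisk (α : ℝ) (s : Strategy d (Allocation d)) (k K : ℕ)
    (θ : Measure (Vec d)) : ℝ≥0∞ :=
  ∫⁻ X : Fin s.n → Vec d, ∫⁻ Z : Fin k → Vec d, ∫⁻ R : Fin K → Vec d,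
    ∫⁻ ε, splitLoss α s (meanOf θ) X Z R ε ∂noiseLaw K (splitEtaSq α s X Z)
    ∂(Measure.pi fun _ => θ) ∂(Measure.pi fun _ => θ) ∂(Measure.pi fun _ => θ)

theorem measurable_estimate_split (α : ℝ) (s : Strategy d (Allocation d)) (k K : ℕ) :
    Measurable fun p : (Fin s.n → Vec d) × (Fin k → Vec d) × (Fin K → Vec d) =>
      s.estimate ⟨s.n, p.1⟩ (s.submit ⟨s.n, p.1⟩)
        (⟨k, p.2.1⟩, ⟨K, p.2.2⟩, etaSq α (s.submit ⟨s.n, p.1⟩) ⟨k, p.2.1⟩) := by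
  have hX : Measurable fun p : (Fin s.n → Vec d) × (Fin k → Vec d) × (Fin K → Vec d) =>
      (⟨s.n, p.1⟩ : Dataset d) := (measurable_sigmaMk _).comp measurable_fst
  have hZ : Measurable fun p : (Fin s.n → Vec d) × (Fin k → Vec d) × (Fin K → Vec d) =>
      (⟨k, p.2.1⟩ : Dataset d) :=
    (measurable_sigmaMk _).comp (measurable_fst.comp measurable_snd)
  have hR : Measurable fun p : (Fin s.n → Vec d) × (Fin k → Vec d) × (Fin K → Vec d) =>
      (⟨K, p.2.2⟩ : Dataset d) :=
    (measurable_sigmaMk _).comp (measurable_snd.comp measurable_snd)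
  have hY := s.measurable_submit.comp hX
  exact s.measurable_estimate.comp (hX.prodMk (hY.prodMk (hZ.prodMk (hR.prodMk
    (measurable_etaSq α hY hZ)))))

theorem measurable_lintegral_splitLoss (α : ℝ) (s : Strategy d (Allocation d)) (k K : ℕ) :
    Measurable fun p : Vec d × (Fin s.n → Vec d) × (Fin k → Vec d) × (Fin K → Vec d) =>
      ∫⁻ ε, splitLoss α s p.1 p.2.1 p.2.2.1 p.2.2.2 ε
        ∂noiseLaw K (splitEtaSq α s p.2.1 p.2.2.1) := by
  have hη : Measurable fun p : Vec d × (Fin s.n → Vec d) × (Fin k → Vec d) × (Fin K → Vec d) =>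
      splitEtaSq α s p.2.1 p.2.2.1 :=
    measurable_etaSq α (s.measurable_submit.comp ((measurable_sigmaMk _).comp
      (measurable_fst.comp measurable_snd)))
      ((measurable_sigmaMk k).comp (measurable_fst.comp (measurable_snd.comp measurable_snd)))
  let ν : Kernel (Vec d × (Fin s.n → Vec d) × (Fin k → Vec d) × (Fin K → Vec d))
      (Fin K → Vec d) :=
    ⟨fun p => noiseLaw K (splitEtaSq α s p.2.1 p.2.2.1), (measurable_noiseLaw K).comp hη⟩
  have : IsMarkovKernel ν := ⟨fun p =>
    inferInstanceAs (IsProbabilityMeasure (noiseLaw K (splitEtaSq α s p.2.1 p.2.2.1)))⟩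
  refine Measurable.lintegral_kernel_prod_right' (κ := ν)
    (f := fun q => splitLoss α s q.1.1 q.1.2.1 q.1.2.2.1 q.1.2.2.2 q.2) ?_
  have h := (measurable_estimate_split α s k K).comp (f := fun q :
      (Vec d × (Fin s.n → Vec d) × (Fin k → Vec d) × (Fin K → Vec d)) × (Fin K → Vec d) =>
      (q.1.2.1, q.1.2.2.1, fun j => q.1.2.2.2 j + q.2 j)) (by fun_prop)
  exact (measurable_sqDist.comp (h.prodMk (measurable_fst.comp measurable_fst))).ennreal_ofReal

/-- The position in the collected data of the `t`-th point of the other agents. -/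
noncomputable def othersIndex (i : Fin m) (n : Fin m → ℕ)
    (t : Fin (Fintype.card (Σ j : {j : Fin m // j ≠ i}, Fin (n j)))) : Σ j : Fin m, Fin (n j) :=
  ⟨((Fintype.equivFin (Σ j : {j : Fin m // j ≠ i}, Fin (n j))).symm t).1,
    ((Fintype.equivFin (Σ j : {j : Fin m // j ≠ i}, Fin (n j))).symm t).2⟩

theorem othersIndex_injective (i : Fin m) (n : Fin m → ℕ) :
    Function.Injective (othersIndex i n) := by
  intro t t' h
  have hφ : Function.Injective fun p : Σ j : {j : Fin m // j ≠ i}, Fin (n j) =>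
      (⟨p.1, p.2⟩ : Σ j : Fin m, Fin (n j)) := by
    rintro ⟨⟨j, hj⟩, l⟩ ⟨⟨j', hj'⟩, l'⟩ h
    obtain ⟨h1, h2⟩ := Sigma.mk.inj h
    subst h1
    obtain rfl : l = l' := eq_of_heq h2
    rfl
  exact (Fintype.equivFin (Σ j : {j : Fin m // j ≠ i}, Fin (n j))).symm.injective (hφ h)

theorem othersIndex_ne_mk (i : Fin m) (n : Fin m → ℕ)
    (t : Fin (Fintype.card (Σ j : {j : Fin m // j ≠ i}, Fin (n j)))) (l : Fin (n i)) :
    othersIndex i n t ≠ ⟨i, l⟩ := fun h =>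
  ((Fintype.equivFin (Σ j : {j : Fin m // j ≠ i}, Fin (n j))).symm t).1.2 (congrArg Sigma.fst h)

/-- Up to four agents: everyone receives the data of the others. -/
theorem risk_mechanism_of_le_four (hm : m ≤ 4) (σ c : ℝ)
    (s : Fin m → Strategy d (Allocation d)) (i : Fin m) (hs : ∀ j, j ≠ i → (s j).submit = id)
    (θ : Measure (Vec d)) [IsProbabilityMeasure θ] {M : ℕ}
    (hM : Fintype.card (Σ j : {j : Fin m // j ≠ i}, Fin (s j).n) = M) :
    risk (mechanism d m σ c) s i θ = ∫⁻ X : Fin (s i).n → Vec d, ∫⁻ D : Fin M → Vec d,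
      ENNReal.ofReal (sqDist ((s i).estimate ⟨(s i).n, X⟩ ((s i).submit ⟨(s i).n, X⟩)
        (⟨M, D⟩, Dataset.empty, 0)) (meanOf θ))
      ∂(Measure.pi fun _ => θ) ∂(Measure.pi fun _ => θ) := by
  subst hM
  set M := Fintype.card (Σ j : {j : Fin m // j ≠ i}, Fin (s j).n) with hMdef
  set k := ⌊σ * √(d / (c * m))⌋₊ with hk
  set α := alpha d m σ c with hα
  let w : Fin M → Σ j : Fin m, Fin (s j).n := othersIndex i fun j => (s j).n
  have hD : ∀ x : (j : Fin m) → Fin (s j).n → Vec d,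
      Dataset.others i (fun j => (s j).submit ⟨(s j).n, x j⟩)
        = ⟨M, fun t => x (w t).1 (w t).2⟩ := fun x =>
    (others_congr (Y' := fun j => (⟨(s j).n, x j⟩ : Dataset d)) fun j hj => by
      rw [hs j hj, id]).trans rfl
  have hest : ∀ X : Dataset d, Measurable fun a : Allocation d =>
      ENNReal.ofReal (sqDist ((s i).estimate X ((s i).submit X) a) (meanOf θ)) := fun X =>
    (measurable_sqDist.comp (((s i).measurable_estimate.comp (measurable_const.prodMk
      (measurable_const.prodMk measurable_id))).prodMk measurable_const)).ennreal_ofReal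
  -- With up to four agents nothing is corrupted; the third block of the splitting is empty.
  let F : (Fin (s i).n → Vec d) × (Fin M → Vec d) × (Fin 0 → Vec d) → ℝ≥0∞ := fun p =>
    ENNReal.ofReal (sqDist ((s i).estimate ⟨(s i).n, p.1⟩ ((s i).submit ⟨(s i).n, p.1⟩)
        (⟨M, p.2.1⟩, Dataset.empty, 0)) (meanOf θ))
  have hF : Measurable F := by
    have hX : Measurable fun p : (Fin (s i).n → Vec d) × (Fin M → Vec d) × (Fin 0 → Vec d) =>
        (⟨(s i).n, p.1⟩ : Dataset d) := (measurable_sigmaMk _).comp measurable_fst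
    have hZ : Measurable fun p : (Fin (s i).n → Vec d) × (Fin M → Vec d) × (Fin 0 → Vec d) =>
        (⟨M, p.2.1⟩ : Dataset d) :=
      (measurable_sigmaMk _).comp (measurable_fst.comp measurable_snd)
    exact (measurable_sqDist.comp (((s i).measurable_estimate.comp (hX.prodMk
      (((s i).measurable_submit.comp hX).prodMk (hZ.prodMk measurable_const)))).prodMk
      measurable_const)).ennreal_ofReal
  let e : Fin (s i).n ⊕ Fin M ⊕ Fin 0 → Σ j : Fin m, Fin (s j).n :=
    Sum.elim (fun l => ⟨i, l⟩) (Sum.elim w Fin.elim0)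
  have he : Function.Injective e := by
    have hwi := othersIndex_ne_mk i fun j => (s j).n
    rintro (l | l | l) (l' | l' | l') h
    · simpa [e] using h
    · exact absurd h.symm (hwi _ _)
    · exact l'.elim0
    · exact absurd h (hwi _ _)
    · rw [othersIndex_injective i (fun j => (s j).n) h]
    all_goals first | exact l.elim0 | exact l'.elim0
  have h := lintegral_dataLaw_split θ (fun j => (s j).n) he hF
  simp only [F, lintegral_const, measure_univ, mul_one] at h
  refine Eq.trans (lintegral_congr fun x => ?_) h
  change ∫⁻ a : Fin m → Allocation d, ENNReal.ofReal (sqDist ((s i).estimate ⟨(s i).n, x i⟩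
        ((s i).submit ⟨(s i).n, x i⟩) (a i)) (meanOf θ))
        ∂(Measure.pi fun i => allocLaw α k i fun j => (s j).submit ⟨(s j).n, x j⟩) = _
  rw [(measurePreserving_eval (fun i => allocLaw α k i fun j =>
      (s j).submit ⟨(s j).n, x j⟩) i).lintegral_comp (hest ⟨(s i).n, x i⟩), allocLaw, if_pos hm,
      hD, lintegral_dirac' _ (hest _)]
  rfl

/-- The points of the other agents are exchangeable, so every permutation contributes the same
integral and the uniform sampling may be replaced by a fixed choice. -/
theorem risk_mechanism_eq_splitRisk (hm : ¬ m ≤ 4) (σ c : ℝ)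
    (s : Fin m → Strategy d (Allocation d)) (i : Fin m) (hs : ∀ j, j ≠ i → (s j).submit = id)
    (θ : Measure (Vec d)) [IsProbabilityMeasure θ] {M : ℕ}
    (hM : Fintype.card (Σ j : {j : Fin m // j ≠ i}, Fin (s j).n) = M) :
    risk (mechanism d m σ c) s i θ = splitRisk (alpha d m σ c) (s i)
      (min M ⌊σ * √(d / (c * m))⌋₊) (M - ⌊σ * √(d / (c * m))⌋₊) θ := by
  subst hM
  set M := Fintype.card (Σ j : {j : Fin m // j ≠ i}, Fin (s j).n) with hMdef
  set k := ⌊σ * √(d / (c * m))⌋₊ with hk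
  set α := alpha d m σ c with hα
  let P : ((j : Fin m) → Fin (s j).n → Vec d) → Fin M → Vec d := fun x t =>
    x ((Fintype.equivFin (Σ j : {j : Fin m // j ≠ i}, Fin (s j).n)).symm t).1
      ((Fintype.equivFin (Σ j : {j : Fin m // j ≠ i}, Fin (s j).n)).symm t).2
  have hD : ∀ x : (j : Fin m) → Fin (s j).n → Vec d,
      Dataset.others i (fun j => (s j).submit ⟨(s j).n, x j⟩) = ⟨M, P x⟩ := fun x =>
    (others_congr (Y' := fun j => (⟨(s j).n, x j⟩ : Dataset d)) fun j hj => by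
      rw [hs j hj, id]).trans rfl
  have hest : ∀ X : Dataset d, Measurable fun a : Allocation d =>
      ENNReal.ofReal (sqDist ((s i).estimate X ((s i).submit X) a) (meanOf θ)) := fun X =>
    (measurable_sqDist.comp (((s i).measurable_estimate.comp (measurable_const.prodMk
      (measurable_const.prodMk measurable_id))).prodMk measurable_const)).ennreal_ofReal
  have hinner : ∀ x : (j : Fin m) → Fin (s j).n → Vec d,
      ∫⁻ a : Fin m → Allocation d, ENNReal.ofReal (sqDist ((s i).estimate ⟨(s i).n, x i⟩
        ((s i).submit ⟨(s i).n, x i⟩) (a i)) (meanOf θ))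
        ∂(Measure.pi fun i => allocLaw α k i fun j => (s j).submit ⟨(s j).n, x j⟩) =
      (Nat.factorial M : ℝ≥0∞)⁻¹ * ∑ π : Equiv.Perm (Fin M),
        ∫⁻ ε, splitLoss α (s i) (meanOf θ) (x i)
            (fun j : Fin (min M k) => P x (π (Fin.castLE (min_le_left _ _) j)))
            (fun j : Fin (M - k) => P x (π ⟨k + j.1, by have := j.2; omega⟩)) ε
          ∂noiseLaw (M - k) (splitEtaSq α (s i) (x i)
            (fun j : Fin (min M k) => P x (π (Fin.castLE (min_le_left _ _) j)))) := by
    intro x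
    rw [(measurePreserving_eval (fun i => allocLaw α k i fun j =>
      (s j).submit ⟨(s j).n, x j⟩) i).lintegral_comp (hest ⟨(s i).n, x i⟩), allocLaw, if_neg hm,
      hD, lintegral_sampleLaw _ _ _ _ (hest _)]
    rfl
  change ∫⁻ x, ∫⁻ a : Fin m → Allocation d, ENNReal.ofReal (sqDist ((s i).estimate ⟨(s i).n, x i⟩
        ((s i).submit ⟨(s i).n, x i⟩) (a i)) (meanOf θ))
        ∂(Measure.pi fun i => allocLaw α k i fun j => (s j).submit ⟨(s j).n, x j⟩)
        ∂(dataLaw θ fun j => (s j).n) = _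
  simp_rw [hinner]
  let F : (Fin (s i).n → Vec d) × (Fin (min M k) → Vec d) × (Fin (M - k) → Vec d) → ℝ≥0∞ :=
    fun p => ∫⁻ ε, splitLoss α (s i) (meanOf θ) p.1 p.2.1 p.2.2 ε
      ∂noiseLaw (M - k) (splitEtaSq α (s i) p.1 p.2.1)
  have hF : Measurable F := by
    have h := (measurable_lintegral_splitLoss α (s i) (min M k) (M - k)).comp
      (f := fun p : (Fin (s i).n → Vec d) × (Fin (min M k) → Vec d) × (Fin (M - k) → Vec d) =>
        (meanOf θ, p)) (by fun_prop)
    exact h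
  have hPmeas : ∀ π : Equiv.Perm (Fin M), Measurable
      fun x : (j : Fin m) → Fin (s j).n → Vec d =>
        F (x i, (fun j => P x (π (Fin.castLE (min_le_left _ _) j))),
          fun j => P x (π ⟨k + j.1, by have := j.2; omega⟩)) := fun π =>
    hF.comp ((measurable_pi_apply i).prodMk ((measurable_pi_iff.2 fun j =>
      (measurable_pi_apply _).comp (measurable_pi_apply _)).prodMk (measurable_pi_iff.2 fun j =>
      (measurable_pi_apply _).comp (measurable_pi_apply _))))
  have key : ∀ π : Equiv.Perm (Fin M), ∫⁻ x : (j : Fin m) → Fin (s j).n → Vec d,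
      F (x i, (fun j => P x (π (Fin.castLE (min_le_left _ _) j))),
          fun j => P x (π ⟨k + j.1, by have := j.2; omega⟩)) ∂(dataLaw θ fun j => (s j).n) =
      splitRisk α (s i) (min M k) (M - k) θ := by
    intro π
    let w : Fin M → Σ j : Fin m, Fin (s j).n := othersIndex i fun j => (s j).n
    have hw : Function.Injective w := othersIndex_injective i fun j => (s j).n
    let e : Fin (s i).n ⊕ Fin (min M k) ⊕ Fin (M - k) → Σ j : Fin m, Fin (s j).n :=
      Sum.elim (fun l => ⟨i, l⟩) (Sum.elim (fun j => w (π (Fin.castLE (min_le_left _ _) j)))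
        fun j => w (π ⟨k + j.1, by have := j.2; omega⟩))
    have he : Function.Injective e := by
      have hwi : ∀ t (l : Fin (s i).n), w t ≠ ⟨i, l⟩ :=
        othersIndex_ne_mk i fun j => (s j).n
      rintro (l | l | l) (l' | l' | l') h
      · simpa [e] using h
      · exact absurd h.symm (hwi _ _)
      · exact absurd h.symm (hwi _ _)
      · exact absurd h (hwi _ _)
      · have := congrArg Fin.val (π.injective (hw h))
        simp only [Fin.val_castLE] at this
        rw [Fin.ext this]
      · have := congrArg Fin.val (π.injective (hw h))
        have h1 := l.2
        simp only [Fin.val_castLE] at this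
        omega
      · exact absurd h (hwi _ _)
      · have := congrArg Fin.val (π.injective (hw h))
        have h1 := l'.2
        simp only [Fin.val_castLE] at this
        omega
      · have := congrArg Fin.val (π.injective (hw h))
        simp only [add_right_inj] at this
        rw [Fin.ext this]
    exact lintegral_dataLaw_split θ (fun j => (s j).n) he hF
  rw [lintegral_const_mul _ (Finset.measurable_sum _ fun π _ => hPmeas π),
    lintegral_finsetSum _ fun π _ => hPmeas π]
  rw [Finset.sum_congr rfl fun π _ => key π]
  rw [Finset.sum_const, Finset.card_univ, Fintype.card_perm, Fintype.card_fin, nsmul_eq_mul,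
    ← mul_assoc, ENNReal.inv_mul_cancel (by exact_mod_cast Nat.factorial_ne_zero _) (by simp),
    one_mul]

end Split

/-! ### Sums of Gaussian variables -/

section Gaussian

theorem lintegral_gaussianReal_gaussianReal (a : ℝ) (u v : ℝ≥0) {f : ℝ → ℝ≥0∞}
    (hf : Measurable f) :
    ∫⁻ x, ∫⁻ y, f y ∂gaussianReal x v ∂gaussianReal a u = ∫⁻ y, f y ∂gaussianReal a (u + v) := by
  have h := gaussianReal_conv_gaussianReal (m₁ := a) (m₂ := 0) (v₁ := u) (v₂ := v)
  rw [add_zero] at h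
  rw [← h, Measure.lintegral_conv hf]
  refine lintegral_congr fun x => ?_
  have e : gaussianReal x v = (gaussianReal 0 v).map fun y => x + y := by
    rw [gaussianReal_map_const_add, zero_add]
  rw [e, lintegral_map hf (by fun_prop)]

theorem lintegral_pi_gaussianReal_sum (a : ℝ) (v : ℝ≥0) (n : ℕ) {f : ℝ → ℝ≥0∞}
    (hf : Measurable f) :
    ∫⁻ z, f (∑ i, z i) ∂(Measure.pi fun _ : Fin n => gaussianReal a v) =
      ∫⁻ y, f y ∂gaussianReal (n * a) (n * v) := by
  induction n generalizing f with
  | zero =>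
    rw [Measure.pi_of_empty _ default]
    simp [lintegral_dirac' _ hf]
  | succ n ih =>
    have hm : Measurable fun z : Fin (n + 1) → ℝ => f (∑ i, z i) := by fun_prop
    rw [← ((measurePreserving_piFinSuccAbove (fun _ : Fin (n + 1) => gaussianReal a v)
      0).symm).lintegral_comp hm]
    have e : ∀ p : ℝ × (Fin n → ℝ),
        f (∑ i, (MeasurableEquiv.piFinSuccAbove (fun _ : Fin (n + 1) => ℝ) 0).symm p i) =
          f (p.1 + ∑ i, p.2 i) := fun p => by
      rw [Fin.sum_univ_succ]
      rfl
    simp_rw [e]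
    rw [lintegral_prod _ (by fun_prop)]
    have e2 : ∀ x : ℝ, ∫⁻ z : Fin n → ℝ, f (x + ∑ i, z i) ∂(Measure.pi fun _ => gaussianReal a v) =
        ∫⁻ y, f (x + y) ∂gaussianReal (n * a) (n * v) := fun x =>
      ih (f := fun y => f (x + y)) (by fun_prop)
    have h := gaussianReal_conv_gaussianReal (m₁ := a) (m₂ := n * a) (v₁ := v) (v₂ := n * v)
    have h1 : ((n + 1 : ℕ) : ℝ) * a = a + n * a := by push_cast; ring
    have h2 : ((n + 1 : ℕ) : ℝ≥0) * v = v + n * v := by push_cast; ring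
    rw [h1, h2, ← h, Measure.lintegral_conv hf]
    exact lintegral_congr e2

/-- The two-term rearrangement inequality. It is proved by adding the differences `e` and `f`, as
subtraction is not available in `ℝ≥0∞`. -/
theorem ennreal_mul_add_mul_le {a b x y : ℝ≥0∞} (hab : a ≤ b) (hxy : x ≤ y) :
    a * y + b * x ≤ a * x + b * y := by
  obtain ⟨e, rfl⟩ := exists_add_of_le hab
  obtain ⟨f, rfl⟩ := exists_add_of_le hxy
  calc a * (x + f) + (a + e) * x ≤ a * (x + f) + (a + e) * x + e * f := le_self_add
    _ = a * x + (a + e) * (x + f) := by ring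

/-- An even function that increases away from `0` has its least Gaussian average when the mean
is `0`. -/
theorem lintegral_gaussianReal_zero_le {ψ : ℝ → ℝ≥0∞} (hψ : Measurable ψ)
    (hmono : ∀ x y, |x| ≤ |y| → ψ x ≤ ψ y) (a : ℝ) {w : ℝ≥0} (hw : w ≠ 0) :
    ∫⁻ z, ψ z ∂gaussianReal 0 w ≤ ∫⁻ z, ψ z ∂gaussianReal a w := by
  let p : ℝ → ℝ≥0∞ := gaussianPDF 0 w
  have hp : Measurable p := measurable_gaussianPDF _ _
  have hpmono : ∀ x y, |x| ≤ |y| → p y ≤ p x := fun x y h => by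
    refine ENNReal.ofReal_le_ofReal ?_
    simp only [gaussianPDFReal, sub_zero]
    have h2 : x ^ 2 ≤ y ^ 2 := sq_le_sq.2 h
    gcongr
  have hpeven : ∀ x, p (-x) = p x := fun x =>
    le_antisymm (hpmono _ _ (by simp)) (hpmono _ _ (by simp))
  have hψeven : ∀ x, ψ (-x) = ψ x := fun x =>
    le_antisymm (hmono _ _ (by simp)) (hmono _ _ (by simp))
  have e0 : ∫⁻ z, ψ z ∂gaussianReal 0 w = ∫⁻ z, p z * ψ z := by
    rw [gaussianReal_of_var_ne_zero _ hw]
    exact lintegral_withDensity_eq_lintegral_mul _ hp hψ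
  have ea : ∫⁻ z, ψ z ∂gaussianReal a w = ∫⁻ z, p z * ψ (z + a) := by
    have e : gaussianReal a w = (gaussianReal 0 w).map fun y => y + a := by
      rw [gaussianReal_map_add_const, zero_add]
    rw [e, lintegral_map hψ (by fun_prop), gaussianReal_of_var_ne_zero _ hw]
    exact lintegral_withDensity_eq_lintegral_mul _ hp (by fun_prop)
  -- Both Gaussian averages are shifted by `± a/2`. Summing the two shifts gives twice each average
  -- and, for each `y`, puts the values of `p` and `ψ` at the same two points `y ± a/2`, paired in
  -- opposite order on one side and crosswise on the other.
  have s1 : ∫⁻ y, p (y - a / 2) * ψ (y - a / 2) = ∫⁻ z, p z * ψ z :=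
    lintegral_sub_right_eq_self (fun z => p z * ψ z) (a / 2)
  have s2 : ∫⁻ y, p (y + a / 2) * ψ (y + a / 2) = ∫⁻ z, p z * ψ z :=
    lintegral_add_right_eq_self (fun z => p z * ψ z) (a / 2)
  have s3 : ∫⁻ y, p (y - a / 2) * ψ (y + a / 2) = ∫⁻ z, p z * ψ (z + a) := by
    rw [← lintegral_sub_right_eq_self (fun z => p z * ψ (z + a)) (a / 2)]
    refine lintegral_congr fun y => ?_
    congr 2
    ring
  have s4 : ∫⁻ y, p (y + a / 2) * ψ (y - a / 2) = ∫⁻ z, p z * ψ (z + a) := by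
    rw [← s3, ← lintegral_neg_eq_self (fun y => p (y - a / 2) * ψ (y + a / 2))]
    refine lintegral_congr fun y => ?_
    rw [← hpeven, ← hψeven]
    congr 2 <;> ring
  -- Since `p` decreases and `ψ` increases in the absolute value, pairing at equal points is the
  -- smaller of the two pairings.
  have hpt : ∀ y, p (y - a / 2) * ψ (y - a / 2) + p (y + a / 2) * ψ (y + a / 2) ≤
      p (y - a / 2) * ψ (y + a / 2) + p (y + a / 2) * ψ (y - a / 2) := fun y => by
    rcases le_total |y - a / 2| |y + a / 2| with h | h
    · have := ennreal_mul_add_mul_le (hpmono _ _ h) (hmono _ _ h)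
      rw [add_comm, add_comm (p (y - a / 2) * _)]
      exact this
    · exact ennreal_mul_add_mul_le (hpmono _ _ h) (hmono _ _ h)
  have hI := lintegral_mono (μ := volume) hpt
  rw [lintegral_add_left (by fun_prop), lintegral_add_left (by fun_prop), s1, s2, s3, s4,
    ← two_mul, ← two_mul] at hI
  rw [e0, ea]
  exact (ENNReal.mul_le_mul_iff_right (by simp) (by simp)).1 hI

end Gaussian

/-! ### Gaussian noise added to a Gaussian sample -/

section Conv

variable {d : ℕ}

theorem map_add_pi_prod_pi {ι E : Type*} [Fintype ι] [MeasurableSpace E] [Add E]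
    [MeasurableAdd₂ E] (μ ν : ι → Measure E) [∀ i, IsProbabilityMeasure (μ i)]
    [∀ i, IsProbabilityMeasure (ν i)] :
    ((Measure.pi μ).prod (Measure.pi ν)).map (fun p i => p.1 i + p.2 i) =
      Measure.pi fun i => ((μ i).prod (ν i)).map fun q => q.1 + q.2 := by
  have h := (measurePreserving_arrowProdEquivProdArrow E E ι μ ν)
  have hp : ∀ i, IsProbabilityMeasure (((μ i).prod (ν i)).map fun q => q.1 + q.2) := fun i =>
    Measure.isProbabilityMeasure_map (by fun_prop)
  rw [← h.map_eq, Measure.map_map (by fun_prop) h.measurable,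
    ← Measure.pi_map_pi (fun i => by fun_prop)]
  rfl

/-- Independent Gaussian variances add. Hence, once the noise variance is fixed, a corrupted point
is just a Gaussian observation of lower precision. -/
theorem map_add_gaussPrec_noise (x : Vec d) (r v : Fin d → ℝ≥0) (K : ℕ) :
    ((Measure.pi fun _ : Fin K => gaussPrec x r).prod (noiseLaw K v)).map
        (fun p j => p.1 j + p.2 j) =
      Measure.pi fun _ : Fin K => gaussPrec x fun k => ((r k)⁻¹ + v k)⁻¹ := by
  unfold noiseLaw
  rw [map_add_pi_prod_pi]
  congr 1
  funext _
  have h : (fun q : Vec d × Vec d => q.1 + q.2) = fun p k => p.1 k + p.2 k := rfl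
  unfold gaussPrec
  rw [h, map_add_pi_prod_pi]
  congr 1
  funext k
  have := gaussianReal_conv_gaussianReal (m₁ := x k) (m₂ := 0) (v₁ := (r k)⁻¹) (v₂ := v k)
  rw [add_zero] at this
  rw [inv_inv, ← this]
  rfl

end Conv

/-! ### A lower bound for the risk of a deviating agent -/

section Deviation

variable {d : ℕ}

theorem lintegral_add_noise (x : Vec d) (r v : Fin d → ℝ≥0) (K : ℕ)
    {f : (Fin K → Vec d) → ℝ≥0∞} (hf : Measurable f) :
    ∫⁻ R, ∫⁻ ε, f (fun j => R j + ε j) ∂noiseLaw K v ∂(Measure.pi fun _ : Fin K => gaussPrec x r) =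
      ∫⁻ W, f W ∂sampleKernel (fun k => ((r k)⁻¹ + v k)⁻¹) K x := by
  have hm : Measurable fun p : (Fin K → Vec d) × (Fin K → Vec d) => f fun j => p.1 j + p.2 j :=
    hf.comp (by fun_prop)
  rw [sampleKernel_apply, ← map_add_gaussPrec_noise, lintegral_map hf (by fun_prop)]
  exact (lintegral_prod _ hm.aemeasurable).symm

theorem lintegral_sampleKernel_mean (x : Vec d) (r : Fin d → ℝ≥0) {k : ℕ} (hk : 0 < k) (l : Fin d)
    {f : ℝ → ℝ≥0∞} (hf : Measurable f) :
    ∫⁻ Z, f (Dataset.mean ⟨k, Z⟩ l) ∂sampleKernel r k x =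
      ∫⁻ y, f y ∂gaussianReal (x l) ((k * r l)⁻¹) := by
  have hk' : (k : ℝ) ≠ 0 := by positivity
  have e1 : (Measure.pi fun _ : Fin k => gaussianReal (x l) (r l)⁻¹) =
      (Measure.pi fun _ : Fin k => gaussPrec x r).map fun Z i => Z i l := by
    have h := Measure.pi_map_pi (μ := fun _ : Fin k => gaussPrec x r) (f := fun _ y => y l)
      fun _ => (measurable_pi_apply l).aemeasurable
    rw [h]
    simp_rw [gaussPrec_map_eval]
  have e2 := lintegral_pi_gaussianReal_sum (x l) (r l)⁻¹ k (f := fun y => f ((k : ℝ)⁻¹ * y))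
    (by fun_prop)
  rw [e1, lintegral_map (by fun_prop) (by fun_prop)] at e2
  have e3 : ∀ Z : Fin k → Vec d, Dataset.mean ⟨k, Z⟩ l = (k : ℝ)⁻¹ * ∑ i, Z i l := fun Z => by
    simp [Dataset.mean, Dataset.sum]
  simp_rw [e3, sampleKernel_apply]
  rw [e2, ← lintegral_map (f := f) hf (by fun_prop), gaussianReal_map_const_mul]
  congr 2
  · field_simp
  · ext
    simp
    field_simp

/-- The predictive law of the sample mean: the uncertainty about the parameter adds to the sampling
variance. -/
theorem lintegral_gaussPrec_sampleKernel_mean (a : Vec d) (s r : Fin d → ℝ≥0) {k : ℕ} (hk : 0 < k)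
    (l : Fin d) {f : ℝ → ℝ≥0∞} (hf : Measurable f) :
    ∫⁻ x, ∫⁻ Z, f (Dataset.mean ⟨k, Z⟩ l) ∂sampleKernel r k x ∂gaussPrec a s =
      ∫⁻ y, f y ∂gaussianReal (a l) ((s l)⁻¹ + (k * r l)⁻¹) := by
  have hm : Measurable fun t : ℝ => ∫⁻ y, f y ∂gaussianReal t ((k * r l)⁻¹) := by
    let κ : Kernel ℝ ℝ := ⟨fun t => gaussianReal t ((k * r l)⁻¹), measurable_gaussianReal.comp
      (g := Function.uncurry gaussianReal) (f := fun t : ℝ => (t, ((k * r l)⁻¹ : ℝ≥0)))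
      (measurable_id.prodMk measurable_const)⟩
    exact hf.lintegral_kernel (κ := κ)
  simp_rw [lintegral_sampleKernel_mean _ _ hk l hf]
  rw [← lintegral_gaussianReal_gaussianReal _ _ _ hf, ← gaussPrec_map_eval a s l,
    lintegral_map hm (measurable_pi_apply l)]

/-- The variance of a coordinate of the mean, given data of precision `A` and `K` points with
noise of variance `q`. -/
noncomputable def postVar (σ A : ℝ) (K : ℕ) (q : ℝ) : ℝ := (A + K / (σ ^ 2 + q))⁻¹

theorem measurable_postVar (σ A : ℝ) (K : ℕ) : Measurable (postVar σ A K) := by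
  unfold postVar
  fun_prop

theorem postVar_nonneg {σ A : ℝ} (hA : 0 < A) (K : ℕ) {q : ℝ} (hq : 0 ≤ q) :
    0 ≤ postVar σ A K q := by
  unfold postVar
  positivity

theorem postVar_le {σ A : ℝ} (hA : 0 < A) (K : ℕ) {q : ℝ} (hq : 0 ≤ q) :
    postVar σ A K q ≤ A⁻¹ := by
  unfold postVar
  have : 0 ≤ K / (σ ^ 2 + q) := by positivity
  exact inv_anti₀ hA (by linarith)

theorem postVar_mono {σ A : ℝ} (hσ : 0 < σ) (hA : 0 < A) (K : ℕ) {q q' : ℝ} (hq : 0 ≤ q)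
    (hqq' : q ≤ q') : postVar σ A K q ≤ postVar σ A K q' := by
  unfold postVar
  have hq' : 0 ≤ q' := hq.trans hqq'
  refine inv_anti₀ (by positivity) ?_
  gcongr

/-- The average posterior variance in a coordinate is at least that of the best submission. -/
theorem lintegral_postVar_le {σ A α : ℝ} (hσ : 0 < σ) (hA : 0 < A) (K : ℕ) (a b : ℝ) {w : ℝ≥0}
    (hw : w ≠ 0) :
    ∫⁻ z, ENNReal.ofReal (postVar σ A K (α ^ 2 * w * z ^ 2)) ∂gaussianReal 0 1 ≤
      ∫⁻ z, ENNReal.ofReal (postVar σ A K (α ^ 2 * (b - z) ^ 2)) ∂gaussianReal a w := by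
  let ψ : ℝ → ℝ≥0∞ := fun z => ENNReal.ofReal (postVar σ A K (α ^ 2 * z ^ 2))
  have hψ : Measurable ψ := ((measurable_postVar σ A K).comp (by fun_prop)).ennreal_ofReal
  have hmono : ∀ x y, |x| ≤ |y| → ψ x ≤ ψ y := fun x y h =>
    ENNReal.ofReal_le_ofReal (postVar_mono hσ hA K (by positivity)
      (mul_le_mul_of_nonneg_left (sq_le_sq.2 h) (sq_nonneg α)))
  have h1 : ∫⁻ z, ψ (b - z) ∂gaussianReal a w = ∫⁻ z, ψ z ∂gaussianReal (b - a) w := by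
    rw [← gaussianReal_map_const_sub, lintegral_map hψ (by fun_prop)]
  have h2 : ∫⁻ z, ψ (√w * z) ∂gaussianReal 0 1 = ∫⁻ z, ψ z ∂gaussianReal 0 w := by
    rw [← lintegral_map (f := ψ) hψ (by fun_prop), gaussianReal_map_const_mul, mul_zero]
    congr 2
    ext
    simp
  calc _ = ∫⁻ z, ψ (√w * z) ∂gaussianReal 0 1 := by
        refine lintegral_congr fun z => ?_
        simp only [ψ, mul_pow, Real.sq_sqrt w.coe_nonneg, mul_assoc]
    _ ≤ ∫⁻ z, ψ (b - z) ∂gaussianReal a w := by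
        rw [h1, h2]
        exact lintegral_gaussianReal_zero_le hψ hmono _ hw

/-- The noise variance depends on `X` and `Z` only, so the observations are peeled off in the order
corrupted points, `Z`, `X`. For fixed `X` and `Z` the corrupted points have known precision and the
risk is at least the posterior variance. For fixed `X`, the submission is a fixed vector and `Z̄` is
Gaussian, so the rearrangement inequality replaces the submission by the best centre. The result no
longer depends on `X`, nor on the functions `submit` and `estimate`. -/
theorem ofReal_le_iSup_splitRisk {σ : ℝ} (hσ : 0 < σ) (α : ℝ) (s : Strategy d (Allocation d))
    {k : ℕ} (hk : 0 < k) (K : ℕ) {δ : ℝ} (hδ : 0 < δ) :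
    ENNReal.ofReal (d * ∫ z, postVar σ ((δ + s.n + k) / σ ^ 2) K
        (α ^ 2 * (σ ^ 2 / (δ + s.n) + σ ^ 2 / k) * z ^ 2) ∂gaussianReal 0 1) ≤
      ⨆ θ ∈ boundedVariance d σ, splitRisk α s k K θ := by
  have hσ2 : 0 < σ ^ 2 := by positivity
  set A : ℝ := (δ + s.n + k) / σ ^ 2 with hAdef
  have hA : 0 < A := by positivity
  set r : Fin d → ℝ≥0 := unitPrec d σ with hr
  have hr0 : ∀ l, 0 < r l := unitPrec_pos hσ
  have hrc : ∀ l, (r l : ℝ) = (σ ^ 2)⁻¹ := fun l => by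
    simp [hr, unitPrec, max_eq_left hσ2.le]
  have hns : ∀ (n : ℕ) l, ((n • r) l : ℝ) = n * (σ ^ 2)⁻¹ := fun n l => by
    rw [Pi.smul_apply, nsmul_eq_mul, NNReal.coe_mul, NNReal.coe_natCast, hrc]
  set p : Fin d → ℝ≥0 := fun _ => (δ / σ ^ 2).toNNReal with hp
  have hp0 : ∀ l, 0 < p l := fun l => by simpa [hp] using (by positivity : 0 < δ / σ ^ 2)
  have hpc : ∀ l, (p l : ℝ) = δ / σ ^ 2 := fun l =>
    Real.coe_toNNReal _ (by positivity : 0 ≤ δ / σ ^ 2)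
  set w : ℝ≥0 := (σ ^ 2 / (δ + s.n) + σ ^ 2 / k).toNNReal with hw
  have hwpos : 0 < σ ^ 2 / (δ + s.n) + σ ^ 2 / k := by positivity
  have hwc : (w : ℝ) = σ ^ 2 / (δ + s.n) + σ ^ 2 / k := Real.coe_toNNReal _ hwpos.le
  have hw0 : w ≠ 0 := by
    rw [← NNReal.coe_ne_zero, hwc]
    exact hwpos.ne'
  -- the precisions of the corrupted points
  let q : (Fin s.n → Vec d) → (Fin k → Vec d) → Fin d → ℝ≥0 := fun X Z l =>
    ((r l)⁻¹ + splitEtaSq α s X Z l)⁻¹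
  have hq0 : ∀ X Z l, 0 < q X Z l := fun X Z l => by
    have := hr0 l
    simp only [q]
    positivity
  let L : Vec d → (Fin s.n → Vec d) → (Fin k → Vec d) → (Fin K → Vec d) → ℝ≥0∞ := fun x X Z R =>
    ∫⁻ ε, splitLoss α s x X Z R ε ∂noiseLaw K (splitEtaSq α s X Z)
  let est : (Fin s.n → Vec d) → (Fin k → Vec d) → (Fin K → Vec d) → Vec d := fun X Z W =>
    s.estimate ⟨s.n, X⟩ (s.submit ⟨s.n, X⟩)
      (⟨k, Z⟩, ⟨K, W⟩, etaSq α (s.submit ⟨s.n, X⟩) ⟨k, Z⟩)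
  have hest := measurable_estimate_split α s k K
  have hnoise : ∀ x X Z, ∫⁻ R, L x X Z R ∂sampleKernel r K x =
      ∫⁻ W, ENNReal.ofReal (sqDist (est X Z W) x) ∂sampleKernel (q X Z) K x := fun x X Z => by
    refine lintegral_add_noise x r (splitEtaSq α s X Z) K
      (f := fun W => ENNReal.ofReal (sqDist (est X Z W) x)) ?_
    have h1 : Measurable fun W => est X Z W :=
      hest.comp (f := fun W : Fin K → Vec d => (X, Z, W)) (by fun_prop)
    exact (measurable_sqDist.comp (h1.prodMk measurable_const)).ennreal_ofReal
  let Ψ : (Fin s.n → Vec d) → (Fin k → Vec d) → ℝ≥0∞ := fun X Z =>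
    ∑ l, ENNReal.ofReal (postVar σ A K (α ^ 2 * ((s.submit ⟨s.n, X⟩).mean l -
      Dataset.mean ⟨k, Z⟩ l) ^ 2))
  -- After `X` and `Z` the prior precision is `(δ + n + k)/σ²`; the `K` corrupted points add `K/(σ²
  -- + η²)`, which gives `postVar`.
  have hpost : ∀ X Z (b : Vec d), Ψ X Z ≤
      ∫⁻ x, ∫⁻ R, L x X Z R ∂sampleKernel r K x ∂gaussPrec b (p + s.n • r + k • r) := by
    intro X Z b
    simp_rw [hnoise]
    have h1 : Measurable fun W : (Fin K → Vec d) × Unit => est X Z W.1 :=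
      hest.comp (f := fun W : (Fin K → Vec d) × Unit => (X, Z, W.1)) (by fun_prop)
    have h := ofReal_le_bayesRisk (bayesDominates_sampleKernel (hq0 X Z) K)
      (Kernel.const _ (Measure.dirac ())) h1 (s := p + s.n • r + k • r)
      (fun l => add_pos_of_pos_of_nonneg (add_pos_of_pos_of_nonneg (hp0 l) bot_le) bot_le) b
    simp only [Kernel.const_apply, lintegral_dirac] at h
    refine le_trans (le_of_eq ?_) h
    rw [ENNReal.ofReal_sum_of_nonneg fun l _ => by positivity]
    refine Finset.sum_congr rfl fun l _ => congrArg _ ?_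
    have hη : (splitEtaSq α s X Z l : ℝ) = α ^ 2 * ((s.submit ⟨s.n, X⟩).mean l -
        Dataset.mean ⟨k, Z⟩ l) ^ 2 := Real.coe_toNNReal _ (by positivity)
    have hq : ((K • q X Z) l : ℝ) = K / (σ ^ 2 + splitEtaSq α s X Z l) := by
      rw [Pi.smul_apply, nsmul_eq_mul, NNReal.coe_mul, NNReal.coe_natCast, div_eq_mul_inv]
      simp only [q, NNReal.coe_inv, NNReal.coe_add, hrc, inv_inv]
    rw [postVar, hq, hη, Pi.add_apply, Pi.add_apply, NNReal.coe_add, NNReal.coe_add, hns _ l, hns _ l, hpc l,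
      hAdef]
    congr 2
    field_simp
  -- the average over the uncorrupted points
  let C : ℝ≥0∞ := ∑ _l : Fin d, ∫⁻ z, ENNReal.ofReal (postVar σ A K (α ^ 2 * w * z ^ 2))
    ∂gaussianReal 0 1
  have hmeasΨ : ∀ X l, Measurable fun Z : Fin k → Vec d =>
      ENNReal.ofReal (postVar σ A K (α ^ 2 * ((s.submit ⟨s.n, X⟩).mean l -
        Dataset.mean ⟨k, Z⟩ l) ^ 2)) := fun X l => by
    refine ((measurable_postVar σ A K).comp ?_).ennreal_ofReal
    have hm : Measurable fun Z : Fin k → Vec d => Dataset.mean ⟨k, Z⟩ l := by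
      simp only [Dataset.mean, Dataset.sum, Finset.sum_apply]
      have hc : ∀ c, Measurable fun Z : Fin k → Vec d => Z c l := fun c => by fun_prop
      exact Measurable.const_mul (f := fun Z : Fin k → Vec d => ∑ c : Fin k, Z c l)
        (Finset.measurable_sum _ fun c _ => hc c) (k : ℝ)⁻¹
    fun_prop
  have hmid : ∀ X (b : Vec d),
      C ≤ ∫⁻ x, ∫⁻ Z, Ψ X Z ∂sampleKernel r k x ∂gaussPrec b (p + s.n • r) := by
    intro X b
    have hmk : ∀ l, Measurable fun x => ∫⁻ Z, ENNReal.ofReal (postVar σ A K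
        (α ^ 2 * ((s.submit ⟨s.n, X⟩).mean l - Dataset.mean ⟨k, Z⟩ l) ^ 2))
        ∂sampleKernel r k x := fun l => (hmeasΨ X l).lintegral_kernel
    simp only [Ψ]
    simp_rw [lintegral_finsetSum _ fun l _ => hmeasΨ X l]
    rw [lintegral_finsetSum _ fun l _ => hmk l]
    refine Finset.sum_le_sum fun l _ => ?_
    rw [lintegral_gaussPrec_sampleKernel_mean b _ r hk l
      (f := fun y => ENNReal.ofReal (postVar σ A K (α ^ 2 * ((s.submit ⟨s.n, X⟩).mean l - y) ^ 2)))
      (((measurable_postVar σ A K).comp (by fun_prop)).ennreal_ofReal)]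
    -- The variance `w` of `Z̄` given `X` is the posterior variance after `δ + n` points plus the
    -- variance of a mean of `k` points.
    have e : ((p + s.n • r) l)⁻¹ + (k * r l)⁻¹ = w := by
      ext
      rw [NNReal.coe_add, NNReal.coe_inv, NNReal.coe_inv, Pi.add_apply, NNReal.coe_add, hns _ l, hpc l,
        NNReal.coe_mul, NNReal.coe_natCast, hrc l, hwc]
      field_simp
    rw [e]
    exact lintegral_postVar_le hσ hA K _ _ hw0
  -- measurability of the losses
  have hL : Measurable fun t : Vec d × (Fin s.n → Vec d) × (Fin k → Vec d) =>
      ∫⁻ R, L t.1 t.2.1 t.2.2 R ∂sampleKernel r K t.1 := by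
    refine Measurable.lintegral_kernel_prod_right'
      (κ := Kernel.prodMkRight ((Fin s.n → Vec d) × (Fin k → Vec d)) (sampleKernel r K))
      (f := fun t : (Vec d × (Fin s.n → Vec d) × (Fin k → Vec d)) × (Fin K → Vec d) =>
        L t.1.1 t.1.2.1 t.1.2.2 t.2) ?_
    exact (measurable_lintegral_splitLoss α s k K).comp
      (f := fun t : (Vec d × (Fin s.n → Vec d) × (Fin k → Vec d)) × (Fin K → Vec d) =>
        (t.1.1, t.1.2.1, t.1.2.2, t.2)) (by fun_prop)
  have hF2 : ∀ X, Measurable (Function.uncurry fun (x : Vec d) (Z : Fin k → Vec d) =>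
      ∫⁻ R, L x X Z R ∂sampleKernel r K x) := fun X =>
    hL.comp (f := fun t : Vec d × (Fin k → Vec d) => (t.1, X, t.2)) (by fun_prop)
  have hF1 : Measurable (Function.uncurry fun (x : Vec d) (X : Fin s.n → Vec d) =>
      ∫⁻ Z, ∫⁻ R, L x X Z R ∂sampleKernel r K x ∂sampleKernel r k x) :=
    Measurable.lintegral_kernel_prod_right'
      (κ := Kernel.prodMkRight (Fin s.n → Vec d) (sampleKernel r k))
      (f := fun t : (Vec d × (Fin s.n → Vec d)) × (Fin k → Vec d) =>
        ∫⁻ R, L t.1.1 t.1.2 t.2 R ∂sampleKernel r K t.1.1)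
      (hL.comp (f := fun t : (Vec d × (Fin s.n → Vec d)) × (Fin k → Vec d) =>
        (t.1.1, t.1.2, t.2)) (by fun_prop))
  have hX : ∀ X (b : Vec d), C ≤ ∫⁻ x, ∫⁻ Z, ∫⁻ R, L x X Z R ∂sampleKernel r K x
      ∂sampleKernel r k x ∂gaussPrec b (p + s.n • r) := fun X b =>
    (hmid X b).trans (bayesDominates_sampleKernel hr0 k (p + s.n • r)
      (fun l => add_pos_of_pos_of_nonneg (hp0 l) bot_le)
      (fun x Z => ∫⁻ R, L x X Z R ∂sampleKernel r K x) (fun _ Z => Ψ X Z) (hF2 X)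
      ((Finset.measurable_sum _ fun l _ => hmeasΨ X l).comp measurable_snd)
      (fun Z b' => by simpa using hpost X Z b') b)
  -- The bound `C` is the same for every `X`, so it passes through the average over the agent's own
  -- data.
  have hall := bayesDominates_sampleKernel hr0 s.n p hp0
    (fun x X => ∫⁻ Z, ∫⁻ R, L x X Z R ∂sampleKernel r K x ∂sampleKernel r k x)
    (fun _ _ => C) hF1 measurable_const (fun X b => by simpa using hX X b) 0
  have hint : Integrable (fun z => postVar σ A K (α ^ 2 * w * z ^ 2)) (gaussianReal 0 1) := by
    refine Integrable.of_bound (C := A⁻¹)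
      ((measurable_postVar σ A K).comp (by fun_prop)).aestronglyMeasurable
      (ae_of_all _ fun z => ?_)
    rw [Real.norm_of_nonneg (postVar_nonneg hA K (by positivity))]
    exact postVar_le hA K (by positivity)
  have hC : ENNReal.ofReal (d * ∫ z, postVar σ A K
      (α ^ 2 * (σ ^ 2 / (δ + s.n) + σ ^ 2 / k) * z ^ 2) ∂gaussianReal 0 1) = C := by
    simp only [C]
    rw [Finset.sum_const, Finset.card_univ, Fintype.card_fin, nsmul_eq_mul,
      ← ofReal_integral_eq_lintegral_ofReal hint
        (ae_of_all _ fun z => postVar_nonneg hA K (by positivity)),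
      ENNReal.ofReal_mul (Nat.cast_nonneg _), ENNReal.ofReal_natCast, hwc]
  rw [hC]
  have h2 := lintegral_gaussPrec_le_iSup σ (splitRisk α s k K) 0 p
  refine le_trans ?_ h2
  simp only [lintegral_const, measure_univ, mul_one] at hall
  refine hall.trans (le_of_eq (lintegral_congr fun x => ?_))
  rw [splitRisk, meanOf_gaussPrec]
  rfl

end Deviation

/-! ### The risk of the recommended strategies -/

section Upper

variable {d m : ℕ}

theorem Dataset.sum_mk {n : ℕ} (X : Fin n → Vec d) (l : Fin d) :
    Dataset.sum ⟨n, X⟩ l = ∑ i, X i l := by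
  simp [Dataset.sum]

/-- The average of a quadratic function of the centred sums of a sample. -/
theorem lintegral_quadratic_sum (ρ : Measure (Vec d)) [IsProbabilityMeasure ρ]
    (hρ : ∀ l, MemLp (fun x : Vec d => x l) 2 ρ) (n : ℕ) (p q r : Fin d → ℝ)
    (h0 : ∀ S : Fin d → ℝ, 0 ≤ ∑ l, (p l * S l ^ 2 + q l * S l + r l)) :
    ∫⁻ Z : Fin n → Vec d, ENNReal.ofReal (∑ l, (p l * (∑ i, (Z i l - meanOf ρ l)) ^ 2 +
        q l * (∑ i, (Z i l - meanOf ρ l)) + r l)) ∂(Measure.pi fun _ => ρ) =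
      ENNReal.ofReal (∑ l, (p l * (n * Var[fun x : Vec d => x l; ρ]) + r l)) := by
  set P := Measure.pi fun _ : Fin n => ρ with hP
  have hc : ∀ l, MemLp (fun x : Vec d => x l - meanOf ρ l) 2 ρ := fun l =>
    (hρ l).sub (memLp_const _)
  have hci : ∀ l (i : Fin n), MemLp (fun Z : Fin n → Vec d => Z i l - meanOf ρ l) 2 P := fun l i =>
    (hc l).comp_measurePreserving (measurePreserving_eval (fun _ : Fin n => ρ) i)
  have hS : ∀ l, MemLp (fun Z : Fin n → Vec d => ∑ i, (Z i l - meanOf ρ l)) 2 P := fun l =>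
    memLp_finsetSum _ fun i _ => hci l i
  have hmean0 : ∀ l, ∫ x, (x l - meanOf ρ l) ∂ρ = 0 := fun l => by
    rw [integral_sub ((hρ l).integrable one_le_two) (integrable_const _)]
    simp [meanOf]
  have heval : ∀ l (i : Fin n) (c : ℝ), ∫ Z, (Z i l - c) ∂P = ∫ x, (x l - c) ∂ρ := fun l i c => by
    have hm : Measurable fun x : Vec d => x l - c := by fun_prop
    have e : P.map (fun Z => Z i) = ρ := (measurePreserving_eval (fun _ : Fin n => ρ) i).map_eq
    have h := integral_map (μ := P) (φ := fun Z : Fin n → Vec d => Z i)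
      (measurable_pi_apply i).aemeasurable (f := fun x => x l - c) hm.aestronglyMeasurable
    rw [e] at h
    exact h.symm
  have hmean : ∀ l, ∫ Z, ∑ i, (Z i l - meanOf ρ l) ∂P = 0 := fun l => by
    rw [integral_finsetSum _ fun i _ => (hci l i).integrable one_le_two]
    refine Finset.sum_eq_zero fun i _ => ?_
    rw [← hmean0 l]
    exact heval l i _
  have hsq : ∀ l, ∫ Z, (∑ i, (Z i l - meanOf ρ l)) ^ 2 ∂P =
      n * Var[fun x : Vec d => x l; ρ] := fun l => by
    rw [← variance_of_integral_eq_zero (hS l).aestronglyMeasurable.aemeasurable (hmean l)]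
    have h := variance_sum_pi (μ := fun _ : Fin n => ρ)
      (X := fun _ x => x l - meanOf ρ l) fun _ => hc l
    have e : (fun Z : Fin n → Vec d => ∑ i, (Z i l - meanOf ρ l)) =
        ∑ i, fun Z : Fin n → Vec d => Z i l - meanOf ρ l := by
      ext Z
      simp
    rw [e, h, variance_sub_const (hρ l).aestronglyMeasurable]
    simp
  have hint1 : ∀ l, Integrable (fun Z : Fin n → Vec d =>
      p l * (∑ i, (Z i l - meanOf ρ l)) ^ 2) P := fun l => (hS l).integrable_sq.const_mul _
  have hint2 : ∀ l, Integrable (fun Z : Fin n → Vec d =>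
      q l * (∑ i, (Z i l - meanOf ρ l))) P := fun l => ((hS l).integrable one_le_two).const_mul _
  have hint : ∀ l, Integrable (fun Z : Fin n → Vec d => p l * (∑ i, (Z i l - meanOf ρ l)) ^ 2 +
      q l * (∑ i, (Z i l - meanOf ρ l)) + r l) P := fun l =>
    ((hint1 l).add (hint2 l)).add (integrable_const _)
  rw [← ofReal_integral_eq_lintegral_ofReal (integrable_finsetSum _ fun l _ => hint l)
    (ae_of_all _ fun Z => h0 fun l => ∑ i, (Z i l - meanOf ρ l)),
    integral_finsetSum _ fun l _ => hint l]
  congr 1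
  refine Finset.sum_congr rfl fun l _ => ?_
  refine (integral_add ((hint1 l).add (hint2 l)) (integrable_const (r l))).trans ?_
  rw [integral_add' (hint1 l) (hint2 l), integral_const_mul, integral_const_mul, hsq, hmean]
  simp

/-- This holds also where `v l = 0`: the convention `0⁻¹ = 0` makes precision `0` encode the point
mass. -/
theorem noiseLaw_eq (K : ℕ) (v : Fin d → ℝ≥0) :
    noiseLaw K v = Measure.pi fun _ : Fin K => gaussPrec 0 fun l => (v l)⁻¹ := by
  simp [noiseLaw, gaussPrec]

/-- The average over the noise of a squared distance. -/
theorem lintegral_noiseLaw_sum (K : ℕ) (v : Fin d → ℝ≥0) (u : Fin d → ℝ) (b : ℝ) :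
    ∫⁻ ε, ENNReal.ofReal (∑ l, (u l + b * ∑ i, ε i l) ^ 2) ∂noiseLaw K v =
      ENNReal.ofReal (∑ l, (u l ^ 2 + b ^ 2 * (K * v l))) := by
  have h := lintegral_quadratic_sum (gaussPrec 0 fun l => (v l)⁻¹)
    (fun l => memLp_eval_gaussPrec _ _ l) K (fun _ => b ^ 2) (fun l => 2 * u l * b)
    (fun l => u l ^ 2) fun S => Finset.sum_nonneg fun l _ => by
      nlinarith [sq_nonneg (u l + b * S l)]
  simp only [meanOf_gaussPrec, variance_eval_gaussPrec, Pi.zero_apply, sub_zero, inv_inv,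
    ← noiseLaw_eq] at h
  convert h using 2
  · ext ε
    congr 1
    exact Finset.sum_congr rfl fun l _ => by ring
  · exact Finset.sum_congr rfl fun l _ => by ring

variable {θ : Measure (Vec d)} [IsProbabilityMeasure θ]

theorem lintegral_sample_sum (hθ : ∀ l, MemLp (fun x : Vec d => x l) 2 θ) (K : ℕ)
    (u r : Fin d → ℝ) (hr : ∀ l, 0 ≤ r l) (b : ℝ) :
    ∫⁻ R : Fin K → Vec d, ENNReal.ofReal (∑ l, ((u l + b * ∑ i, (R i l - meanOf θ l)) ^ 2 + r l))
        ∂(Measure.pi fun _ => θ) =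
      ENNReal.ofReal (∑ l, (u l ^ 2 + b ^ 2 * (K * Var[fun x : Vec d => x l; θ]) + r l)) := by
  have h := lintegral_quadratic_sum θ hθ K (fun _ => b ^ 2) (fun l => 2 * u l * b)
    (fun l => u l ^ 2 + r l) fun S => Finset.sum_nonneg fun l _ => by
      nlinarith [sq_nonneg (u l + b * S l), hr l]
  convert h using 2
  · ext ε
    congr 1
    exact Finset.sum_congr rfl fun l _ => by ring
  · exact Finset.sum_congr rfl fun l _ => by ring

/-- The risk when all points are used with the recommended weights. -/
theorem splitRisk_recommended_le {σ : ℝ} (hσ : 0 < σ) (hθ : θ ∈ boundedVariance d σ) (α : ℝ)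
    (s : Strategy d (Allocation d)) (hs : 0 < s.n) (K : ℕ) (hsub : s.submit = id)
    (hest : ∀ X Y A, s.estimate X Y A =
      weightedMean σ (2 * α ^ 2 * σ ^ 2 / s.n) X A.1 A.2.1) :
    splitRisk α s s.n K θ ≤ ENNReal.ofReal
      (d * (2 * s.n / σ ^ 2 + K / (σ ^ 2 + 2 * α ^ 2 * σ ^ 2 / s.n))⁻¹) := by
  obtain ⟨-, hθ⟩ := hθ
  set N : ℝ := ((s.n : ℕ) : ℝ) with hN
  have hN0 : 0 < N := Nat.cast_pos.2 hs
  set a : ℝ := 1 / σ ^ 2 with ha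
  set b : ℝ := 1 / (σ ^ 2 + 2 * α ^ 2 * σ ^ 2 / N) with hb
  have ha0 : 0 < a := by positivity
  have hb0 : 0 < b := by positivity
  set W : ℝ := a * (N + N) + b * K with hW
  have hW0 : 0 < W := by positivity
  set μ := meanOf θ with hμ
  set V : Fin d → ℝ := fun l => Var[fun x : Vec d => x l; θ] with hV
  -- the loss in terms of centred sums
  have hloss : ∀ (X : Fin s.n → Vec d) (Z : Fin s.n → Vec d) (R ε : Fin K → Vec d),
      splitLoss α s μ X Z R ε = ENNReal.ofReal (∑ l, ((a / W * (∑ i, (X i l - μ l)) +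
        a / W * (∑ i, (Z i l - μ l)) + b / W * ∑ i, (R i l - μ l)) + b / W * ∑ i, ε i l) ^ 2) := by
    intro X Z R ε
    rw [splitLoss, hest, sqDist]
    congr 1
    refine Finset.sum_congr rfl fun l _ => ?_
    simp only [weightedMean, Dataset.sum_mk, Dataset.size, Pi.add_apply, Finset.sum_add_distrib,
      Finset.sum_sub_distrib, Finset.sum_const, Finset.card_univ, Fintype.card_fin, nsmul_eq_mul]
    congr 1
    rw [← hN, ← ha, ← hb, ← hW]
    field_simp
    rw [hW]
    ring
  -- Both datasets have `N` points, so the true mean cancels and the noise variance is a quadratic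
  -- form in the centred sums. Hence only second moments of `θ` enter the risk.
  have hη : ∀ (X Z : Fin s.n → Vec d) (l : Fin d), (splitEtaSq α s X Z l : ℝ) =
      (α / N * (∑ i, (X i l - μ l)) - α / N * ∑ i, (Z i l - μ l)) ^ 2 := by
    intro X Z l
    rw [splitEtaSq, hsub, etaSq, Real.coe_toNNReal _ (by positivity)]
    simp only [Dataset.mean, Dataset.sum_mk, id, Finset.sum_sub_distrib, Finset.sum_const,
      Finset.card_univ, Fintype.card_fin, nsmul_eq_mul]
    rw [← hN]
    field_simp
    ring
  rw [splitRisk]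
  simp_rw [← hμ, hloss, lintegral_noiseLaw_sum, hη]
  have step1 : ∀ X Z : Fin s.n → Vec d, ∫⁻ R : Fin K → Vec d, ENNReal.ofReal (∑ l,
      ((a / W * (∑ i, (X i l - μ l)) + a / W * (∑ i, (Z i l - μ l)) +
        b / W * ∑ i, (R i l - μ l)) ^ 2 + (b / W) ^ 2 * (K * (α / N * (∑ i, (X i l - μ l)) -
          α / N * ∑ i, (Z i l - μ l)) ^ 2))) ∂(Measure.pi fun _ => θ) =
      ENNReal.ofReal (∑ l, (((a / W) ^ 2 + (b / W) ^ 2 * K * (α / N) ^ 2) *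
        (∑ i, (Z i l - μ l)) ^ 2 + (2 * (a / W) ^ 2 - 2 * (b / W) ^ 2 * K * (α / N) ^ 2) *
          (∑ i, (X i l - μ l)) * (∑ i, (Z i l - μ l)) +
        (((a / W) ^ 2 + (b / W) ^ 2 * K * (α / N) ^ 2) * (∑ i, (X i l - μ l)) ^ 2 +
          (b / W) ^ 2 * (K * V l)))) := by
    intro X Z
    rw [lintegral_sample_sum (fun l => (hθ l).1) K (fun l => a / W * (∑ i, (X i l - μ l)) +
      a / W * (∑ i, (Z i l - μ l))) (fun l => (b / W) ^ 2 * (K * (α / N * (∑ i, (X i l - μ l)) -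
          α / N * ∑ i, (Z i l - μ l)) ^ 2)) (fun l => by positivity)]
    congr 1
    refine Finset.sum_congr rfl fun l _ => ?_
    ring
  simp_rw [step1]
  have step2 : ∀ X : Fin s.n → Vec d, ∫⁻ Z : Fin s.n → Vec d,
      ENNReal.ofReal (∑ l, (((a / W) ^ 2 + (b / W) ^ 2 * K * (α / N) ^ 2) *
        (∑ i, (Z i l - μ l)) ^ 2 + (2 * (a / W) ^ 2 - 2 * (b / W) ^ 2 * K * (α / N) ^ 2) *
          (∑ i, (X i l - μ l)) * (∑ i, (Z i l - μ l)) +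
        (((a / W) ^ 2 + (b / W) ^ 2 * K * (α / N) ^ 2) * (∑ i, (X i l - μ l)) ^ 2 +
          (b / W) ^ 2 * (K * V l)))) ∂(Measure.pi fun _ => θ) =
      ENNReal.ofReal (∑ l, (((a / W) ^ 2 + (b / W) ^ 2 * K * (α / N) ^ 2) *
        (∑ i, (X i l - μ l)) ^ 2 + 0 * (∑ i, (X i l - μ l)) +
          (((a / W) ^ 2 + (b / W) ^ 2 * K * (α / N) ^ 2) * (N * V l) +
            (b / W) ^ 2 * (K * V l)))) := by
    intro X
    rw [lintegral_quadratic_sum θ (fun l => (hθ l).1) s.n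
      (fun _ => (a / W) ^ 2 + (b / W) ^ 2 * K * (α / N) ^ 2)
      (fun l => (2 * (a / W) ^ 2 - 2 * (b / W) ^ 2 * K * (α / N) ^ 2) * (∑ i, (X i l - μ l)))
      (fun l => ((a / W) ^ 2 + (b / W) ^ 2 * K * (α / N) ^ 2) * (∑ i, (X i l - μ l)) ^ 2 +
          (b / W) ^ 2 * (K * V l))]
    · congr 1
      refine Finset.sum_congr rfl fun l _ => ?_
      simp only [← hN, hV]
      ring
    · intro S
      refine Finset.sum_nonneg fun l _ => ?_
      have h1 : 0 ≤ (a / W) ^ 2 * (S l + ∑ i, (X i l - μ l)) ^ 2 := by positivity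
      have h2 : 0 ≤ (b / W) ^ 2 * K * (α / N) ^ 2 * (S l - ∑ i, (X i l - μ l)) ^ 2 := by positivity
      have h3 : 0 ≤ (b / W) ^ 2 * (K * V l) :=
        mul_nonneg (sq_nonneg _) (mul_nonneg (Nat.cast_nonneg _) (variance_nonneg _ _))
      nlinarith
  simp_rw [step2]
  rw [lintegral_quadratic_sum θ (fun l => (hθ l).1) s.n
      (fun _ => (a / W) ^ 2 + (b / W) ^ 2 * K * (α / N) ^ 2) (fun l => 0)
      (fun l => ((a / W) ^ 2 + (b / W) ^ 2 * K * (α / N) ^ 2) * (N * V l) +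
          (b / W) ^ 2 * (K * V l))]
  · refine ENNReal.ofReal_le_ofReal ?_
    have hle : ∀ l ∈ Finset.univ, ((a / W) ^ 2 + (b / W) ^ 2 * K * (α / N) ^ 2) * (N * V l) +
        (((a / W) ^ 2 + (b / W) ^ 2 * K * (α / N) ^ 2) * (N * V l) + (b / W) ^ 2 * (K * V l)) ≤
        W⁻¹ := by
      intro l _
      have e : ((a / W) ^ 2 + (b / W) ^ 2 * K * (α / N) ^ 2) * (N * V l) +
        (((a / W) ^ 2 + (b / W) ^ 2 * K * (α / N) ^ 2) * (N * V l) + (b / W) ^ 2 * (K * V l)) =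
        (2 * N * a ^ 2 + b ^ 2 * K * (1 + 2 * α ^ 2 / N)) / W ^ 2 * V l := by
        field_simp
        ring
      -- When the variance is `σ²`, the expected noise variance is exactly `τ²`, and the weights are
      -- the inverse variances; the variance of the weighted mean is then the inverse `W⁻¹` of the
      -- total weight. For smaller variances the same expression is only scaled down.
      have e2 : (2 * N * a ^ 2 + b ^ 2 * K * (1 + 2 * α ^ 2 / N)) * σ ^ 2 = W := by
        rw [hW, ha, hb]
        field_simp
        ring
      rw [e]
      calc _ ≤ (2 * N * a ^ 2 + b ^ 2 * K * (1 + 2 * α ^ 2 / N)) / W ^ 2 * σ ^ 2 :=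
            mul_le_mul_of_nonneg_left (hθ l).2 (by positivity)
        _ = W⁻¹ := by
            rw [div_mul_eq_mul_div, e2]
            field_simp
    refine (Finset.sum_le_sum hle).trans (le_of_eq ?_)
    rw [Finset.sum_const, Finset.card_univ, Fintype.card_fin, nsmul_eq_mul, hW, ha, hb]
    congr 2
    ring
  · intro S
    refine Finset.sum_nonneg fun l _ => ?_
    have h3 : 0 ≤ V l := variance_nonneg _ _
    exact add_nonneg (add_nonneg (by positivity) (by simp)) (add_nonneg
      (mul_nonneg (by positivity) (mul_nonneg hN0.le h3))
      (mul_nonneg (by positivity) (mul_nonneg (Nat.cast_nonneg _) h3)))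

/-- The risk of an agent who uses the mean of `n` of her own points and all `M` points of the
others. -/
theorem lintegral_mean_le {σ : ℝ} (hθ : θ ∈ boundedVariance d σ) (n M : ℕ) (hnM : 0 < n + M)
    (τ : ℝ) (hσ : 0 < σ) :
    ∫⁻ X : Fin n → Vec d, ∫⁻ D : Fin M → Vec d, ENNReal.ofReal
        (sqDist (weightedMean σ τ ⟨n, X⟩ ⟨M, D⟩ Dataset.empty) (meanOf θ))
        ∂(Measure.pi fun _ => θ) ∂(Measure.pi fun _ => θ) ≤
      ENNReal.ofReal (d * (σ ^ 2 / (n + M))) := by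
  obtain ⟨-, hθ⟩ := hθ
  have hT : 0 < (n : ℝ) + M := by exact_mod_cast hnM
  set μ := meanOf θ with hμ
  set V : Fin d → ℝ := fun l => Var[fun x : Vec d => x l; θ] with hV
  set T : ℝ := n + M with hTdef
  have hloss : ∀ (X : Fin n → Vec d) (D : Fin M → Vec d),
      sqDist (weightedMean σ τ ⟨n, X⟩ ⟨M, D⟩ Dataset.empty) μ =
        ∑ l, ((T⁻¹ * (∑ i, (X i l - μ l)) + T⁻¹ * ∑ i, (D i l - μ l)) ^ 2 + 0) := by
    intro X D
    refine Finset.sum_congr rfl fun l _ => ?_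
    have h0 : Dataset.sum (Dataset.empty : Dataset d) l = 0 := by
      rw [Dataset.empty, Dataset.sum_mk, Finset.univ_eq_empty, Finset.sum_empty]
    have h1 : ((Dataset.empty : Dataset d).1 : ℝ) = 0 := by simp [Dataset.empty]
    simp only [weightedMean, Dataset.sum_mk, h0, h1, Dataset.size, Finset.sum_sub_distrib,
      Finset.sum_const, Finset.card_univ, Fintype.card_fin, nsmul_eq_mul, mul_zero, add_zero]
    congr 1
    rw [← hTdef]
    field_simp
    rw [hTdef]
    ring
  simp_rw [hloss]
  have step : ∀ X : Fin n → Vec d, ∫⁻ D : Fin M → Vec d, ENNReal.ofReal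
      (∑ l, ((T⁻¹ * (∑ i, (X i l - μ l)) + T⁻¹ * ∑ i, (D i l - μ l)) ^ 2 + 0))
      ∂(Measure.pi fun _ => θ) = ENNReal.ofReal
      (∑ l, ((0 + T⁻¹ * ∑ i, (X i l - μ l)) ^ 2 + T⁻¹ ^ 2 * (M * V l))) := fun X => by
    rw [lintegral_sample_sum (fun l => (hθ l).1) M (fun l => T⁻¹ * (∑ i, (X i l - μ l)))
      (fun _ => 0) fun _ => le_rfl]
    congr 1
    exact Finset.sum_congr rfl fun l _ => by ring
  simp_rw [step]
  rw [lintegral_sample_sum (fun l => (hθ l).1) n (fun l => 0) (fun l => T⁻¹ ^ 2 * (M * V l))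
    fun l => mul_nonneg (sq_nonneg _) (mul_nonneg (Nat.cast_nonneg _) (variance_nonneg _ _))]
  refine ENNReal.ofReal_le_ofReal ?_
  have hle : ∀ l ∈ Finset.univ,
      (0 : ℝ) ^ 2 + T⁻¹ ^ 2 * (n * V l) + T⁻¹ ^ 2 * (M * V l) ≤ σ ^ 2 / T := fun l _ => by
    have e : (0 : ℝ) ^ 2 + T⁻¹ ^ 2 * (n * V l) + T⁻¹ ^ 2 * (M * V l) = T⁻¹ * V l := by
      field_simp
      rw [hTdef]
      ring
    rw [e, div_eq_inv_mul]
    exact mul_le_mul_of_nonneg_left (hθ l).2 (by positivity)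
  refine (Finset.sum_le_sum hle).trans (le_of_eq ?_)
  rw [Finset.sum_const, Finset.card_univ, Fintype.card_fin, nsmul_eq_mul]

end Upper

/-! ### The Mills ratio of the normal distribution -/

theorem integrable_iff_stdGaussian {f : ℝ → ℝ} :
    Integrable f (gaussianReal 0 1) ↔ Integrable (fun z => gaussianPDFReal 0 1 z * f z) := by
  rw [gaussianReal_of_var_ne_zero 0 one_ne_zero, integrable_withDensity_iff_integrable_smul₀'
    (measurable_gaussianPDF 0 1).aemeasurable (by simp [gaussianPDF])]
  simp [gaussianPDF, ENNReal.toReal_ofReal (gaussianPDFReal_nonneg _ _ _)]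

theorem integral_stdGaussian (f : ℝ → ℝ) :
    ∫ z, f z ∂gaussianReal 0 1 = ∫ z, gaussianPDFReal 0 1 z * f z := by
  simpa using integral_gaussianReal_eq_integral_smul (μ := 0) (v := 1) one_ne_zero (f := f)

theorem gaussianPDFReal_zero_one (z : ℝ) :
    gaussianPDFReal 0 1 z = (√(2 * Real.pi))⁻¹ * Real.exp (-(z ^ 2 / 2)) := by
  simp [gaussianPDFReal, neg_div]

theorem integral_exp_neg_sq_stdGaussian {w : ℝ} (hw : 0 ≤ w) :
    ∫ z, Real.exp (-w * z ^ 2) ∂gaussianReal 0 1 = (√(1 + 2 * w))⁻¹ := by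
  rw [integral_stdGaussian]
  have h : ∀ z, gaussianPDFReal 0 1 z * Real.exp (-w * z ^ 2)
      = (√(2 * Real.pi))⁻¹ * Real.exp (-((1 + 2 * w) / 2) * z ^ 2) := fun z => by
    rw [gaussianPDFReal_zero_one, mul_assoc, ← Real.exp_add]; congr 2; ring
  simp only [h]
  rw [integral_const_mul, integral_gaussian, ← Real.sqrt_inv, ← Real.sqrt_inv, ← Real.sqrt_mul
    (by positivity)]
  congr 1
  have := Real.pi_pos
  field_simp

/-- Write `1/(a + z²)` as `∫ exp(-w(a + z²)) dw` over `w > 0`, exchange the integrals and use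
`E[exp(-wz²)] = (1 + 2w)^(-1/2)`. -/
theorem integral_inv_add_sq {a : ℝ} (ha : 0 < a) :
    ∫ z, (a + z ^ 2)⁻¹ ∂gaussianReal 0 1
      = √(2 / a) * Real.exp (a / 2) * ∫ v in Set.Ioi (√(a / 2)), Real.exp (-v ^ 2) := by
  set x := √(a / 2) with hx
  have hx0 : 0 < x := by positivity
  have hx2 : x ^ 2 = a / 2 := Real.sq_sqrt (by positivity)
  -- The substitution `w = v²/a - 1/2` makes `√(1 + 2w)` linear in `v` and leaves `exp(-v²)`; `w =
  -- 0` corresponds to `v = √(a/2)`.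
  let F : ℝ → ℝ → ℝ := fun z v => 2 * v / a * Real.exp (-(v ^ 2 / a - 1 / 2) * (a + z ^ 2))
  have hF0 : ∀ z, ∀ v ∈ Set.Ioi x, 0 ≤ F z v := fun z v hv => by
    have : 0 < v := hx0.trans hv
    positivity
  have hFm : Measurable (Function.uncurry F) := by
    have : Continuous (Function.uncurry F) := by
      simp only [F, Function.uncurry_def]; fun_prop
    exact this.measurable
  have hw : ∀ v ∈ Set.Ioi x, 0 ≤ v ^ 2 / a - 1 / 2 := fun v hv => by
    have h1 : x ^ 2 ≤ v ^ 2 := by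
      have : x < v := hv
      gcongr
    rw [sub_nonneg, le_div_iff₀ ha]; linarith
  have hF1 : ∀ z, ∫⁻ v in Set.Ioi x, ENNReal.ofReal (F z v) = ENNReal.ofReal ((a + z ^ 2)⁻¹) := by
    intro z
    have hb : 0 < a + z ^ 2 := by positivity
    let g : ℝ → ℝ := fun v => -(a + z ^ 2)⁻¹ * Real.exp (-(v ^ 2 / a - 1 / 2) * (a + z ^ 2))
    have hd : ∀ v, HasDerivAt g (F z v) v := fun v => by
      have h1 : HasDerivAt (fun v : ℝ => -(v ^ 2 / a - 1 / 2) * (a + z ^ 2))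
          (-(2 * v / a) * (a + z ^ 2)) v := by
        have := (((hasDerivAt_pow 2 v).div_const a).sub_const (1 / 2)).neg.mul_const (a + z ^ 2)
        simpa using this
      refine (h1.exp.const_mul (-(a + z ^ 2)⁻¹)).congr_deriv ?_
      change _ = 2 * v / a * Real.exp _
      field_simp
    have hlim : Filter.Tendsto g Filter.atTop (nhds 0) := by
      have h1 : Filter.Tendsto (fun v : ℝ => (v ^ 2 / a - 1 / 2) * (a + z ^ 2)) Filter.atTop
          Filter.atTop := by
        refine Filter.Tendsto.atTop_mul_const hb ?_
        refine Filter.tendsto_atTop_add_const_right _ _ ?_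
        exact (Filter.tendsto_pow_atTop two_ne_zero).atTop_div_const ha
      have h2 := (Real.tendsto_exp_neg_atTop_nhds_zero.comp h1).const_mul (-(a + z ^ 2)⁻¹)
      simp only [mul_zero, Function.comp_def] at h2
      simpa only [g, neg_mul] using h2
    have hi := integrableOn_Ioi_deriv_of_nonneg' (a := x) (fun v _ => hd v) (hF0 z) hlim
    have he := integral_Ioi_of_hasDerivAt_of_nonneg' (a := x) (fun v _ => hd v) (hF0 z) hlim
    rw [← ofReal_integral_eq_lintegral_ofReal hi
      ((ae_restrict_iff' measurableSet_Ioi).2 (ae_of_all _ (hF0 z))), he]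
    congr 1
    simp only [g, hx2]
    have : -(a / 2 / a - 1 / 2) * (a + z ^ 2) = 0 := by field_simp; ring
    rw [this]; simp
  have hF2 : ∀ v ∈ Set.Ioi x, ∫⁻ z, ENNReal.ofReal (F z v) ∂gaussianReal 0 1
      = ENNReal.ofReal (√(2 / a) * Real.exp (a / 2) * Real.exp (-v ^ 2)) := by
    intro v hv
    have hv0 : 0 < v := hx0.trans hv
    have hsplit : ∀ z, F z v = (2 * v / a * Real.exp (-(v ^ 2 / a - 1 / 2) * a))
        * Real.exp (-(v ^ 2 / a - 1 / 2) * z ^ 2) := fun z => by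
      simp only [F]; rw [mul_add, Real.exp_add, mul_assoc]
    have hint : Integrable (fun z => F z v) (gaussianReal 0 1) := by
      simp only [hsplit]
      refine Integrable.const_mul ?_ _
      refine (integrable_const (1 : ℝ)).mono' (by fun_prop) (ae_of_all _ fun z => ?_)
      rw [Real.norm_eq_abs, abs_of_pos (Real.exp_pos _), Real.exp_le_one_iff]
      have := mul_nonneg (hw v hv) (sq_nonneg z)
      linarith
    rw [← ofReal_integral_eq_lintegral_ofReal hint (ae_of_all _ fun z => hF0 z v hv)]
    simp only [hsplit]
    rw [integral_const_mul, integral_exp_neg_sq_stdGaussian (hw v hv)]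
    have h1 : √(1 + 2 * (v ^ 2 / a - 1 / 2)) = v * √(2 / a) := by
      rw [show 1 + 2 * (v ^ 2 / a - 1 / 2) = v ^ 2 * (2 / a) by ring, Real.sqrt_mul (sq_nonneg v),
        Real.sqrt_sq hv0.le]
    have h2 : Real.exp (-(v ^ 2 / a - 1 / 2) * a) = Real.exp (a / 2) * Real.exp (-v ^ 2) := by
      rw [← Real.exp_add]; congr 1; field_simp; ring
    have h3 : √(2 / a) * √(2 / a) = 2 / a := Real.mul_self_sqrt (by positivity)
    have h4 : 0 < √(2 / a) := by positivity
    rw [h1, h2]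
    congr 1
    field_simp
    rw [pow_two, h3]; field_simp
  have hI : Integrable (fun z : ℝ => (a + z ^ 2)⁻¹) (gaussianReal 0 1) := by
    refine (integrable_const (a⁻¹)).mono' (by fun_prop) (ae_of_all _ fun z => ?_)
    rw [Real.norm_eq_abs, abs_of_pos (by positivity)]
    gcongr
    nlinarith [sq_nonneg z]
  have hJ : Integrable (fun v : ℝ => √(2 / a) * Real.exp (a / 2) * Real.exp (-v ^ 2))
      (volume.restrict (Set.Ioi x)) := by
    have := (integrable_exp_neg_mul_sq (b := 1) one_pos).integrableOn (s := Set.Ioi x)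
    simpa using Integrable.const_mul (by simpa [IntegrableOn] using this)
      (√(2 / a) * Real.exp (a / 2))
  have key : ENNReal.ofReal (∫ z, (a + z ^ 2)⁻¹ ∂gaussianReal 0 1) = ENNReal.ofReal
      (∫ v in Set.Ioi x, √(2 / a) * Real.exp (a / 2) * Real.exp (-v ^ 2)) := by
    rw [ofReal_integral_eq_lintegral_ofReal hI (ae_of_all _ fun z => by positivity),
      ofReal_integral_eq_lintegral_ofReal hJ (ae_of_all _ fun z => by positivity),
      ← lintegral_congr fun z => hF1 z,
      lintegral_lintegral_swap (hFm.ennreal_ofReal.aemeasurable)]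
    exact setLIntegral_congr_fun measurableSet_Ioi hF2
  rw [← integral_const_mul]
  refine (ENNReal.ofReal_eq_ofReal_iff ?_ ?_).1 key
  · exact integral_nonneg fun z => by positivity
  · exact integral_nonneg fun z => by positivity

theorem integrable_pow_stdGaussian (n : ℕ) : Integrable (fun z => z ^ n) (gaussianReal 0 1) := by
  have h := (memLp_id_gaussianReal (μ := 0) (v := 1) n).integrable_norm_pow'
  refine (integrable_norm_iff (by fun_prop)).1 ?_
  simpa using h

/-- Stein's identity for the standard normal distribution. -/
theorem integral_deriv_stdGaussian {f f' : ℝ → ℝ} (hd : ∀ z, HasDerivAt f (f' z) z)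
    (hf : Integrable f (gaussianReal 0 1)) (hf' : Integrable f' (gaussianReal 0 1))
    (hz : Integrable (fun z => z * f z) (gaussianReal 0 1)) :
    ∫ z, f' z ∂gaussianReal 0 1 = ∫ z, z * f z ∂gaussianReal 0 1 := by
  have hp : ∀ z, HasDerivAt (gaussianPDFReal 0 1) (-z * gaussianPDFReal 0 1 z) z := fun z => by
    have h1 : HasDerivAt (fun z : ℝ => -(z ^ 2 / 2)) (-z) z := by
      refine ((hasDerivAt_pow 2 z).div_const 2).neg.congr_deriv ?_
      norm_num
    have h2 := h1.exp.const_mul (√(2 * Real.pi))⁻¹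
    rw [funext gaussianPDFReal_zero_one]
    refine h2.congr_deriv ?_
    ring
  have h0 := integral_eq_zero_of_hasDerivAt_of_integrable
    (f := fun z => gaussianPDFReal 0 1 z * f z)
    (f' := fun z => gaussianPDFReal 0 1 z * f' z - gaussianPDFReal 0 1 z * (z * f z))
    (fun z => ((hp z).mul (hd z)).congr_deriv (by ring))
    ((integrable_iff_stdGaussian.1 hf').sub (integrable_iff_stdGaussian.1 hz))
    (integrable_iff_stdGaussian.1 hf)
  rw [integral_sub (integrable_iff_stdGaussian.1 hf') (integrable_iff_stdGaussian.1 hz)] at h0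
  rw [integral_stdGaussian, integral_stdGaussian]
  linarith

/-- Stein's identity for `z^(n+1)`. -/
theorem integral_pow_stdGaussian (n : ℕ) :
    ∫ z, z ^ (n + 2) ∂gaussianReal 0 1 = (n + 1) * ∫ z, z ^ n ∂gaussianReal 0 1 := by
  have h := integral_deriv_stdGaussian (f := fun z => z ^ (n + 1))
    (f' := fun z => (n + 1) * z ^ n) (fun z => by simpa using hasDerivAt_pow (n + 1) z)
    (integrable_pow_stdGaussian _) ((integrable_pow_stdGaussian _).const_mul _)
    (by simpa only [← pow_succ'] using integrable_pow_stdGaussian (n + 1 + 1))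
  rw [integral_const_mul] at h
  rw [h]
  simp only [← pow_succ']

theorem integral_sq_stdGaussian : ∫ z, z ^ 2 ∂gaussianReal 0 1 = 1 := by
  have := integral_pow_stdGaussian 0
  simpa using this

theorem integral_pow_four_stdGaussian : ∫ z, z ^ 4 ∂gaussianReal 0 1 = 3 := by
  have := integral_pow_stdGaussian 2
  rw [integral_sq_stdGaussian] at this
  norm_num at this; exact this

theorem integral_pow_six_stdGaussian : ∫ z, z ^ 6 ∂gaussianReal 0 1 = 15 := by
  have := integral_pow_stdGaussian 4
  rw [integral_pow_four_stdGaussian] at this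
  norm_num at this; exact this

theorem integral_pow_eight_stdGaussian : ∫ z, z ^ 8 ∂gaussianReal 0 1 = 105 := by
  have := integral_pow_stdGaussian 6
  rw [integral_pow_six_stdGaussian] at this
  norm_num at this; exact this

/-- The expectation of `1 / (1 + y z²)` for a standard normal variable `z`: up to scaling, the Mills
ratio of the normal distribution. -/
noncomputable def mills (y : ℝ) : ℝ := ∫ z, (1 + y * z ^ 2)⁻¹ ∂gaussianReal 0 1

theorem integrable_inv_one_add {y : ℝ} (hy : 0 ≤ y) :
    Integrable (fun z : ℝ => (1 + y * z ^ 2)⁻¹) (gaussianReal 0 1) := by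
  refine (integrable_const (1 : ℝ)).mono' (by fun_prop) (ae_of_all _ fun z => ?_)
  have h : 0 ≤ y * z ^ 2 := by positivity
  rw [Real.norm_eq_abs, abs_of_pos (by positivity)]
  exact inv_le_one_of_one_le₀ (by linarith)

theorem continuousOn_mills : ContinuousOn mills (Set.Ici 0) := by
  refine continuousOn_of_dominated (bound := fun _ => 1) (fun y _ => ?_) (fun y hy => ?_)
    (integrable_const _) (ae_of_all _ fun z => ?_)
  · exact (by fun_prop : Measurable fun z : ℝ => (1 + y * z ^ 2)⁻¹).aestronglyMeasurable
  · refine ae_of_all _ fun z => ?_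
    have hy : 0 ≤ y := hy
    have h : 0 ≤ y * z ^ 2 := by positivity
    rw [Real.norm_eq_abs, abs_of_pos (by positivity)]
    exact inv_le_one_of_one_le₀ (by linarith)
  · refine ContinuousOn.inv₀ (by fun_prop) fun y hy => ?_
    have hy : 0 ≤ y := hy
    positivity

/-- Jensen's inequality: `u ↦ 1/(1 + yu)` is convex and `E[z²] = 1`. The integrand is compared with
its tangent at `z² = 1`. -/
theorem inv_one_add_le_mills {y : ℝ} (hy : 0 ≤ y) : (1 + y)⁻¹ ≤ mills y := by
  have h0 := integrable_const (μ := gaussianReal 0 1) ((1 + 2 * y) / (1 + y) ^ 2)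
  have h2 := (integrable_pow_stdGaussian 2).const_mul (-y / (1 + y) ^ 2)
  have h := integral_mono (h0.add h2) (integrable_inv_one_add hy) fun z => by
    have h : 0 < 1 + y * z ^ 2 := by positivity
    change (1 + 2 * y) / (1 + y) ^ 2 + -y / (1 + y) ^ 2 * z ^ 2 ≤ (1 + y * z ^ 2)⁻¹
    have : (1 + y * z ^ 2)⁻¹ - ((1 + 2 * y) / (1 + y) ^ 2 + -y / (1 + y) ^ 2 * z ^ 2)
        = ((1 + y) - (1 + y * z ^ 2)) ^ 2 / ((1 + y * z ^ 2) * (1 + y) ^ 2) := by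
      field_simp; ring
    rw [← sub_nonneg, this]; positivity
  refine le_trans (le_of_eq ?_) h
  rw [integral_add' h0 h2, integral_const_mul, integral_sq_stdGaussian]
  simp
  field_simp; ring

/-- The right side is five-point Gauss-Hermite quadrature of `1/(1 + yz²)`, with nodes `0` and the
roots of `z⁴ - 10z² + 15`. The quadrature is exact for the polynomial of degree `8` that
interpolates the integrand at the nodes, to second order at the nonzero ones, and this polynomial
lies above the integrand. -/
theorem mills_le_rational {y : ℝ} (hy : 0 ≤ y) :
    mills y ≤ (1 + 9 * y + 8 * y ^ 2) / (1 + 10 * y + 15 * y ^ 2) := by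
  set D := 1 + 10 * y + 15 * y ^ 2 with hD
  have hD0 : 0 < D := by positivity
  -- The interpolating polynomial. The factor `D - (1 + yz²)(1 + 10y - yz²)` in the error equals
  -- `y²(z⁴ - 10z² + 15)`.
  let P : ℝ → ℝ := fun z => 1 + (y * (1 + 10 * y) * (1 + 10 * y - 2 * D) / D ^ 2) * z ^ 2
    + (y ^ 2 * ((1 + 10 * y) ^ 2 - 2 * (1 + 10 * y) + 2 * D) / D ^ 2) * z ^ 4
    + (y ^ 3 * (1 - 2 * (1 + 10 * y)) / D ^ 2) * z ^ 6 + y ^ 4 / D ^ 2 * z ^ 8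
  have hP : ∀ z, (1 + y * z ^ 2)⁻¹ ≤ P z := fun z => by
    have h : 0 < 1 + y * z ^ 2 := by positivity
    have : P z - (1 + y * z ^ 2)⁻¹
        = y * z ^ 2 * (D - (1 + y * z ^ 2) * (1 + 10 * y - y * z ^ 2)) ^ 2
          / ((1 + y * z ^ 2) * D ^ 2) := by
      simp only [P]
      field_simp
      ring
    rw [← sub_nonneg, this]
    positivity
  have h2 := (integrable_pow_stdGaussian 2).const_mul
    (y * (1 + 10 * y) * (1 + 10 * y - 2 * D) / D ^ 2)
  have h4 := (integrable_pow_stdGaussian 4).const_mul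
    (y ^ 2 * ((1 + 10 * y) ^ 2 - 2 * (1 + 10 * y) + 2 * D) / D ^ 2)
  have h6 := (integrable_pow_stdGaussian 6).const_mul (y ^ 3 * (1 - 2 * (1 + 10 * y)) / D ^ 2)
  have h8 := (integrable_pow_stdGaussian 8).const_mul (y ^ 4 / D ^ 2)
  have h1 := integrable_const (μ := gaussianReal 0 1) (1 : ℝ)
  have h := integral_mono (integrable_inv_one_add hy) ((((h1.add h2).add h4).add h6).add h8) hP
  refine h.trans (le_of_eq ?_)
  rw [integral_add' (((h1.add h2).add h4).add h6) h8, integral_add' ((h1.add h2).add h4) h6,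
    integral_add' (h1.add h2) h4, integral_add' h1 h2]
  simp only [integral_const_mul, integral_sq_stdGaussian, integral_pow_four_stdGaussian,
    integral_pow_six_stdGaussian, integral_pow_eight_stdGaussian]
  simp
  field_simp
  rw [hD]; ring

/-- This connects `mills` with the product of exp and erfc that occurs in `G`. -/
theorem mills_eq {a : ℝ} (ha : 0 < a) :
    mills a⁻¹ = √(2 * a) * Real.exp (a / 2) * (√Real.pi / 2 * erfc (√(a / 2))) := by
  have h1 : mills a⁻¹ = a * ∫ z, (a + z ^ 2)⁻¹ ∂gaussianReal 0 1 := by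
    rw [mills, ← integral_const_mul]
    refine integral_congr_ae (ae_of_all _ fun z => ?_)
    change (1 + a⁻¹ * z ^ 2)⁻¹ = a * (a + z ^ 2)⁻¹
    field_simp
  rw [h1, integral_inv_add_sq ha, erfc]
  have h2 : √(2 * a) = a * √(2 / a) := by
    rw [show 2 * a = a ^ 2 * (2 / a) by field_simp, Real.sqrt_mul (sq_nonneg a), Real.sqrt_sq ha.le]
  rw [h2]
  have : √Real.pi ≠ 0 := by positivity
  field_simp

theorem erfc_le_one {x : ℝ} (hx : 0 ≤ x) : erfc x ≤ 1 := by
  have h : ∫ t in Set.Ioi x, Real.exp (-t ^ 2) ≤ ∫ t in Set.Ioi (0 : ℝ), Real.exp (-t ^ 2) := by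
    refine setIntegral_mono_set ?_ (ae_of_all _ fun t => by positivity)
      (Filter.Eventually.of_forall (Set.Ioi_subset_Ioi hx))
    simpa [IntegrableOn] using
      (integrable_exp_neg_mul_sq (b := 1) one_pos).integrableOn (s := Set.Ioi 0)
  have h2 := integral_gaussian_Ioi 1
  simp only [neg_mul, one_mul, div_one] at h2
  rw [h2] at h
  have hp : 0 < √Real.pi := by positivity
  calc erfc x ≤ 2 / √Real.pi * (√Real.pi / 2) := by unfold erfc; gcongr
    _ = 1 := by field_simp

/-- The second moment `E[1 / (1 + y z²)²]` in terms of the first. -/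
theorem integral_inv_one_add_sq {y : ℝ} (hy : 0 < y) :
    ∫ z, ((1 + y * z ^ 2) ^ 2)⁻¹ ∂gaussianReal 0 1 = (1 - (1 - y) * mills y) / (2 * y) := by
  have hi1 := integrable_inv_one_add hy.le
  have hi2 : Integrable (fun z : ℝ => ((1 + y * z ^ 2) ^ 2)⁻¹) (gaussianReal 0 1) := by
    refine (integrable_const (1 : ℝ)).mono' (by fun_prop) (ae_of_all _ fun z => ?_)
    have h : 0 ≤ y * z ^ 2 := by positivity
    rw [Real.norm_eq_abs, abs_of_pos (by positivity)]
    exact inv_le_one_of_one_le₀ (one_le_pow₀ (by linarith))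
  have hzf : ∀ z : ℝ, z * (z * (1 + y * z ^ 2)⁻¹) = y⁻¹ * (1 - (1 + y * z ^ 2)⁻¹) := fun z => by
    have : 0 < 1 + y * z ^ 2 := by positivity
    field_simp; ring
  have hf : Integrable (fun z : ℝ => z * (1 + y * z ^ 2)⁻¹) (gaussianReal 0 1) := by
    refine (integrable_pow_stdGaussian 1).mono (by fun_prop) (ae_of_all _ fun z => ?_)
    have h : 0 ≤ y * z ^ 2 := by positivity
    rw [norm_mul, pow_one]
    refine mul_le_of_le_one_right (norm_nonneg _) ?_
    rw [Real.norm_eq_abs, abs_of_pos (by positivity)]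
    exact inv_le_one_of_one_le₀ (by linarith)
  -- Stein's identity for `z/(1 + yz²)`: the derivative contains the squared inverse, and `z` times
  -- the function is affine in the inverse.
  have h := integral_deriv_stdGaussian (f := fun z => z * (1 + y * z ^ 2)⁻¹)
    (f' := fun z => 2 * ((1 + y * z ^ 2) ^ 2)⁻¹ - (1 + y * z ^ 2)⁻¹) (fun z => by
      have h0 : 1 + y * z ^ 2 ≠ 0 := by positivity
      have h1 : HasDerivAt (fun z : ℝ => 1 + y * z ^ 2) (y * (2 * z)) z := by
        simpa using ((hasDerivAt_pow 2 z).const_mul y).const_add 1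
      refine ((hasDerivAt_id z).mul (h1.inv h0)).congr_deriv ?_
      simp only [id, Pi.inv_apply]
      field_simp; ring) hf ((hi2.const_mul 2).sub hi1) (by
        simp only [hzf]; exact ((integrable_const _).sub hi1).const_mul _)
  simp only [hzf] at h
  rw [integral_sub (hi2.const_mul 2) hi1, integral_const_mul, integral_const_mul,
    integral_sub (integrable_const _) hi1] at h
  simp only [integral_const, probReal_univ, smul_eq_mul, mul_one] at h
  change 2 * _ - mills y = y⁻¹ * (1 - mills y) at h
  have : ∫ z, ((1 + y * z ^ 2) ^ 2)⁻¹ ∂gaussianReal 0 1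
      = (mills y + y⁻¹ * (1 - mills y)) / 2 := by linarith
  rw [this]; field_simp; ring

/-! ### The corruption parameter -/

/-- The function `G` in the scale-free variable `t = α² √(c m) / σ`, up to a positive factor. -/
noncomputable def balance (m t : ℝ) : ℝ :=
  4 * t * ((m - 4) / (m - 2)) - 1 - (4 * t * ((m + 1) / m) - 1) * mills (4 * t / m)

theorem rpow_quarter {x : ℝ} (hx : 0 ≤ x) : x ^ (1 / 4 : ℝ) = √(√x) := by
  rw [Real.sqrt_eq_rpow, Real.sqrt_eq_rpow, ← Real.rpow_mul hx]; norm_num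

/-- With `a² = tσ/√(cm)` every argument in `G` depends on `m` and `t` only: the one of erfc is
`√(m/(8t))`. Hence the exp-erfc product becomes `mills (4t/m)`, up to the factor `4√(t/m)` common to
all terms. -/
theorem G_eq_balance {m σ c t : ℝ} (hm : 0 < m) (hσ : 0 < σ) (hc : 0 < c) (ht : 0 < t) :
    G m σ c (√(t * (σ / √(c * m)))) = 4 * √(t / m) * balance m t := by
  set N := σ / √(c * m) with hN
  have hN0 : 0 < N := by positivity
  have h1 : √(m / c) = m / √(c * m) := by
    rw [eq_div_iff (by positivity), ← Real.sqrt_mul (by positivity),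
      show m / c * (c * m) = m ^ 2 by field_simp, Real.sqrt_sq hm.le]
  have h2 : σ * √(m / c) = m * N := by rw [h1, hN]; ring
  have h3 : √σ * (m / c) ^ (1 / 4 : ℝ) = √(m * N) := by
    rw [rpow_quarter (by positivity), ← Real.sqrt_mul hσ.le, h2]
  set a := m / (4 * t) with ha
  have ha0 : 0 < a := by positivity
  have hsq : √(t * N) ^ 2 = t * N := Real.sq_sqrt (by positivity)
  have h4 : m * N / (8 * (t * N)) = a / 2 := by rw [ha]; field_simp; norm_num
  have h5 : √(m * N) / (2 * √2 * √(t * N)) = √(a / 2) := by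
    have h8 : (2 : ℝ) * √2 * √(t * N) = √(8 * (t * N)) := by
      rw [show (8 : ℝ) * (t * N) = 2 ^ 2 * (2 * (t * N)) by ring,
        Real.sqrt_mul (x := (2 : ℝ) ^ 2) (by norm_num), Real.sqrt_sq (x := (2 : ℝ)) (by norm_num),
        Real.sqrt_mul (x := (2 : ℝ)) (by norm_num), mul_assoc]
    rw [h8, ← Real.sqrt_div (by positivity), h4]
  have h6 : 4 * √(t * N) / √(m * N) = 4 * √(t / m) := by
    rw [mul_div_assoc, ← Real.sqrt_div (by positivity)]
    congr 2; field_simp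
  have h7 : mills (4 * t / m) = √(2 * a) * Real.exp (a / 2) * (√Real.pi / 2 * erfc (√(a / 2))) := by
    rw [← mills_eq ha0, ha, inv_div]
  have h9 : √(2 * Real.pi) = 4 * √(t / m) * (√(2 * a) * (√Real.pi / 2)) := by
    have : √(t / m) * √(2 * a) = √2 / 2 := by
      rw [← Real.sqrt_mul (by positivity),
        show t / m * (2 * a) = 2 / 2 ^ 2 by rw [ha]; field_simp; norm_num,
        Real.sqrt_div (by norm_num), Real.sqrt_sq (by norm_num)]
    rw [Real.sqrt_mul (by norm_num)]
    linear_combination (-2 * √Real.pi) * this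
  unfold G balance
  rw [hsq, h2, h3, h4, h5, h6, h7, h9, ← hN]
  have h10 : t * N / N = t := by field_simp
  have h11 : t * N / (m * N) = t / m := by field_simp
  rw [h11, mul_div_assoc, h10]
  ring

theorem continuousOn_balance {m : ℝ} (hm : 0 < m) : ContinuousOn (balance m) (Set.Ici 0) := by
  unfold balance
  refine ContinuousOn.sub (by fun_prop) (ContinuousOn.mul (by fun_prop) ?_)
  refine continuousOn_mills.comp (by fun_prop) fun t ht => ?_
  have : 0 ≤ t := ht
  exact div_nonneg (by positivity) hm.le

/-- Jensen's bound for `mills` suffices at `t = 1`; it leaves `-48/((m-2)(m+4))`. -/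
theorem balance_one_neg {m : ℝ} (hm : 4 < m) : balance m 1 < 0 := by
  have h1 := inv_one_add_le_mills (y := 4 * 1 / m) (by positivity)
  have h2 : 0 < 4 * 1 * ((m + 1) / m) - 1 := by
    have : 1 < (m + 1) / m := by rw [lt_div_iff₀ (by linarith)]; linarith
    linarith
  have h3 := mul_le_mul_of_nonneg_left h1 h2.le
  unfold balance
  refine lt_of_le_of_lt (sub_le_sub_left h3 _) ?_
  have hm2 : 0 < m - 2 := by linarith
  have hm0 : 0 < m := by linarith
  have : 4 * 1 * ((m - 4) / (m - 2)) - 1 - (4 * 1 * ((m + 1) / m) - 1) * (1 + 4 * 1 / m)⁻¹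
      = -48 / ((m - 2) * (m + 4)) := by
    field_simp; ring
  rw [this]
  exact div_neg_of_neg_of_pos (by norm_num) (by positivity)

/-- An upper bound for the smallest root of `balance m` above `1`. -/
noncomputable def rootBound (m : ℝ) : ℝ := (2 * m + 7) / (2 * m - 13)

/-- The quadrature bound for `mills` makes this a rational inequality in `m`. With `m = n + 9` all
coefficients that remain after clearing denominators are nonnegative. -/
theorem balance_rootBound_nonneg {m : ℝ} (hm : 9 ≤ m) : 0 ≤ balance m (rootBound m) := by
  obtain ⟨n, hn, rfl⟩ : ∃ n, 0 ≤ n ∧ m = n + 9 := ⟨m - 9, by linarith, by ring⟩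
  have ht : rootBound (n + 9) = (2 * n + 25) / (2 * n + 5) := by
    unfold rootBound; congr 1 <;> ring
  rw [ht]
  set t := (2 * n + 25) / (2 * n + 5) with htd
  have ht0 : 1 ≤ t := by rw [htd, le_div_iff₀ (by positivity)]; linarith
  have h1 := mills_le_rational (y := 4 * t / (n + 9)) (by positivity)
  have h2 : 0 ≤ 4 * t * ((n + 9 + 1) / (n + 9)) - 1 := by
    have : 1 ≤ (n + 9 + 1) / (n + 9) := by rw [le_div_iff₀ (by positivity)]; linarith
    nlinarith
  have h3 := mul_le_mul_of_nonneg_left h1 h2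
  unfold balance
  refine le_trans ?_ (sub_le_sub_left h3 _)
  have h4 : (n + 9 - 4) / (n + 9 - 2) = (n + 5) / (n + 7) := by congr 1 <;> ring
  rw [h4, htd, sub_nonneg, ← sub_nonneg]
  field_simp
  rw [← sub_nonneg]
  ring_nf
  positivity

/-- For few agents the root may be large, and the quadrature bound is of no use there because it
never drops below `8/15`. The erfc formula is used instead, with crude numerical bounds; they give
`mills ≤ 1/5` at `t = 100`. -/
theorem balance_hundred_nonneg {m : ℝ} (hm : 5 ≤ m) (hm8 : m ≤ 8) : 0 ≤ balance m 100 := by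
  set a := m / 400 with ha
  have ha0 : 0 < a := by positivity
  have ha1 : a ≤ 1 / 50 := by rw [ha]; linarith
  have h1 : mills (4 * 100 / m) ≤ 1 / 5 := by
    rw [show 4 * 100 / m = a⁻¹ by rw [ha, inv_div]; norm_num, mills_eq ha0]
    have h2 : √(2 * a) ≤ 1 / 5 := by
      rw [Real.sqrt_le_left (by norm_num)]; norm_num; linarith
    have h3 : Real.exp (a / 2) ≤ 11 / 10 := by
      have h := Real.exp_bound_div_one_sub_of_interval' (x := a / 2) (by positivity) (by linarith)
      refine h.le.trans ?_
      rw [div_le_iff₀ (by linarith)]; linarith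
    have h4 : √Real.pi ≤ 9 / 5 := by
      rw [Real.sqrt_le_left (by norm_num)]
      have := Real.pi_lt_d2
      norm_num; linarith
    have h6 : 0 ≤ erfc (√(a / 2)) := by
      unfold erfc
      exact mul_nonneg (by positivity) (integral_nonneg fun t => by positivity)
    have h5 : √Real.pi / 2 * erfc (√(a / 2)) ≤ 9 / 10 * 1 :=
      mul_le_mul (by linarith) (erfc_le_one (by positivity)) h6 (by norm_num)
    calc √(2 * a) * Real.exp (a / 2) * (√Real.pi / 2 * erfc (√(a / 2)))
        ≤ (1 / 5 * (11 / 10)) * (9 / 10 * 1) := by gcongr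
      _ ≤ 1 / 5 := by norm_num
  have h2 : 0 ≤ 4 * 100 * ((m + 1) / m) - 1 := by
    have : 1 ≤ (m + 1) / m := by rw [le_div_iff₀ (by positivity)]; linarith
    linarith
  have h3 := mul_le_mul_of_nonneg_left h1 h2
  have h4 : (m + 1) / m ≤ 6 / 5 := by rw [div_le_iff₀ (by positivity)]; linarith
  have h5 : 1 / 3 ≤ (m - 4) / (m - 2) := by rw [le_div_iff₀ (by linarith)]; linarith
  unfold balance
  linarith

/-- In the variable `t = a²/(σ/√(cm/d))` the threshold for `a` becomes `t > 1`. The sign change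
gives a root by the intermediate value theorem, and compactness of the root set on `[1, t₀]` gives a
smallest one. -/
theorem exists_isLeast_alphaSet {d m : ℕ} (hd : 0 < d) (hm : 5 ≤ m) {σ c : ℝ} (hσ : 0 < σ)
    (hc : 0 < c) : ∃ t : ℝ, 1 < t ∧ (9 ≤ m → t ≤ rootBound m) ∧ balance m t = 0 ∧
      IsLeast (alphaSet d m σ c) (alpha d m σ c) ∧
      alpha d m σ c ^ 2 = t * (σ * √(d / (c * m))) := by
  have hm5 : (5 : ℝ) ≤ m := by exact_mod_cast hm
  have hm0 : (0 : ℝ) < m := by linarith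
  have hd0 : (0 : ℝ) < d := by exact_mod_cast hd
  obtain ⟨t₀, h1, h2, h3⟩ : ∃ t₀ : ℝ, 1 < t₀ ∧ (9 ≤ m → t₀ ≤ rootBound m) ∧ 0 ≤ balance m t₀ := by
    by_cases h : 9 ≤ m
    · have h9 : (9 : ℝ) ≤ m := by exact_mod_cast h
      refine ⟨rootBound m, ?_, fun _ => le_rfl, balance_rootBound_nonneg h9⟩
      rw [rootBound, lt_div_iff₀ (by linarith)]; linarith
    · have h8 : (m : ℝ) ≤ 8 := by
        have : m ≤ 8 := by omega
        exact_mod_cast this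
      exact ⟨100, by norm_num, fun h' => absurd h' h, balance_hundred_nonneg hm5 h8⟩
  have hb1 := balance_one_neg (m := m) (by linarith)
  have hcont : ContinuousOn (balance m) (Set.Icc 1 t₀) :=
    (continuousOn_balance hm0).mono fun t ht => zero_le_one.trans ht.1
  let T : Set ℝ := Set.Icc 1 t₀ ∩ balance m ⁻¹' {0}
  have hne : T.Nonempty := by
    obtain ⟨t, ht, ht'⟩ := intermediate_value_Icc h1.le hcont ⟨hb1.le, h3⟩
    exact ⟨t, ht, ht'⟩
  have hcomp : IsCompact T :=
    isCompact_Icc.of_isClosed_subset (hcont.preimage_isClosed_of_isClosed isClosed_Icc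
      isClosed_singleton) Set.inter_subset_left
  obtain ⟨t, ⟨⟨ht1, ht0⟩, htb⟩, hmin⟩ := hcomp.exists_isLeast hne
  have htb : balance m t = 0 := htb
  -- The closed interval was needed for compactness; its left end is not a root because `balance m 1
  -- < 0`.
  have ht1' : 1 < t := lt_of_le_of_ne ht1 fun h => by rw [← h] at htb; linarith
  set N := σ / √(c / d * m) with hN
  have hN0 : 0 < N := by positivity
  have hNeq : σ * √(d / (c * m)) = N := by
    rw [hN, div_eq_mul_inv σ, ← Real.sqrt_inv]
    congr 2; field_simp
  have hthr : √σ * (c / d * m) ^ (-(1 / 4) : ℝ) = √N := by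
    rw [Real.rpow_neg (by positivity), rpow_quarter (by positivity), ← div_eq_mul_inv,
      ← Real.sqrt_div hσ.le]
  have hG : ∀ s : ℝ, 0 < s → (G m σ (c / d) (√(s * N)) = 0 ↔ balance m s = 0) := fun s hs => by
    rw [hN, G_eq_balance hm0 hσ (by positivity) hs, mul_eq_zero, or_iff_right]
    positivity
  have hleast : IsLeast (alphaSet d m σ c) (√(t * N)) := by
    refine ⟨⟨?_, (hG t (by linarith)).2 htb⟩, fun a ha => ?_⟩
    · rw [hthr]
      exact Real.sqrt_lt_sqrt hN0.le (by nlinarith)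
    · obtain ⟨ha1, ha2⟩ := ha
      rw [hthr] at ha1
      have ha0 : 0 < a := (Real.sqrt_nonneg N).trans_lt ha1
      have haN : N < a ^ 2 := (Real.sqrt_lt' ha0).1 ha1
      have hs : a = √(a ^ 2 / N * N) := by
        rw [div_mul_cancel₀ _ hN0.ne', Real.sqrt_sq ha0.le]
      have hs1 : 1 < a ^ 2 / N := by rwa [one_lt_div hN0]
      rw [hs] at ha2 ⊢
      have hb := (hG _ (by linarith)).1 ha2
      refine Real.sqrt_le_sqrt (mul_le_mul_of_nonneg_right ?_ hN0.le)
      -- Minimality of `t` is only known among roots up to `t₀`; any other root exceeds `t₀ ≥ t`.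
      by_cases hle : a ^ 2 / N ≤ t₀
      · exact hmin ⟨⟨hs1.le, hle⟩, hb⟩
      · linarith
  have hal : alpha d m σ c = √(t * N) := hleast.csInf_eq
  refine ⟨t, ht1', fun h => ht0.trans (h2 h), htb, hal ▸ hleast, ?_⟩
  rw [hal, Real.sq_sqrt (by positivity), hNeq]

/-! ### The penalty as a function of the number of points -/

/-- A lower bound for the posterior variance, affine in the (scaled) number `X` of points. -/
theorem tangent_le_inv {m s X : ℝ} (hm : 2 ≤ m) (hs : 0 ≤ s) (hX : 0 < X) :
    (1 + 2 * s) / (m + 4 * s) - ((1 + 2 * s) ^ 2 + (m - 2) * s) / (m + 4 * s) ^ 2 * (X - 1)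
      ≤ (X + 1 + (m - 2) / (1 + s * (1 + 1 / X)))⁻¹ := by
  obtain ⟨M, hM, rfl⟩ : ∃ M, 0 ≤ M ∧ m = M + 2 := ⟨m - 2, by linarith, by ring⟩
  rw [show M + 2 - 2 = M by ring]
  set h := X + 1 + M / (1 + s * (1 + 1 / X)) with hh
  have hD : 1 + s * (1 + 1 / X) = (X * (1 + s) + s) / X := by field_simp; ring
  have h0 : 0 < h := by positivity
  -- The total precision `h` is concave in `X` and so lies below its tangent at `X = 1`, where its
  -- value is `B`.
  have h1 : h ≤ (M + 2 + 4 * s) / (1 + 2 * s) + (1 + M * s / (1 + 2 * s) ^ 2) * (X - 1) := by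
    rw [hh, hD, ← sub_nonneg]
    have : (M + 2 + 4 * s) / (1 + 2 * s) + (1 + M * s / (1 + 2 * s) ^ 2) * (X - 1)
        - (X + 1 + M / ((X * (1 + s) + s) / X))
        = M * s * (1 + s) * (X - 1) ^ 2 / ((1 + 2 * s) ^ 2 * (X * (1 + s) + s)) := by
      have : X * (1 + s) + s ≠ 0 := by positivity
      field_simp; ring
    rw [this]; positivity
  set B := (M + 2 + 4 * s) / (1 + 2 * s) with hB
  have hB0 : 0 < B := by positivity
  -- The inverse is convex and decreasing, so the tangent at `B` combines with the upper bound for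
  -- `h`.
  have h2 : 2 / B - h / B ^ 2 ≤ h⁻¹ := by
    rw [← sub_nonneg]
    have : h⁻¹ - (2 / B - h / B ^ 2) = (h - B) ^ 2 / (h * B ^ 2) := by field_simp; ring
    rw [this]; positivity
  refine le_trans ?_ h2
  have h3 : h / B ^ 2 ≤ (B + (1 + M * s / (1 + 2 * s) ^ 2) * (X - 1)) / B ^ 2 := by gcongr
  refine le_trans (le_of_eq ?_) (sub_le_sub_left h3 _)
  rw [hB]; field_simp; ring

theorem integrable_postVar_scaled {m t X : ℝ} (hm : 2 ≤ m) (ht : 0 ≤ t) (hX : 0 < X) :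
    Integrable (fun z : ℝ => (X + 1 + (m - 2) / (1 + t * z ^ 2 * (1 + 1 / X)))⁻¹)
      (gaussianReal 0 1) := by
  have hme : Measurable fun z : ℝ => (X + 1 + (m - 2) / (1 + t * z ^ 2 * (1 + 1 / X)))⁻¹ := by
    fun_prop
  refine (integrable_const (1 : ℝ)).mono' hme.aestronglyMeasurable (ae_of_all _ fun z => ?_)
  have h : 0 ≤ (m - 2) / (1 + t * z ^ 2 * (1 + 1 / X)) :=
    div_nonneg (by linarith) (by positivity)
  rw [Real.norm_eq_abs, abs_of_pos (by positivity)]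
  exact inv_le_one_of_one_le₀ (by linarith)

/-- The equilibrium condition. Averaging the tangent at `X = 1` over `z` gives a lower bound affine
in `X`, and `balance m t = 0` makes its slope cancel the marginal cost `1/m`. The left side is the
value of this bound at `X = 1`, that is, at `n*` points. -/
theorem le_integral_postVar_scaled {m t X : ℝ} (hm : 5 ≤ m) (ht : 1 < t)
    (hb : balance m t = 0) (hX : 0 < X) :
    (10 * t - 1) / (4 * t * (m + 1) - m) + 1 / m ≤
      ∫ z, (X + 1 + (m - 2) / (1 + t * z ^ 2 * (1 + 1 / X)))⁻¹ ∂gaussianReal 0 1 + X / m := by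
  have hm0 : 0 < m := by linarith
  have hm2 : 0 < m - 2 := by linarith
  set y := 4 * t / m with hy
  have hy0 : 0 < y := by positivity
  have hi1 := integrable_inv_one_add hy0.le
  have hi2 : Integrable (fun z : ℝ => ((1 + y * z ^ 2) ^ 2)⁻¹) (gaussianReal 0 1) := by
    refine hi1.mono' (by fun_prop) (ae_of_all _ fun z => ?_)
    have h : 0 ≤ y * z ^ 2 := by positivity
    rw [Real.norm_eq_abs, abs_of_pos (by positivity)]
    exact inv_anti₀ (by positivity) (by nlinarith)
  -- Partial fractions of the tangent in `(1 + yz²)⁻¹`, so that only `mills y` and the second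
  -- moment, itself affine in `mills y`, are needed.
  set c0 := 1 / 2 - (X - 1) / 4 with hc0
  set c1 := (m - 2) / m * (-(1 / 2) + (X - 1) / 4) with hc1
  set c2 := (m - 2) / (2 * m ^ 2) * (X - 1) with hc2
  have h0 := integrable_const (μ := gaussianReal 0 1) c0
  have hmono := integral_mono ((h0.add (hi1.const_mul c1)).add (hi2.const_mul c2))
    (integrable_postVar_scaled (by linarith : 2 ≤ m) (by linarith : 0 ≤ t) hX) fun z => by
      refine le_trans (le_of_eq ?_)
        (tangent_le_inv (by linarith : 2 ≤ m) (by positivity : 0 ≤ t * z ^ 2) hX)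
      change c0 + c1 * (1 + y * z ^ 2)⁻¹ + c2 * ((1 + y * z ^ 2) ^ 2)⁻¹ = _
      have hv : 1 + y * z ^ 2 = (m + 4 * (t * z ^ 2)) / m := by rw [hy]; field_simp
      have hv0 : m + 4 * (t * z ^ 2) ≠ 0 := by positivity
      rw [hv, hc0, hc1, hc2]
      field_simp; ring
  rw [integral_add' (h0.add (hi1.const_mul c1)) (hi2.const_mul c2),
    integral_add' h0 (hi1.const_mul c1), integral_const_mul, integral_const_mul,
    integral_inv_one_add_sq hy0] at hmono
  change _ + c1 * mills y + _ ≤ _ at hmono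
  have hD : 0 < 4 * t * (m + 1) - m := by nlinarith
  -- The root equation is linear in `mills y` and can be solved for it, which removes the
  -- transcendental term.
  have hg : mills y = m * (4 * t * (m - 4) - (m - 2)) / ((m - 2) * (4 * t * (m + 1) - m)) := by
    unfold balance at hb
    rw [← hy] at hb
    rw [eq_div_iff (by positivity)]
    field_simp at hb
    linear_combination -hb
  refine le_trans (le_of_eq ?_) (add_le_add_left hmono (X / m))
  simp only [integral_const, probReal_univ, smul_eq_mul, one_mul]
  rw [hg, hc0, hc1, hc2, hy]
  obtain ⟨D, hDD⟩ : ∃ D, D = 4 * t * (m + 1) - m := ⟨_, rfl⟩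
  rw [← hDD] at hD ⊢
  field_simp
  rw [hDD]
  ring

/-! ### Rational inequalities in `m` and `t` -/

/-- The left side increases in `t` because `m > 2`; the right side is its value at `t = rootBound
m`. -/
theorem fraction_le_of_le_rootBound {m t : ℝ} (hm : 9 ≤ m) (ht : 1 < t) (ht' : t ≤ rootBound m) :
    (1 + 2 * t) / (m + 4 * t) ≤ (6 * m + 1) / (2 * m ^ 2 - 5 * m + 28) := by
  unfold rootBound at ht'
  rw [le_div_iff₀ (by linarith)] at ht'
  rw [div_le_div_iff₀ (by positivity) (by nlinarith)]
  nlinarith [mul_nonneg (by linarith : 0 ≤ m - 2) (sub_nonneg.2 ht')]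

theorem fraction_lt_half {m t : ℝ} (hm : 2 < m) (ht : 1 < t) :
    (1 + 2 * t) / (m + 4 * t) < 1 / 2 := by
  rw [div_lt_div_iff₀ (by positivity) (by norm_num)]
  linarith

/-- The inequality behind the factor `1 + 5/m`: the upper bound for the recommended profile against
the lower bound for any deviation. After clearing denominators it is quadratic in `t`, with positive
leading coefficient for `5 ≤ m ≤ 8`. The coefficient is already negative at `m = 9`, where the bound
on the root is needed. -/
theorem fraction_add_inv_le {m : ℕ} {t : ℝ} (hm : 5 ≤ m) (ht : 1 < t)
    (ht' : 9 ≤ m → t ≤ rootBound m) :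
    (1 + 2 * t) / (m + 4 * t) + 1 / m ≤
      ((10 * t - 1) / (4 * t * (m + 1) - m) + 1 / m) * (1 + 5 / m) := by
  have hm5 : (5 : ℝ) ≤ m := by exact_mod_cast hm
  have hm0 : (0 : ℝ) < m := by linarith
  have hD : 0 < 4 * t * ((m : ℝ) + 1) - m := by nlinarith
  have key : 0 ≤ (10 * t - 1) * (m + 5) * (m + 4 * t) * m
      + 5 * (4 * t * ((m : ℝ) + 1) - m) * (m + 4 * t)
      - (1 + 2 * t) * (4 * t * ((m : ℝ) + 1) - m) * m ^ 2 := by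
    obtain ⟨s, hs, rfl⟩ : ∃ s, 0 < s ∧ t = 1 + s := ⟨t - 1, by linarith, by ring⟩
    by_cases h : 9 ≤ m
    · obtain ⟨n, hn⟩ : ∃ n, m = n + 9 := ⟨m - 9, by omega⟩
      have ht0 := ht' h
      have hmn : (m : ℝ) = n + 9 := by rw [hn]; push_cast; ring
      have hn0 : (0 : ℝ) ≤ n := n.cast_nonneg
      rw [hmn] at ht0 ⊢
      have hs1 : s * (2 * n + 5) ≤ 20 := by
        unfold rootBound at ht0
        rw [le_div_iff₀ (by linarith)] at ht0
        linarith
      -- As `rootBound m - 1 = 20/(2n + 5)`, the bound on `s` is encoded by a free parameter `r ≥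
      -- 0`; after this substitution all coefficients are nonnegative.
      obtain ⟨r, hr, hsr⟩ : ∃ r, 0 ≤ r ∧ s = 20 / ((2 * n + 5) * (1 + r)) := by
        refine ⟨20 / (s * (2 * n + 5)) - 1, ?_, ?_⟩
        · rw [sub_nonneg, le_div_iff₀ (by positivity)]; linarith
        · rw [add_sub_cancel]; field_simp
      rw [hsr]
      field_simp
      rw [← sub_nonneg]
      ring_nf
      positivity
    · interval_cases m <;> push_cast <;> ring_nf <;> positivity
  rw [← sub_nonneg]
  have : ((10 * t - 1) / (4 * t * (m + 1) - m) + 1 / m) * (1 + 5 / m)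
      - ((1 + 2 * t) / (m + 4 * t) + 1 / m)
      = ((10 * t - 1) * (m + 5) * (m + 4 * t) * m
      + 5 * (4 * t * ((m : ℝ) + 1) - m) * (m + 4 * t)
      - (1 + 2 * t) * (4 * t * ((m : ℝ) + 1) - m) * m ^ 2)
        / (m ^ 2 * (4 * t * ((m : ℝ) + 1) - m) * (m + 4 * t)) := by
    have : (m : ℝ) + 4 * t ≠ 0 := by positivity
    obtain ⟨D, hDD⟩ : ∃ D, D = 4 * t * ((m : ℝ) + 1) - m := ⟨_, rfl⟩
    rw [← hDD] at hD ⊢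
    field_simp; ring
  rw [this]
  exact div_nonneg key (by positivity)

theorem fraction_add_inv_lt {m : ℕ} {t : ℝ} (hm : 5 ≤ m) (ht : 1 < t)
    (ht' : 9 ≤ m → t ≤ rootBound m) :
    (1 + 2 * t) / (m + 4 * t) + 1 / m < 2 / m * (2 + 10 / m) := by
  have hm5 : (5 : ℝ) ≤ m := by exact_mod_cast hm
  have hm0 : (0 : ℝ) < m := by linarith
  by_cases h : 9 ≤ m
  · have h9 : (9 : ℝ) ≤ m := by exact_mod_cast h
    refine lt_of_le_of_lt (add_le_add_left (fraction_le_of_le_rootBound h9 ht (ht' h)) _) ?_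
    have hD : 0 < 2 * (m : ℝ) ^ 2 - 5 * m + 28 := by nlinarith
    have e : 2 / (m : ℝ) * (2 + 10 / m) - 1 / m = (3 * m + 20) / m ^ 2 := by field_simp; ring
    rw [← lt_sub_iff_add_lt, e, div_lt_div_iff₀ hD (by positivity)]
    nlinarith [mul_pos hm0 hm0]
  · have h8 : (m : ℝ) ≤ 8 := by
      have : m ≤ 8 := by omega
      exact_mod_cast this
    refine lt_of_lt_of_le (add_lt_add_left (fraction_lt_half (by linarith) ht) _) ?_
    have e : 2 / (m : ℝ) * (2 + 10 / m) - 1 / m = (3 * m + 20) / m ^ 2 := by field_simp; ring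
    rw [← le_sub_iff_add_le, e, div_le_div_iff₀ (by norm_num) (by positivity)]
    nlinarith

theorem fraction_add_inv_le_sqrt {m : ℕ} {t : ℝ} (hm : 5 ≤ m) (ht : 1 < t)
    (ht' : 9 ≤ m → t ≤ rootBound m) :
    (1 + 2 * t) / (m + 4 * t) + 1 / m ≤ 2 / √m := by
  have hm5 : (5 : ℝ) ≤ m := by exact_mod_cast hm
  have hm0 : (0 : ℝ) < m := by linarith
  have hr : √(m : ℝ) ^ 2 = m := Real.sq_sqrt hm0.le
  have hr0 : 0 < √(m : ℝ) := by positivity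
  set r := √(m : ℝ) with hrd
  by_cases h : 9 ≤ m
  · have h9 : (9 : ℝ) ≤ m := by exact_mod_cast h
    refine le_trans (add_le_add_left (fraction_le_of_le_rootBound h9 ht (ht' h)) _) ?_
    have h3 : 3 ≤ r := Real.le_sqrt_of_sq_le (by linarith)
    rw [← hr]
    obtain ⟨w, hw, hrw⟩ : ∃ w, 0 ≤ w ∧ r = w + 3 := ⟨r - 3, by linarith, by ring⟩
    rw [hrw]
    have hD : 0 < 2 * ((w + 3) ^ 2) ^ 2 - 5 * (w + 3) ^ 2 + 28 := by ring_nf; positivity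
    rw [div_add_div _ _ hD.ne' (by positivity), div_le_div_iff₀ (by positivity) (by positivity),
      ← sub_nonneg]
    ring_nf
    positivity
  · have h8 : (m : ℝ) ≤ 8 := by
      have : m ≤ 8 := by omega
      exact_mod_cast this
    refine le_trans (add_le_add_left (fraction_lt_half (by linarith) ht).le _) ?_
    rw [← hr, div_add_div _ _ (by norm_num) (by positivity),
      div_le_div_iff₀ (by positivity) (by positivity)]
    have h1 : r ≤ 3 := by nlinarith
    have h2 : 2 ≤ r := by nlinarith
    nlinarith [mul_pos hr0 hr0]

/-! ### Penalties -/

variable {d m : ℕ} {σ c : ℝ}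

/-- Used to let the prior precision tend to `0`: `δ` enters as an additional number of points, which
overstates the cost by `c * δ`. -/
theorem ofReal_le_of_forall_sub {a c : ℝ} {p : ℝ≥0∞}
    (h : ∀ δ : ℝ, 0 < δ → ENNReal.ofReal (a - c * δ) ≤ p) : ENNReal.ofReal a ≤ p := by
  have hc : Continuous fun δ : ℝ => ENNReal.ofReal (a - c * δ) :=
    ENNReal.continuous_ofReal.comp (by fun_prop)
  have ht : Filter.Tendsto (fun δ : ℝ => ENNReal.ofReal (a - c * δ)) (nhdsWithin 0 (Set.Ioi 0))
      (nhds (ENNReal.ofReal a)) := by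
    have := (hc.tendsto 0).mono_left (nhdsWithin_le_nhds (s := Set.Ioi 0))
    simpa using this
  exact le_of_tendsto ht (Filter.eventually_of_mem self_mem_nhdsWithin h)

theorem two_mul_le_div_add_mul {B T x c : ℝ} (hT : 0 < T) (hc : 0 < c) (hB : B ^ 2 = c * x) :
    2 * B ≤ x / T + c * T := by
  have : x / T + c * T - 2 * B = (B - c * T) ^ 2 / (c * T) := by
    field_simp
    linear_combination -hB
  rw [← sub_nonneg, this]
  positivity

theorem ofReal_le_alonePenalty_of_sq (hσ : 0 < σ) (hc : 0 < c) {B : ℝ}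
    (hB : B ^ 2 = c * (d * σ ^ 2)) (n : ℕ) {h : Dataset d → Vec d} (hh : Measurable h) :
    ENNReal.ofReal (2 * B) ≤ alonePenalty σ c n h := by
  refine ofReal_le_of_forall_sub (c := c) fun δ hδ => ?_
  refine le_trans ?_ (ofReal_le_alonePenalty hσ n hh hδ)
  rw [← ENNReal.ofReal_add (by positivity) (by positivity)]
  refine ENNReal.ofReal_le_ofReal ?_
  have := two_mul_le_div_add_mul (T := δ + n) (by positivity) hc hB
  linarith

/-- Each of the `m` agents has risk at least `dσ²/T`, where `T` is the total number of points, while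
the total cost is `cT`. AM-GM gives `2√(c m d σ²)`. -/
theorem ofReal_le_socialPenalty_of_sq (hσ : 0 < σ) (hc : 0 < c) {B : ℝ}
    (hB : B ^ 2 = c * (m * (d * σ ^ 2))) (M : Mechanism.{u} d m)
    (s : Fin m → Strategy d M.Alloc) : ENNReal.ofReal (2 * B) ≤ socialPenalty σ c M s := by
  refine ofReal_le_of_forall_sub (c := c) fun δ hδ => ?_
  have h0 : 0 ≤ ∑ j, ((s j).n : ℝ) := Finset.sum_nonneg fun j _ => Nat.cast_nonneg _
  calc ENNReal.ofReal (2 * B - c * δ)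
      ≤ ENNReal.ofReal (∑ i, (d * σ ^ 2 / (δ + ∑ j, ((s j).n : ℝ)) + c * (s i).n)) := by
        refine ENNReal.ofReal_le_ofReal ?_
        have := two_mul_le_div_add_mul (T := δ + ∑ j, ((s j).n : ℝ)) (by positivity) hc hB
        rw [Finset.sum_add_distrib, ← Finset.mul_sum, Finset.sum_const, Finset.card_univ,
          Fintype.card_fin, nsmul_eq_mul, ← mul_div_assoc]
        linarith
    _ = ∑ i, (ENNReal.ofReal (d * σ ^ 2 / (δ + ∑ j, ((s j).n : ℝ)))
          + ENNReal.ofReal (c * (s i).n)) := by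
        rw [ENNReal.ofReal_sum_of_nonneg fun i _ => by positivity]
        exact Finset.sum_congr rfl fun i _ => ENNReal.ofReal_add (by positivity) (by positivity)
    _ ≤ socialPenalty σ c M s :=
        Finset.sum_le_sum fun i _ => add_le_add_left (ofReal_le_iSup_risk hσ M s i hδ) _

theorem socialPenalty_ne_top {M : Mechanism.{u} d m} {s : Fin m → Strategy d M.Alloc} {p : ℝ}
    (hp : ∀ i, penalty σ c M s i ≤ ENNReal.ofReal p) : socialPenalty σ c M s ≠ ∞ :=
  ENNReal.sum_ne_top.2 fun i _ => ne_top_of_le_ne_top ENNReal.ofReal_ne_top (hp i)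

theorem PoS_lt (hσ : 0 < σ) (hc : 0 < c) {B : ℝ} (hB0 : 0 < B)
    (hB : B ^ 2 = c * (m * (d * σ ^ 2))) {M : Mechanism.{u} d m}
    {s : Fin m → Strategy d M.Alloc} {p r : ℝ}
    (hp : ∀ i, penalty σ c M s i ≤ ENNReal.ofReal p) (hr : m * p < r * (2 * B)) :
    PoS.{u, v} σ c M s < ENNReal.ofReal r := by
  have h1 : socialPenalty σ c M s ≤ ENNReal.ofReal (m * p) := by
    refine (Finset.sum_le_sum fun i _ => hp i).trans (le_of_eq ?_)
    rw [Finset.sum_const, Finset.card_univ, Fintype.card_fin, nsmul_eq_mul,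
      ENNReal.ofReal_mul (by positivity), ENNReal.ofReal_natCast]
  have h2 : ENNReal.ofReal (2 * B) ≤
      ⨅ (M' : Mechanism.{v} d m) (s' : Fin m → Strategy d M'.Alloc), socialPenalty σ c M' s' :=
    le_iInf₂ fun M' s' => ofReal_le_socialPenalty_of_sq hσ hc hB M' s'
  have h3 : m * p / (2 * B) < r := by rwa [div_lt_iff₀ (by positivity)]
  by_cases hmp : 0 < r
  · calc PoS.{u, v} σ c M s ≤ ENNReal.ofReal (m * p) / ENNReal.ofReal (2 * B) :=
          ENNReal.div_le_div h1 h2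
      _ = ENNReal.ofReal (m * p / (2 * B)) := (ENNReal.ofReal_div_of_pos (by positivity)).symm
      _ < ENNReal.ofReal r := (ENNReal.ofReal_lt_ofReal_iff hmp).2 h3
  -- If `r ≤ 0`, then `m * p` would be negative and the social penalty zero, against the positive
  -- lower bound `2 * B`.
  · have hs : ENNReal.ofReal (m * p) = 0 := by
      refine ENNReal.ofReal_eq_zero.2 ?_
      nlinarith
    have := (ofReal_le_socialPenalty_of_sq hσ hc hB M s).trans h1
    rw [hs, nonpos_iff_eq_zero, ENNReal.ofReal_eq_zero] at this
    linarith

theorem card_others (i : Fin m) {n : Fin m → ℕ} {N : ℕ} (hn : ∀ j, j ≠ i → n j = N) :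
    Fintype.card (Σ j : {j : Fin m // j ≠ i}, Fin (n j)) = (m - 1) * N := by
  rw [Fintype.card_sigma, Finset.sum_congr rfl fun (j : {j : Fin m // j ≠ i}) _ =>
    (Fintype.card_fin _).trans (hn j j.2)]
  simp

/-! ### Penalties with at least five agents -/

section Many

variable {N : ℕ} {t : ℝ}

theorem risk_mechanism_of_five_le (hm : 5 ≤ m) (hN : σ * √(d / (c * m)) = N)
    {s : Fin m → Strategy d (Allocation d)} {i : Fin m}
    (hs : ∀ j, j ≠ i → (s j).submit = id ∧ (s j).n = N) (θ : Measure (Vec d))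
    [IsProbabilityMeasure θ] : risk (mechanism d m σ c) s i θ
      = splitRisk (alpha d m σ c) (s i) N ((m - 2) * N) θ := by
  rw [risk_mechanism_eq_splitRisk (by omega) σ c s i (fun j hj => (hs j hj).1) θ
    (card_others i fun j hj => (hs j hj).2), hN, Nat.floor_natCast]
  obtain ⟨k, rfl⟩ : ∃ k, m = k + 2 := ⟨m - 2, by omega⟩
  have h1 : min ((k + 2 - 1) * N) N = N := min_eq_right (Nat.le_mul_of_pos_left N (by omega))
  have h2 : (k + 2 - 1) * N - N = (k + 2 - 2) * N := by
    rw [show k + 2 - 1 = k + 1 by omega, show k + 2 - 2 = k by omega, add_mul]; omega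
  rw [h1, h2]

/-- In units of `dσ²/N` the bound on the risk depends on `(δ + n)/N = X`, `t` and `m` only, and the
choice of `n*` makes the price of `N` points equal to `1/m`. Thus the scaled inequality applies to
every deviation, including `n = 0`. -/
theorem le_penalty_of_five_le (hm : 5 ≤ m) (hσ : 0 < σ) (hN0 : 0 < N)
    (hN : σ * √(d / (c * m)) = N) (hcN : c * N = d * σ ^ 2 / N / m) (ht : 1 < t)
    (hb : balance m t = 0) (hα : alpha d m σ c ^ 2 = t * N)
    {s : Fin m → Strategy d (Allocation d)} {i : Fin m}
    (hs : ∀ j, j ≠ i → (s j).submit = id ∧ (s j).n = N) :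
    ENNReal.ofReal (d * σ ^ 2 / N * ((10 * t - 1) / (4 * t * (m + 1) - m) + 1 / m)) ≤
      penalty σ c (mechanism d m σ c) s i := by
  have hN0' : (0 : ℝ) < N := Nat.cast_pos.2 hN0
  have hm5 : (5 : ℝ) ≤ m := by exact_mod_cast hm
  have hm0 : (0 : ℝ) < m := by linarith
  have hc : 0 ≤ c := by
    have : 0 ≤ c * N := by rw [hcN]; positivity
    exact nonneg_of_mul_nonneg_left this hN0'
  have hrisk : (⨆ θ ∈ boundedVariance d σ, risk (mechanism d m σ c) s i θ) =
      ⨆ θ ∈ boundedVariance d σ, splitRisk (alpha d m σ c) (s i) N ((m - 2) * N) θ :=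
    iSup_congr fun θ => iSup_congr fun hθ => by
      have := hθ.1
      exact risk_mechanism_of_five_le hm hN hs θ
  refine ofReal_le_of_forall_sub (c := c) fun δ hδ => ?_
  set X : ℝ := (δ + (s i).n) / N with hX
  have hX0 : 0 < X := by positivity
  have h1 := le_integral_postVar_scaled hm5 ht hb hX0
  have h2 := ofReal_le_iSup_splitRisk (d := d) hσ (alpha d m σ c) (s i) hN0 ((m - 2) * N) hδ
  have hpost : ∀ z : ℝ, postVar σ ((δ + (s i).n + N) / σ ^ 2) ((m - 2) * N)
      (alpha d m σ c ^ 2 * (σ ^ 2 / (δ + (s i).n) + σ ^ 2 / N) * z ^ 2)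
      = σ ^ 2 / N * (X + 1 + (m - 2) / (1 + t * z ^ 2 * (1 + 1 / X)))⁻¹ := fun z => by
    have hK : (((m - 2) * N : ℕ) : ℝ) = ((m : ℝ) - 2) * N := by
      rw [Nat.cast_mul, Nat.cast_sub (by omega)]; norm_num
    have hD : δ + (s i).n = X * N := by rw [hX]; field_simp
    have hq : σ ^ 2 + t * N * (σ ^ 2 / (X * N) + σ ^ 2 / N) * z ^ 2
        = σ ^ 2 * (1 + t * z ^ 2 * (1 + 1 / X)) := by field_simp; ring
    unfold postVar
    rw [hα, hD, hK, hq]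
    have h3 : 0 < 1 + t * z ^ 2 * (1 + 1 / X) := by
      have : 0 < t := by linarith
      positivity
    rw [← inv_inv (σ ^ 2 / (N : ℝ)), ← mul_inv]
    congr 1
    field_simp
  simp only [hpost] at h2
  rw [integral_const_mul] at h2
  rw [← hrisk] at h2
  refine le_trans ?_ (add_le_add_left h2 _)
  have hI : 0 ≤ ∫ z, (X + 1 + (m - 2) / (1 + t * z ^ 2 * (1 + 1 / X)))⁻¹ ∂gaussianReal 0 1 := by
    refine integral_nonneg fun z => inv_nonneg.2 ?_
    have : 0 < t := by linarith
    have : 0 ≤ (m - 2) / (1 + t * z ^ 2 * (1 + 1 / X)) :=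
      div_nonneg (by linarith) (by positivity)
    positivity
  rw [← ENNReal.ofReal_add (by positivity) (by positivity)]
  refine ENNReal.ofReal_le_ofReal ?_
  have h4 := mul_le_mul_of_nonneg_left h1 (by positivity : 0 ≤ d * σ ^ 2 / N)
  -- The scaled cost `X/m` is the actual cost plus the spurious `c * δ`, which disappears in the
  -- limit.
  have h5 : d * σ ^ 2 / N * (X / m) = c * δ + c * (s i).n := by
    have : d * σ ^ 2 / N * (X / m) = d * σ ^ 2 / N / m * X := by ring
    rw [this, ← hcN, hX]; field_simp
  rw [mul_add _ _ (X / m), h5] at h4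
  have h6 : ∀ I : ℝ, d * σ ^ 2 / N * I = d * (σ ^ 2 / N * I) := fun I => by ring
  rw [h6 (integral _ _)] at h4
  linarith

theorem penalty_recommended_le_of_five_le (hm : 5 ≤ m) (hσ : 0 < σ) (hN0 : 0 < N)
    (hN : σ * √(d / (c * m)) = N) (hcN : c * N = d * σ ^ 2 / N / m) (ht : 1 < t)
    (hα : alpha d m σ c ^ 2 = t * N) (i : Fin m) :
    penalty σ c (mechanism d m σ c) (recommendedProfile d m σ c) i ≤
      ENNReal.ofReal (d * σ ^ 2 / N * ((1 + 2 * t) / (m + 4 * t) + 1 / m)) := by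
  have hN0' : (0 : ℝ) < N := Nat.cast_pos.2 hN0
  have hm5 : (5 : ℝ) ≤ m := by exact_mod_cast hm
  have hm0 : (0 : ℝ) < m := by linarith
  have hstar : nStar d m σ c = N := by rw [nStar, if_neg (by omega), hN]
  have hn : (recommended d m σ c).n = N := by
    change ⌊nStar d m σ c⌋₊ = N
    rw [hstar, Nat.floor_natCast]
  have hrisk : (⨆ θ ∈ boundedVariance d σ,
      risk (mechanism d m σ c) (recommendedProfile d m σ c) i θ) ≤
      ENNReal.ofReal (d * σ ^ 2 / N * ((1 + 2 * t) / (m + 4 * t))) := by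
    refine iSup₂_le fun θ hθ => ?_
    have := hθ.1
    rw [risk_mechanism_of_five_le hm hN (s := recommendedProfile d m σ c)
      (fun j _ => ⟨rfl, hn⟩) θ]
    have h := splitRisk_recommended_le hσ hθ (alpha d m σ c) (recommended d m σ c)
      (hn ▸ hN0) ((m - 2) * N) rfl fun X Y A => by
        change weightedMean σ (tauSq d m σ c) X A.1 A.2.1 = _
        rw [tauSq, hstar, hn]
    rw [hn] at h
    refine h.trans (ENNReal.ofReal_le_ofReal (le_of_eq ?_))
    rw [Nat.cast_mul, Nat.cast_sub (by omega), hα]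
    have h1 : 1 + 2 * t ≠ 0 := by linarith
    have h2 : (m : ℝ) + 4 * t ≠ 0 := by linarith
    have h3 : σ ^ 2 + 2 * (t * N) * σ ^ 2 / N = σ ^ 2 * (1 + 2 * t) := by field_simp
    have h4 : 2 * N / σ ^ 2 + ((m : ℝ) - (2 : ℕ)) * N / (σ ^ 2 * (1 + 2 * t))
        = N / σ ^ 2 * ((m + 4 * t) / (1 + 2 * t)) := by
      push_cast; field_simp; ring
    rw [h3, h4]
    field_simp
  rw [penalty]
  refine (add_le_add_left hrisk _).trans ?_
  change _ + ENNReal.ofReal (c * (recommended d m σ c).n) ≤ _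
  rw [hn, hcN, mul_add, ENNReal.ofReal_add (by positivity) (by positivity), mul_one_div]

end Many

/-! ### Penalties with at most four agents -/

section Few

variable {N : ℕ}

/-- By AM-GM `dσ²/T + cT` is at least `2cmN` for every total `T`; the share `c(m-1)N` paid by the
others is subtracted. The bound holds for every mechanism, since no allocation can reveal more than
all the data. -/
theorem le_penalty_of_le_four (hσ : 0 < σ) (hc : 0 < c)
    (hN : (c * (m * N)) ^ 2 = c * (d * σ ^ 2)) {M : Mechanism.{u} d m}
    {s : Fin m → Strategy d M.Alloc} {i : Fin m} (hs : ∀ j, j ≠ i → (s j).n = N) :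
    ENNReal.ofReal (c * ((m + 1) * N)) ≤ penalty σ c M s i := by
  refine ofReal_le_of_forall_sub (c := c) fun δ hδ => ?_
  have hsum : ∑ j, ((s j).n : ℝ) = (s i).n + (m - 1) * N := by
    rw [← Finset.add_sum_erase _ _ (Finset.mem_univ i),
      Finset.sum_congr rfl fun j hj => by rw [hs j (Finset.ne_of_mem_erase hj)],
      Finset.sum_const, Finset.card_erase_of_mem (Finset.mem_univ i), Finset.card_univ,
      Fintype.card_fin, nsmul_eq_mul, Nat.cast_sub (by have := i.2; omega), Nat.cast_one]
  have h0 : 0 ≤ ∑ j, ((s j).n : ℝ) := Finset.sum_nonneg fun j _ => Nat.cast_nonneg _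
  refine le_trans ?_ (add_le_add_left (ofReal_le_iSup_risk hσ M s i hδ) _)
  rw [← ENNReal.ofReal_add (by positivity) (by positivity)]
  refine ENNReal.ofReal_le_ofReal ?_
  have := two_mul_le_div_add_mul (T := δ + ∑ j, ((s j).n : ℝ)) (by positivity) hc hN
  have h1 : c * (δ + ∑ j, ((s j).n : ℝ)) = c * δ + c * (s i).n + c * ((m - 1) * N) := by
    rw [hsum]; ring
  linarith

theorem penalty_recommended_le_of_le_four (hm0 : 0 < m) (hm : m ≤ 4) (hσ : 0 < σ) (hc : 0 < c)
    (hN0 : 0 < N) (hstar : nStar d m σ c = N) (hN : (c * (m * N)) ^ 2 = c * (d * σ ^ 2))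
    (i : Fin m) : penalty σ c (mechanism d m σ c) (recommendedProfile d m σ c) i ≤
      ENNReal.ofReal (c * ((m + 1) * N)) := by
  have hN0' : (0 : ℝ) < N := Nat.cast_pos.2 hN0
  have hm0' : (0 : ℝ) < m := Nat.cast_pos.2 hm0
  have hn : (recommended d m σ c).n = N := by
    change ⌊nStar d m σ c⌋₊ = N
    rw [hstar, Nat.floor_natCast]
  have hrisk : (⨆ θ ∈ boundedVariance d σ,
      risk (mechanism d m σ c) (recommendedProfile d m σ c) i θ) ≤
      ENNReal.ofReal (c * (m * N)) := by
    refine iSup₂_le fun θ hθ => ?_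
    have := hθ.1
    rw [risk_mechanism_of_le_four hm σ c (recommendedProfile d m σ c) i (fun j _ => rfl) θ
      (card_others i fun j _ => hn)]
    refine (lintegral_mean_le hθ (recommended d m σ c).n ((m - 1) * N) (by rw [hn]; omega)
      (tauSq d m σ c) hσ).trans (ENNReal.ofReal_le_ofReal (le_of_eq ?_))
    rw [hn, Nat.cast_mul, Nat.cast_sub (by omega), Nat.cast_one,
      show (N : ℝ) + (m - 1) * N = m * N by ring, ← mul_div_assoc, div_eq_iff (by positivity)]
    have := mul_left_cancel₀ hc.ne' (hN.symm.trans (by ring :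
      (c * (m * N)) ^ 2 = c * (c * (m * N) * (m * N))))
    exact this
  rw [penalty]
  refine (add_le_add_left hrisk _).trans ?_
  change _ + ENNReal.ofReal (c * (recommended d m σ c).n) ≤ _
  rw [hn, ← ENNReal.ofReal_add (by positivity) (by positivity)]
  exact ENNReal.ofReal_le_ofReal (le_of_eq (by ring))

end Few

end CCCD

/-! ### The main theorem -/

theorem theorem4 (d m : ℕ) (hd : 0 < d) (hm : 0 < m) (σ c : ℝ) (hσ : 0 < σ) (hc : 0 < c)
    (hint : ∃ n : ℕ, CCCD.nStar d m σ c = n) :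
    -- the parameter `α` of the mechanism exists
    (5 ≤ m → IsLeast (CCCD.alphaSet d m σ c) (CCCD.alpha d m σ c)) ∧
    -- approximate Nash equilibrium
    (∀ (i : Fin m) (si : CCCD.Strategy d (CCCD.mechanism d m σ c).Alloc),
      CCCD.penalty σ c (CCCD.mechanism d m σ c) (CCCD.recommendedProfile d m σ c) i ≤
        CCCD.penalty σ c (CCCD.mechanism d m σ c)
          (Function.update (CCCD.recommendedProfile d m σ c) i si) i * (1 + 5 / (m : ℝ≥0∞))) ∧
    -- individual rationality
    CCCD.IndividuallyRational σ c (CCCD.mechanism d m σ c) (CCCD.recommendedProfile d m σ c) ∧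
    -- approximate efficiency
    CCCD.socialPenalty σ c (CCCD.mechanism d m σ c) (CCCD.recommendedProfile d m σ c) ≠ ∞ ∧
    CCCD.PoS.{0, v} σ c (CCCD.mechanism d m σ c) (CCCD.recommendedProfile d m σ c) <
      2 + 10 / (m : ℝ≥0∞) := by
  have hd0 : (0 : ℝ) < d := Nat.cast_pos.2 hd
  have hm0 : (0 : ℝ) < m := Nat.cast_pos.2 hm
  obtain ⟨N, hstar⟩ := hint
  have hm1 : (m : ℝ≥0∞) = ENNReal.ofReal m := (ENNReal.ofReal_natCast m).symm
  have h5m : (1 : ℝ≥0∞) + 5 / m = ENNReal.ofReal (1 + 5 / m) := by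
    rw [ENNReal.ofReal_add (by positivity) (by positivity), ENNReal.ofReal_div_of_pos hm0, hm1]
    simp
  have h10m : (2 : ℝ≥0∞) + 10 / m = ENNReal.ofReal (2 + 10 / m) := by
    rw [ENNReal.ofReal_add (by positivity) (by positivity), ENNReal.ofReal_div_of_pos hm0, hm1]
    simp
  by_cases h4 : m ≤ 4
  · rw [CCCD.nStar, if_pos h4] at hstar
    have hN0' : (0 : ℝ) < N := by rw [← hstar]; positivity
    have hN0 : 0 < N := Nat.cast_pos.1 hN0'
    have hN : (c * (m * N)) ^ 2 = c * (d * σ ^ 2) := by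
      rw [← hstar]
      have : √(d / c) ^ 2 = d / c := Real.sq_sqrt (by positivity)
      field_simp
      rw [this]; field_simp
    have hle := CCCD.penalty_recommended_le_of_le_four hm h4 hσ hc hN0
      (by rw [CCCD.nStar, if_pos h4, hstar]) hN
    refine ⟨fun h => by omega, fun i si => ?_, fun i => ?_, CCCD.socialPenalty_ne_top hle, ?_⟩
    -- Here the profile is an exact equilibrium; the factor `1 + 5/m` is not needed.
    · refine (hle i).trans (le_trans ?_ (le_mul_of_one_le_right zero_le le_self_add))
      refine CCCD.le_penalty_of_le_four hσ hc hN fun j hj => ?_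
      rw [Function.update_of_ne hj]
      change ⌊CCCD.nStar d m σ c⌋₊ = N
      rw [CCCD.nStar, if_pos h4, hstar, Nat.floor_natCast]
    · refine (hle i).trans (le_iInf₂ fun n h => le_iInf fun hh => le_trans ?_
        (CCCD.ofReal_le_alonePenalty_of_sq hσ hc hN n hh))
      refine ENNReal.ofReal_le_ofReal ?_
      have : (1 : ℝ) ≤ m := by exact_mod_cast hm
      rw [← mul_assoc, ← mul_assoc, ← mul_assoc, mul_comm 2 c]
      refine mul_le_mul_of_nonneg_right ?_ hN0'.le
      rw [mul_assoc]
      exact mul_le_mul_of_nonneg_left (by linarith) hc.le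
    · rw [h10m]
      -- The social optimum is at least `2cmN√m` and the profile costs at most `cm(m+1)N`; for `m ≤
      -- 4` the crude bound `√m ≥ 1` suffices.
      refine CCCD.PoS_lt (B := c * (m * N) * √m) hσ hc (by positivity) ?_ hle ?_
      · rw [mul_pow, hN, Real.sq_sqrt hm0.le]; ring
      · have h1 : (1 : ℝ) ≤ √m := Real.one_le_sqrt.2 (by exact_mod_cast hm)
        have h2 : (m : ℝ) + 1 < (2 + 10 / m) * 2 := by
          have hm4 : (m : ℝ) ≤ 4 := by exact_mod_cast h4
          have : 10 / 4 ≤ 10 / (m : ℝ) := by gcongr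
          linarith
        calc (m : ℝ) * (c * ((m + 1) * N)) = c * (m * N) * (m + 1) := by ring
          _ < c * (m * N) * ((2 + 10 / m) * 2) := by gcongr
          _ ≤ c * (m * N) * ((2 + 10 / m) * 2) * √m := le_mul_of_one_le_right (by positivity) h1
          _ = _ := by ring
  · have h5 : 5 ≤ m := by omega
    rw [CCCD.nStar, if_neg h4] at hstar
    have hN0' : (0 : ℝ) < N := by rw [← hstar]; positivity
    have hN0 : 0 < N := Nat.cast_pos.1 hN0'
    have hcN2 : c * N ^ 2 * m = d * σ ^ 2 := by
      rw [← hstar]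
      have : √(d / (c * m)) ^ 2 = d / (c * m) := Real.sq_sqrt (by positivity)
      rw [mul_pow, this]; field_simp
    have hcN : c * N = d * σ ^ 2 / N / m := by
      rw [← hcN2]; field_simp
    obtain ⟨t, ht1, ht, hb, hleast, hα⟩ := CCCD.exists_isLeast_alphaSet hd h5 hσ hc
    rw [hstar] at hα
    have hle := CCCD.penalty_recommended_le_of_five_le h5 hσ hN0 hstar hcN ht1 hα
    set A : ℝ := d * σ ^ 2 / N with hA
    have hA0 : 0 < A := by positivity
    have hA2 : A ^ 2 = c * (m * (d * σ ^ 2)) := by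
      rw [hA, ← hcN2]; field_simp
    refine ⟨fun _ => hleast, fun i si => ?_, fun i => ?_, CCCD.socialPenalty_ne_top hle, ?_⟩
    · have hs : ∀ j, j ≠ i →
          (Function.update (CCCD.recommendedProfile d m σ c) i si j).submit = id ∧
          (Function.update (CCCD.recommendedProfile d m σ c) i si j).n = N := fun j hj => by
        rw [Function.update_of_ne hj]
        refine ⟨rfl, ?_⟩
        change ⌊CCCD.nStar d m σ c⌋₊ = N
        rw [CCCD.nStar, if_neg h4, hstar, Nat.floor_natCast]
      have h1 := CCCD.le_penalty_of_five_le h5 hσ hN0 hstar hcN ht1 hb hα hs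
      refine (hle i).trans (le_trans ?_ (mul_le_mul_left h1 _))
      rw [h5m, ← ENNReal.ofReal_mul' (by positivity), mul_assoc]
      exact ENNReal.ofReal_le_ofReal
        (mul_le_mul_of_nonneg_left (CCCD.fraction_add_inv_le h5 ht1 ht) hA0.le)
    -- An agent on her own pays at least `2σ√(cd)`, which is `2A/√m`.
    · refine (hle i).trans (le_iInf₂ fun n h => le_iInf fun hh => le_trans ?_
        (CCCD.ofReal_le_alonePenalty_of_sq (B := A / √m) hσ hc ?_ n hh))
      · refine ENNReal.ofReal_le_ofReal ((mul_le_mul_of_nonneg_left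
          (CCCD.fraction_add_inv_le_sqrt h5 ht1 ht) hA0.le).trans (le_of_eq (by ring)))
      · rw [div_pow, hA2, Real.sq_sqrt hm0.le]; field_simp
    · rw [h10m]
      refine CCCD.PoS_lt hσ hc hA0 hA2 hle ?_
      have h1 := mul_lt_mul_of_pos_left (CCCD.fraction_add_inv_lt h5 ht1 ht)
        (mul_pos hm0 hA0)
      calc (m : ℝ) * (A * ((1 + 2 * t) / (m + 4 * t) + 1 / m))
          = m * A * ((1 + 2 * t) / (m + 4 * t) + 1 / m) := by ring
        _ < m * A * (2 / m * (2 + 10 / m)) := h1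
        _ = _ := by field_simp
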